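/- Let $K$ be a field of characteristic zero and let $S$ be a smooth del Pezzo surface over $K$, that is, a smooth proper geometrically integral $K$-surface with ample anticanonical divisor $-K_S$. Assume that $S$ has Picard number one, i.e. that $\mathrm{Pic}(S)$ has rank one, and that $S$ contains an $\mathbb{A}^1_K$-cylinder, i.e. a Zariski open subset $U$ isomorphic over $K$ to $Z\times\mathbb{A}^1_K$ for some smooth curve $Z$ over $K$. Then $S$ is $K$-rational, i.e. birational over $K$ to $\mathbb{A}^2_K$ (equivalently, to $\mathbb{P}^2_K$). Moreover, let $\overline{Z}$ be the smooth projective model of $Z$ and let $\varphi\colon S\dashrightarrow\overline{Z}$ be the rational map over $K$ induced by the projection $U\simeq Z\times\mathbb{A}^1_K\to Z$. Then: (a) $\varphi$ is not regular; there is exactly one point of $S$ at which $\varphi$ is not defined, and this point is $K$-rational; (b) $\overline{Z}$ is isomorphic over $K$ to $\mathbb{P}^1_K$. -/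

import Mathlib

open CategoryTheory CategoryTheory.Limits AlgebraicGeometry
open scoped AlgebraicGeometry KaehlerDifferential

universe u

noncomputable section

namespace DelPezzo

section Divisors

variable (X : Scheme.{u}) [IsIntegral X]

/-- The local ring `𝒪_{X,x}` of an integral scheme, as a subring of the function field. -/
def localRing (x : X) : Subring X.functionField :=
  (algebraMap (X.presheaf.stalk x) X.functionField).range

/-- The subgroup `𝒪_{X,x}ˣ` of the multiplicative group of the function field. -/
def localUnits (x : X) : Subgroup (X.functionField)ˣ :=
  (localRing X x).toSubmonoid.units

/-- The group `Fˣ / 𝒪_{X,x}ˣ` of germs at `x` of Cartier divisors, where `F` is the function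
field. -/
def DivisorGerm (x : X) : Type u := (X.functionField)ˣ ⧸ localUnits X x

instance (x : X) : CommGroup (DivisorGerm X x) :=
  inferInstanceAs (CommGroup ((X.functionField)ˣ ⧸ localUnits X x))

/-- The germ at `x` of the principal divisor of a nonzero rational function. -/
def germ (x : X) : (X.functionField)ˣ →* DivisorGerm X x := QuotientGroup.mk' (localUnits X x)

theorem germ_eq_germ_iff (x : X) (f g : (X.functionField)ˣ) :
    germ X x f = germ X x g ↔ f⁻¹ * g ∈ localUnits X x :=
  QuotientGroup.eq

theorem germ_surjective (x : X) : Function.Surjective (germ X x) :=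
  QuotientGroup.mk_surjective

/-- The group of Cartier divisors of an integral scheme `X` with function field `F`, i.e. the
group of global sections of the sheaf `Fˣ / 𝒪ˣ`: families of germs in `Fˣ / 𝒪_{X,x}ˣ` which are
locally given by one rational function (a local equation). The group law is written
multiplicatively, so `D⁻¹` is the divisor usually denoted `-D`, and `D ^ n` is `nD`. -/
def cartierDivisors : Subgroup (∀ x : X, DivisorGerm X x) where
  carrier := {D | ∀ x : X, ∃ U : X.Opens, x ∈ U ∧
    ∃ f : (X.functionField)ˣ, ∀ y ∈ U, D y = germ X y f}
  one_mem' x := ⟨⊤, trivial, 1, fun y _ => (map_one (germ X y)).symm⟩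
  mul_mem' := by
    intro D E hD hE x
    obtain ⟨U, hxU, f, hf⟩ := hD x
    obtain ⟨V, hxV, g, hg⟩ := hE x
    refine ⟨U ⊓ V, ⟨hxU, hxV⟩, f * g, fun y hy => ?_⟩
    rw [Pi.mul_apply, hf y hy.1, hg y hy.2, map_mul]
  inv_mem' := by
    intro D hD x
    obtain ⟨U, hxU, f, hf⟩ := hD x
    refine ⟨U, hxU, f⁻¹, fun y hy => ?_⟩
    rw [Pi.inv_apply, hf y hy, map_inv]

/-- The principal Cartier divisor `div(f)` of a nonzero rational function `f`. -/
def principalDivisor : (X.functionField)ˣ →* cartierDivisors X where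
  toFun f := ⟨fun x => germ X x f, fun _ => ⟨⊤, trivial, f, fun _ _ => rfl⟩⟩
  map_one' := Subtype.ext (funext fun x => map_one (germ X x))
  map_mul' f g := Subtype.ext (funext fun x => map_mul (germ X x) f g)

/-- The Picard group of an integral scheme, as the group of Cartier divisors modulo linear
equivalence. -/
abbrev PicardGroup : Type u := cartierDivisors X ⧸ (principalDivisor X).range

/-- The Picard number: the rank of the Picard group as an abelian group. -/
def picardNumber : ℕ := Module.finrank ℤ (Additive (PicardGroup X))

variable {X}

/-- The Cartier divisor `D` is effective: its local equations are regular functions. -/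
def IsEffective (D : cartierDivisors X) : Prop :=
  ∀ x : X, ∀ d : (X.functionField)ˣ, germ X x d = D.1 x →
    (d : X.functionField) ∈ localRing X x

/-- The Cartier divisor `D` is ample, i.e. the line bundle `𝒪(D)` is ample: `X` is quasi-compact
and every point `x` lies in an affine open of the form `X_f = {y | f generates 𝒪(nD) at y}` for
some `n ≥ 1` and some global section `f` of `𝒪(nD)`. A nonzero rational function `f` is a global
section of `𝒪(nD)` iff `div(f) + nD` is effective, and it generates `𝒪(nD)` at `y` iff the local
equation of `div(f) + nD` at `y` is a unit. -/
def IsAmple (D : cartierDivisors X) : Prop :=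
  CompactSpace X ∧
  ∀ x : X, ∃ n : ℕ, 0 < n ∧ ∃ f : (X.functionField)ˣ,
    IsEffective (principalDivisor X f * D ^ n) ∧
    ∃ U : X.Opens, IsAffineOpen U ∧ x ∈ U ∧
      ∀ y : X, y ∈ U ↔ (principalDivisor X f * D ^ n).1 y = 1

end Divisors

section Canonical

variable {K : Type u} [Field K] {X : Scheme.{u}} [IsIntegral X]

/-- The inclusion of `K` in the function field of an integral `K`-scheme. -/
def toFunctionField (s : X ⟶ Spec (.of K)) : K →+* X.functionField :=
  (X.presheaf.germ ⊤ (genericPoint X) trivial).hom.comp (s.appTop.hom.comp (Scheme.ΓSpecIso (.of K)).inv.hom)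

/-- The stalk at `x` of the sheaf of regular `n`-forms, inside the space `⋀ⁿ Ω_{F/K}` of rational
`n`-forms, where `F` is the function field: the `𝒪_{X,x}`-submodule generated by the forms
`da₁ ∧ ⋯ ∧ daₙ` with `aᵢ ∈ 𝒪_{X,x}` (the image of `⋀ⁿ Ω_{𝒪_{X,x}/K}`). -/
def regularForms (K : Type u) [Field K] (X : Scheme.{u}) [IsIntegral X]
    [Algebra K X.functionField] (n : ℕ) (x : X) :
    Submodule (localRing X x) (⋀[X.functionField]^n Ω[X.functionField⁄K]) :=
  Submodule.span (localRing X x)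
    {w | ∃ a : Fin n → X.functionField, (∀ i, a i ∈ localRing X x) ∧
      w = exteriorPower.ιMulti X.functionField n
        (fun i => KaehlerDifferential.D K X.functionField (a i))}

/-- `D` is a canonical divisor of the `n`-dimensional smooth `K`-scheme `X`: there is a nonzero
rational `n`-form `η` with `D = div(η)`, which means that if `g` is a local equation of `D` at `x`,
then `g⁻¹ η` generates the stalk at `x` of the sheaf of regular `n`-forms. -/
def IsCanonicalDivisor (s : X ⟶ Spec (.of K)) (n : ℕ) (D : cartierDivisors X) : Prop :=
  letI : Algebra K X.functionField := (toFunctionField s).toAlgebra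
  ∃ η : ⋀[X.functionField]^n Ω[X.functionField⁄K], η ≠ 0 ∧
    ∀ x : X, ∀ g : (X.functionField)ˣ, germ X x g = D.1 x →
      regularForms K X n x =
        Submodule.span (localRing X x) {((g⁻¹ : (X.functionField)ˣ) : X.functionField) • η}

/-- A smooth del Pezzo surface over `K`: a smooth proper geometrically integral surface whose
anticanonical divisor is ample (so that it is projective). -/
structure IsSmoothDelPezzoSurface (s : X ⟶ Spec (.of K)) : Prop where
  smooth : SmoothOfRelativeDimension 2 s
  proper : IsProper s
  geometricallyIntegral : GeometricallyIntegral s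
  ample : ∃ D : cartierDivisors X, IsCanonicalDivisor s 2 D ∧ IsAmple D⁻¹

end Canonical

section Curves

variable {K : Type u} [Field K]

/-- A smooth (integral) curve over `K`. -/
structure IsSmoothCurve {Z : Scheme.{u}} (z : Z ⟶ Spec (.of K)) : Prop where
  integral : IsIntegral Z
  smooth : SmoothOfRelativeDimension 1 z
  separated : IsSeparated z
  quasiCompact : QuasiCompact z

/-- The smooth curve `Z'` over `K`, with the open immersion `j : Z ⟶ Z'` over `K`, is a smooth
projective model of the curve `Z` (a proper curve over a field is projective). -/
structure IsSmoothProjectiveModel {Z Z' : Scheme.{u}} (z : Z ⟶ Spec (.of K))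
    (z' : Z' ⟶ Spec (.of K)) (j : Z ⟶ Z') : Prop where
  curve : IsSmoothCurve z'
  proper : IsProper z'
  openImmersion : IsOpenImmersion j
  isOver : j ≫ z' = z

variable (K) in
/-- The affine space `𝔸ⁿ` over `K`. -/
abbrev affineSpace (n : ℕ) : Scheme.{u} := 𝔸(ULift.{u} (Fin n); Spec (.of K))

variable (K) in
/-- The structure morphism of `𝔸ⁿ` over `K`. -/
abbrev affineSpaceHom (n : ℕ) : affineSpace K n ⟶ Spec (.of K) :=
  𝔸(ULift.{u} (Fin n); Spec (.of K)) ↘ Spec (.of K)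

attribute [local instance] MvPolynomial.gradedAlgebra

variable (K) in
/-- The projective space `ℙⁿ` over `K`, i.e. `Proj K[x₀, …, xₙ]`. -/
abbrev projectiveSpace (n : ℕ) : Scheme.{u} :=
  Proj (MvPolynomial.homogeneousSubmodule (Fin (n + 1)) K)

variable (K) in
/-- The structure morphism of `ℙⁿ` over `K`. -/
abbrev projectiveSpaceHom (n : ℕ) : projectiveSpace K n ⟶ Spec (.of K) :=
  Proj.toSpecZero (MvPolynomial.homogeneousSubmodule (Fin (n + 1)) K) ≫
    Spec.map (CommRingCat.ofHom
      (algebraMap K (MvPolynomial.homogeneousSubmodule (Fin (n + 1)) K 0)))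

/-- The product `Z × 𝔸¹` over `K`. -/
abbrev cylinder {Z : Scheme.{u}} (z : Z ⟶ Spec (.of K)) : Scheme.{u} :=
  pullback z (affineSpaceHom K 1)

/-- The projection `Z × 𝔸¹ ⟶ Z`. -/
abbrev cylinderProj {Z : Scheme.{u}} (z : Z ⟶ Spec (.of K)) : cylinder z ⟶ Z :=
  pullback.fst z (affineSpaceHom K 1)

/-- An open immersion over `K` of `Z × 𝔸¹` in `S`, i.e. an isomorphism of `Z × 𝔸¹` with an open
subscheme of `S`: a cylinder in `S`. -/
structure IsCylinder {S Z : Scheme.{u}} (s : S ⟶ Spec (.of K)) (z : Z ⟶ Spec (.of K))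
    (i : cylinder z ⟶ S) : Prop where
  openImmersion : IsOpenImmersion i
  isOver : i ≫ s = cylinderProj z ≫ z

theorem isDominant_cylinder {S Z : Scheme.{u}} [IsIntegral S] {s : S ⟶ Spec (.of K)}
    {z : Z ⟶ Spec (.of K)} {i : cylinder z ⟶ S} (hz : IsSmoothCurve z)
    (hi : IsCylinder s z i) : IsDominant i := by
  have := hi.openImmersion
  have := hz.integral
  have : Surjective (cylinderProj z) := inferInstance
  have hne : Nonempty (cylinder z) :=
    ⟨((cylinderProj z).surjective (Nonempty.some inferInstance)).choose⟩
  exact ⟨i.isOpenEmbedding.isOpen_range.dense (Set.range_nonempty i)⟩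

/-- The rational map `S ⇢ Z'` that is induced by the projection `Z × 𝔸¹ ⟶ Z` of a cylinder
`i : Z × 𝔸¹ ⟶ S`, where `j : Z ⟶ Z'`: it is represented by `j ∘ pr_Z ∘ i⁻¹` on the image
of `i`. -/
def inducedMap {S Z Z' : Scheme.{u}} [IsIntegral S] {s : S ⟶ Spec (.of K)}
    {z : Z ⟶ Spec (.of K)} {i : cylinder z ⟶ S} (hz : IsSmoothCurve z)
    (hi : IsCylinder s z i) (j : Z ⟶ Z') : S ⤏ Z' :=
  haveI := hi.openImmersion
  haveI := isDominant_cylinder hz hi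
  (i.partialIso.symm.toPartialMap.compHom (cylinderProj z ≫ j)).toRationalMap

end Curves

end DelPezzo

end

/-! Write `k` for the function field of the curve and `F` for that of `S`. The cylinder makes `F =
k(t)`, with `t` the coordinate along the fibres. Let `v` be the place of `F` over `k` at `t = ∞`;
geometrically it is the section at infinity of the cylinder. Everything is read off from the center
of `v` on `S`.

Call `q` in `S` fundamental if some `x` in `k` satisfies neither `x ∈ 𝒪_q` nor `x⁻¹ ∈ 𝒪_q`. If `q`
is not fundamental, `𝒪_q ∩ k` is a valuation ring of `k`, and it has a center on a proper curve. So
the points where the rational map to the proper model is undefined are exactly the fundamental ones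
(`compl_domain_eq`).

At a fundamental point, normality of `𝒪_q` yields a valuation ring `W` that dominates `𝒪_q` and in
which the residue of `x` is transcendental over that of `𝒪_q`. Then `W` contains `k`, since `k` has
transcendence degree one over `K`; and `t ∉ W`, since otherwise `q` would lie in the cylinder. Only
the ring of `v` has these properties, so `q` is the center of `v` and is unique by separatedness
(`dominates_of_isFundamental`). The residues of `𝒪_q` are algebraic over `K`, hence lie in `K`,
because geometric integrality makes `K` algebraically closed in `F`. So `q` is `K`-rational.

A fundamental point exists because the Picard number is one (`exists_isFundamental`). If there were
none, a function `x` in `k` vanishing along a fibre would have a Cartier divisor of poles, disjoint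
from the closure of that fibre. This divisor is either torsion, which makes `x` constant, or
proportional to an ample divisor up to torsion. In the second case a power of the ample bundle is
trivial near the closed fibre, so this complete curve lies in an affine open set and `t` is
algebraic on it, which is absurd.

The curve is rational by Zariski's argument (`IsTwoGeneratedAtCenter.exists_adjoin_eq_top`). Blow up
the center of `v`, which is a regular `K`-rational point, and repeat. After finitely many steps `v`
dominates the generic point of an exceptional line, whose coordinate `τ` generates the residue field
`k` of `v`. Then `F = K(τ, t)`, so `S` is rational, and the proper regular curve with function field
`K(τ)` is the projective line. -/

section ValuationRings

/-! ### Valuation rings dominating a normal local ring. -/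

open Polynomial

/-- If `R` is an integrally closed local subring of a field and neither `x` nor `x⁻¹` lies in `R`,
then a polynomial relation of `x` over `R` has no unit coefficient. -/
theorem Subring.not_isUnit_coeff_of_aeval_eq_zero {F : Type*} [Field F] (R : Subring F)
    [IsLocalRing R] (hR : ∀ y : F, IsIntegral R y → y ∈ R) {x : F} (hx : x ∉ R) (hx' : x⁻¹ ∉ R)
    (P : R[X]) (hP : aeval x P = 0) (i : ℕ) : ¬ IsUnit (P.coeff i) := by
  obtain ⟨n, hn⟩ : ∃ n, P.natDegree ≤ n := ⟨_, le_rfl⟩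
  -- Induction on a degree bound. For the leading coefficient `a`, the product `a * x` is integral
  -- over `R`, hence in `R`, so the leading term can be absorbed into the coefficient one degree
  -- lower. Here `a` is a nonunit because `x ∉ R`, and `a * x` is a nonunit because `x⁻¹ ∉ R`;
  -- adding a nonunit does not change whether a coefficient is a unit.
  induction n generalizing P i with
  | zero =>
    rw [natDegree_eq_zero.mp (Nat.le_zero.mp hn) |>.choose_spec.symm] at hP ⊢
    rw [aeval_C] at hP
    rw [(FaithfulSMul.algebraMap_eq_zero_iff R F).mp hP]
    simp
  | succ n ih =>
    by_cases hd : P.natDegree ≤ n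
    · exact ih P hP i hd
    have hd : P.natDegree = n + 1 := by omega
    set a := P.coeff (n + 1) with ha
    have hax : (a : F) * x ∈ R := by
      apply hR
      have := isIntegral_leadingCoeff_smul P x hP
      rwa [leadingCoeff, hd, ← ha, Algebra.smul_def] at this
    have ha_nu : ¬ IsUnit a := by
      intro h
      obtain ⟨b, hb⟩ := h.exists_left_inv
      apply hx
      have : x = (b : F) * (a * x) := by
        rw [← mul_assoc, ← Subring.coe_mul, hb]; simp
      rw [this]
      exact R.mul_mem b.2 hax
    have hax_nu : ¬ IsUnit (⟨_, hax⟩ : R) := by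
      intro h
      obtain ⟨b, hb⟩ := h.exists_left_inv
      apply hx'
      have hb' : (b : F) * (a * x) = 1 := congrArg Subtype.val hb
      have : x⁻¹ = (b : F) * a := inv_eq_of_mul_eq_one_left (by rw [mul_assoc]; exact hb')
      rw [this]
      exact R.mul_mem b.2 a.2
    let Q : R[X] := P.erase (n + 1) + monomial n ⟨_, hax⟩
    have hPQ : P = monomial (n + 1) a + P.erase (n + 1) := (monomial_add_erase P (n + 1)).symm
    have hQ0 : aeval x Q = 0 := by
      rw [hPQ, map_add] at hP
      simp only [Q, map_add, aeval_monomial] at hP ⊢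
      rw [add_comm, ← hP]
      congr 1
      change (a : F) * x * x ^ n = a * x ^ (n + 1)
      ring
    have hQd : Q.natDegree ≤ n := by
      refine (natDegree_add_le _ _).trans (max_le ?_ (natDegree_monomial_le _))
      refine natDegree_le_iff_coeff_eq_zero.mpr fun N hN => ?_
      rw [coeff_erase]
      split_ifs with h
      · rfl
      · exact coeff_eq_zero_of_natDegree_lt (by omega)
    have hc : ∀ j, ¬ IsUnit (Q.coeff j) := fun j => ih Q hQ0 j hQd
    have := hc i
    simp only [Q, coeff_add, coeff_erase, coeff_monomial] at this
    by_cases hi : i = n + 1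
    · rw [hi]; exact ha_nu
    rw [if_neg hi] at this
    split_ifs at this with h
    · intro hu
      have h3 := IsLocalRing.nonunits_add (a := P.coeff i + ⟨_, hax⟩) (b := -⟨_, hax⟩) this
        (by simpa [mem_nonunits_iff] using hax_nu)
      exact h3 (by simpa using hu)
    · simpa using this

/-- Relations of `x` have all coefficients in the maximal ideal `𝔪`, so the kernel of `R[X] → R[x]`
lies in the prime `𝔪 R[X]`, and `𝔪 R[x]` is prime. A valuation ring dominating the localization of
`R[x]` there is as required; the last property says that the residue of `x` is transcendental over
the residue field of `R`. -/
theorem Subring.exists_valuationSubring_of_notMem {F : Type*} [Field F] (R : Subring F)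
    [IsLocalRing R] (hR : ∀ y : F, IsIntegral R y → y ∈ R) {x : F} (hx : x ∉ R) (hx' : x⁻¹ ∉ R) :
    ∃ W : ValuationSubring F, R ≤ W.toSubring ∧ (∀ r : R, ¬ IsUnit r → (r : F) ∈ W.nonunits) ∧
      ∀ P : R[X], (∃ i, IsUnit (P.coeff i)) → aeval x P ∈ W ∧ aeval x P ∉ W.nonunits := by
  let A : Subring F := (aeval x : R[X] →ₐ[R] F).toRingHom.range
  let f : R[X] →+* A := (aeval x : R[X] →ₐ[R] F).toRingHom.rangeRestrict
  have hf : Function.Surjective f := RingHom.rangeRestrict_surjective _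
  let 𝔓 : Ideal R[X] := (IsLocalRing.maximalIdeal R).map C
  have hmem : ∀ P : R[X], P ∈ 𝔓 ↔ ∀ i, ¬ IsUnit (P.coeff i) := fun P => by
    rw [Ideal.mem_map_C_iff]; rfl
  have hprime : 𝔓.IsPrime := Ideal.isPrime_map_C_of_isPrime
  have hker : RingHom.ker f ≤ 𝔓 := by
    intro P hP
    rw [hmem]
    apply R.not_isUnit_coeff_of_aeval_eq_zero hR hx hx'
    exact congrArg Subtype.val hP
  have hp : (𝔓.map f).IsPrime := Ideal.map_isPrime_of_surjective hf hker
  obtain ⟨W, hW⟩ := (LocalSubring.ofPrime A (𝔓.map f)).exists_le_valuationSubring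
  have hAO := LocalSubring.le_ofPrime A (𝔓.map f)
  have hmap : ∀ P : R[X], f P ∈ 𝔓.map f ↔ P ∈ 𝔓 := fun P => by
    rw [← Ideal.mem_comap, Ideal.comap_map_of_surjective f hf, sup_eq_left.mpr]
    exact (Ideal.comap_mono bot_le).trans hker
  have hunit : ∀ a : A, a ∉ 𝔓.map f → (a : F) ∈ W ∧ (a : F) ∉ W.nonunits := by
    intro a ha
    have h1 := IsLocalization.map_units (LocalSubring.ofPrime A (𝔓.map f)).toSubring
      (⟨a, ha⟩ : (𝔓.map f).primeCompl)
    have h2 := h1.map (Subring.inclusion hW.1)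
    refine ⟨hW.1 (hAO a.2), fun h => ?_⟩
    obtain ⟨h3, h4⟩ := ValuationSubring.mem_nonunits_iff_exists_mem_maximalIdeal.mp h
    exact h4 h2
  have hnon : ∀ a : A, a ∈ 𝔓.map f → (a : F) ∈ W.nonunits := by
    intro a ha
    rw [ValuationSubring.mem_nonunits_iff_exists_mem_maximalIdeal]
    refine ⟨hW.1 (hAO a.2), fun h => ?_⟩
    have h2 : IsUnit (⟨a, hAO a.2⟩ : (LocalSubring.ofPrime A (𝔓.map f)).toSubring) := hW.2.1 _ h
    exact (IsLocalization.AtPrime.isUnit_to_map_iff _ (𝔓.map f) a).mp h2 ha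
  refine ⟨W, ?_, ?_, ?_⟩
  · intro r hr
    exact hW.1 (hAO ⟨C ⟨r, hr⟩, aeval_C x (⟨r, hr⟩ : R)⟩)
  · intro r hr
    have := hnon (f (C r)) ((hmap _).mpr ?_)
    · exact (show ((f (C r) : A) : F) = r from aeval_C x r) ▸ this
    · exact Ideal.mem_map_of_mem _ hr
  · rintro P ⟨i, hi⟩
    exact hunit (f P) (fun h => (hmem P).mp ((hmap P).mp h) i hi)

end ValuationRings

/-! ### Function fields of transcendence degree one. -/

section TranscendenceDegreeOne

open Polynomial IntermediateField

variable {K k F : Type*} [Field K] [Field k] [Field F] [Algebra K k] [Algebra k F] [Algebra K F]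

omit [Algebra K F] in
/-- A valuation ring of `F ⊇ k` in which all nonzero polynomials in `ξ ∈ k` are units contains `k`
if `k` is algebraic over `K(ξ)`. -/
theorem ValuationSubring.algebraMap_mem_of_isAlgebraic_adjoin (W : ValuationSubring F) {ξ : k}
    (halg : Algebra.IsAlgebraic K⟮ξ⟯ k)
    (hW : ∀ P : K[X], P ≠ 0 → algebraMap k F (aeval ξ P) ∈ W ∧
      algebraMap k F (aeval ξ P) ∉ W.nonunits) (y : k) : algebraMap k F y ∈ W := by
  let W' : ValuationSubring k := W.comap (algebraMap k F)
  have hadj : ∀ z ∈ K⟮ξ⟯, z ∈ W' := by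
    intro z hz
    obtain ⟨p, q, rfl⟩ := IntermediateField.mem_adjoin_simple_iff K z |>.mp hz
    rw [ValuationSubring.mem_comap, map_div₀]
    by_cases hp : p = 0
    · simp [hp]
    by_cases hq : q = 0
    · simp [hq]
    rw [div_eq_mul_inv]
    refine W.mul_mem _ _ (hW p hp).1 ?_
    have := (hW q hq).2
    rw [ValuationSubring.mem_nonunits_iff_or] at this
    push Not at this
    exact this.2
  let f : K⟮ξ⟯ →+* W' := (algebraMap K⟮ξ⟯ k).codRestrict W' fun z => hadj z z.2
  have h1 : IsIntegral K⟮ξ⟯ y := (halg.isAlgebraic y).isIntegral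
  have h2 : IsIntegral W' y := by
    obtain ⟨P, hP, hP0⟩ := h1
    exact ⟨P.map f, hP.map f, by rw [eval₂_map]; exact hP0⟩
  obtain ⟨z, hz⟩ := IsIntegrallyClosed.isIntegral_iff.mp h2
  rw [← hz]
  exact z.2

theorem Subring.aeval_mem_of_coeff_isUnit (R : Subring F) (hKR : ∀ c : K, algebraMap K F c ∈ R)
    {W : ValuationSubring F} {x : F}
    (hW : ∀ P : R[X], (∃ i, IsUnit (P.coeff i)) → aeval x P ∈ W ∧ aeval x P ∉ W.nonunits)
    (P : K[X]) (hP : P ≠ 0) : aeval x P ∈ W ∧ aeval x P ∉ W.nonunits := by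
  let κ : K →+* R := (algebraMap K F).codRestrict R hKR
  obtain ⟨i, hi⟩ : ∃ i, P.coeff i ≠ 0 := by
    by_contra! h
    exact hP (Polynomial.ext h)
  have h1 : aeval x (P.map κ) = aeval x P := by
    rw [aeval_def, eval₂_map, aeval_def]
    rfl
  rw [← h1]
  apply hW
  refine ⟨i, ?_⟩
  rw [coeff_map]
  exact (IsUnit.mk0 _ hi).map κ

theorem Subring.mem_of_isAlgebraic (R : Subring F)
    (hR : ∀ y : F, IsIntegral R y → y ∈ R) (hKR : ∀ c : K, algebraMap K F c ∈ R) {x : F}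
    (hx : IsAlgebraic K x) : x ∈ R := by
  let κ : K →+* R := (algebraMap K F).codRestrict R hKR
  obtain ⟨P, hP, hP0⟩ := hx.isIntegral
  exact hR _ ⟨P.map κ, hP.map κ, by rw [eval₂_map]; exact hP0⟩

/-- A normal local ring with field of fractions `k` of transcendence degree one over `K` is a
valuation ring. -/
theorem Subring.mem_or_inv_mem_of_isAlgebraic_adjoin (R : Subring k) [IsLocalRing R]
    (hR : ∀ y : k, IsIntegral R y → y ∈ R) (hKR : ∀ c : K, algebraMap K k c ∈ R)
    (hfrac : ∀ y : k, ∃ a ∈ R, ∃ b ∈ R, b ≠ 0 ∧ y * b = a)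
    (htr : ∀ ξ : k, Transcendental K ξ → Algebra.IsAlgebraic K⟮ξ⟯ k) (x : k) :
    x ∈ R ∨ x⁻¹ ∈ R := by
  by_contra! ⟨hx, hx'⟩
  have hxt : Transcendental K x := fun h => hx (R.mem_of_isAlgebraic hR hKR h)
  obtain ⟨W, hRW, hnu, hW⟩ := R.exists_valuationSubring_of_notMem hR hx hx'
  -- `W` is the whole field, yet nonunits of `R` remain nonunits in `W`. So `R` has no nonzero
  -- nonunit, and it is equal to its field of fractions.
  have htop : ∀ y : k, y ∈ W := W.algebraMap_mem_of_isAlgebraic_adjoin (k := k) (htr x hxt)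
    (R.aeval_mem_of_coeff_isUnit hKR hW)
  obtain ⟨a, ha, b, hb, hb0, hab⟩ := hfrac x
  have hbu : IsUnit (⟨b, hb⟩ : R) := by
    by_contra h
    have := hnu _ h
    rw [ValuationSubring.mem_nonunits_iff_or] at this
    exact this.elim hb0 fun h => h (htop _)
  obtain ⟨⟨c, hc⟩, hcb⟩ := hbu.exists_right_inv
  have hcb' : b * c = 1 := congrArg Subtype.val hcb
  apply hx
  have : x = a * c := by rw [← hab, mul_assoc, hcb', mul_one]
  rw [this]
  exact R.mul_mem ha hc

theorem isAlgebraic_adjoin_of_trdeg_eq_one (h : Algebra.trdeg K k = 1) (ξ : k)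
    (hξ : Transcendental K ξ) : Algebra.IsAlgebraic K⟮ξ⟯ k := by
  have h1 : AlgebraicIndependent K (fun _ : Unit => ξ) :=
    (algebraicIndependent_unique_type_iff (ι := Unit)).mpr hξ
  have h2 := h1.isTranscendenceBasis_of_lift_trdeg_le (by simp [h]) (by simp [h])
  have h3 := h2.isAlgebraic_field
  rw [show Set.range (fun _ : Unit => ξ) = {ξ} from Set.range_const] at h3
  exact h3

end TranscendenceDegreeOne

/-! ### Rational places and the place at infinity of `k(t)`. -/

section Place

open Polynomial WithZero

/-- A discrete valuation `v` of `F ⊇ k`, trivial on `k`, whose residue field is `k`. -/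
structure IsRationalPlace (k : Type*) {F : Type*} [Field k] [Field F] [Algebra k F]
    (v : Valuation F (WithZero (Multiplicative ℤ))) : Prop where
  map_algebraMap : ∀ c : k, c ≠ 0 → v (algebraMap k F c) = 1
  exists_residue : ∀ a : F, v a ≤ 1 → ∃ c : k, v (a - algebraMap k F c) < 1

/-- The place at infinity of a rational function field. -/
theorem exists_isRationalPlace_ratFunc {k F : Type*} [Field k] [Field F] [Algebra k F]
    (e : RatFunc k ≃ₐ[k] F) :
    ∃ v : Valuation F (WithZero (Multiplicative ℤ)), IsRationalPlace k v ∧ 1 < v (e RatFunc.X) := by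
  classical
  let v₀ := RatFunc.inftyValuation k
  let v := v₀.comap (e.symm : F →+* RatFunc k)
  refine ⟨v, ⟨?_, ?_⟩, ?_⟩
  · intro c hc
    change v₀ (e.symm (algebraMap k F c)) = 1
    rw [AlgEquiv.commutes, RatFunc.algebraMap_eq_C]
    exact RatFunc.inftyValuation.C k hc
  · intro a ha
    obtain ⟨f, rfl⟩ := e.surjective a
    change v₀ (e.symm (e f)) ≤ 1 at ha
    rw [AlgEquiv.symm_apply_apply] at ha
    suffices h : ∃ c : k, v₀ (f - RatFunc.C c) < 1 by
      obtain ⟨c, hc⟩ := h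
      refine ⟨c, ?_⟩
      change v₀ (e.symm (e f - algebraMap k F c)) < 1
      rwa [map_sub, AlgEquiv.symm_apply_apply, AlgEquiv.commutes, RatFunc.algebraMap_eq_C]
    have hpoly : ∀ p : k[X], p ≠ 0 → v₀ (algebraMap k[X] (RatFunc k) p) = exp (p.natDegree : ℤ) :=
      fun p hp => RatFunc.inftyValuation.polynomial k hp
    set p := f.num
    set q := f.denom
    have hq0 : q ≠ 0 := f.denom_ne_zero
    have hq0' : algebraMap k[X] (RatFunc k) q ≠ 0 := by simpa using hq0
    have hf : f = algebraMap k[X] (RatFunc k) p / algebraMap k[X] (RatFunc k) q :=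
      (RatFunc.num_div_denom f).symm
    have hle : p.natDegree ≤ q.natDegree := by
      by_cases hp : p = 0
      · simp [hp]
      rw [hf, map_div₀, hpoly p hp, hpoly q hq0, ← exp_sub, ← exp_zero, exp_le_exp] at ha
      omega
    have key : ∀ r : k[X], r.degree < q.degree →
        v₀ (algebraMap k[X] (RatFunc k) r / algebraMap k[X] (RatFunc k) q) < 1 := by
      intro r hr
      by_cases hr0 : r = 0
      · simp [hr0]
      rw [map_div₀, hpoly r hr0, hpoly q hq0, ← exp_sub, ← exp_zero, exp_lt_exp]
      have := natDegree_lt_natDegree hr0 hr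
      omega
    -- The value of `p / q` at infinity: zero if `deg p < deg q`, and the quotient of the leading
    -- coefficients if the degrees agree. In both cases `p - c * q` has degree below that of `q`.
    set c := p.coeff q.natDegree / q.leadingCoeff
    have hlc : q.leadingCoeff ≠ 0 := by simpa using hq0
    refine ⟨c, ?_⟩
    have : f - RatFunc.C c = algebraMap k[X] (RatFunc k) (p - C c * q) /
        algebraMap k[X] (RatFunc k) q := by
      rw [hf, map_sub, map_mul, sub_div, mul_div_assoc, div_self hq0', mul_one,
        RatFunc.algebraMap_C]
    rw [this]
    apply key
    rw [degree_eq_natDegree hq0, degree_lt_iff_coeff_zero]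
    intro m hm
    rw [coeff_sub, coeff_C_mul]
    rcases hm.eq_or_lt with h | h
    · rw [← h]
      simp only [c, coeff_natDegree]
      field_simp
      simp
    · rw [coeff_eq_zero_of_natDegree_lt (by omega), coeff_eq_zero_of_natDegree_lt h]
      simp
  · change 1 < v₀ (e.symm (e RatFunc.X))
    rw [AlgEquiv.symm_apply_apply, RatFunc.inftyValuation.X, ← exp_zero, exp_lt_exp]
    norm_num

namespace IsRationalPlace

variable {k F : Type*} [Field k] [Field F] [Algebra k F]
  {v : Valuation F (WithZero (Multiplicative ℤ))}

theorem map_algebraMap_le (hv : IsRationalPlace k v) (c : k) : v (algebraMap k F c) ≤ 1 := by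
  by_cases hc : c = 0
  · simp [hc]
  · exact (hv.map_algebraMap c hc).le

theorem le_one (hv : IsRationalPlace k v) {a : F} {c : k} (h : v (a - algebraMap k F c) < 1) :
    v a ≤ 1 := by
  rw [show a = (a - algebraMap k F c) + algebraMap k F c by ring]
  exact (v.map_add _ _).trans (max_le h.le (hv.map_algebraMap_le c))

theorem residue_unique (hv : IsRationalPlace k v) {a : F} {c d : k}
    (h : v (a - algebraMap k F c) < 1) (h' : v (a - algebraMap k F d) < 1) : c = d := by
  by_contra hcd
  have h1 := hv.map_algebraMap (c - d) (sub_ne_zero.mpr hcd)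
  have h2 : algebraMap k F (c - d) = (a - algebraMap k F d) - (a - algebraMap k F c) := by
    rw [map_sub]; ring
  rw [h2] at h1
  exact ((v.map_sub _ _).trans_lt (max_lt h' h)).ne h1

theorem residue_mul (hv : IsRationalPlace k v) {a b : F} {c d : k}
    (h : v (a - algebraMap k F c) < 1) (h' : v (b - algebraMap k F d) < 1) :
    v (a * b - algebraMap k F (c * d)) < 1 := by
  have : a * b - algebraMap k F (c * d) =
      (a - algebraMap k F c) * b + algebraMap k F c * (b - algebraMap k F d) := by
    rw [map_mul]; ring
  rw [this]
  refine (v.map_add _ _).trans_lt (max_lt ?_ ?_)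
  · rw [map_mul]
    exact mul_lt_one_of_lt_of_le h (hv.le_one h')
  · rw [map_mul, mul_comm]
    exact mul_lt_one_of_lt_of_le h' (hv.map_algebraMap_le c)

theorem residue_algebraMap (c : k) : v (algebraMap k F c - algebraMap k F c) < 1 := by simp

theorem residue_pow (hv : IsRationalPlace k v) {a : F} {c : k}
    (h : v (a - algebraMap k F c) < 1) (n : ℕ) : v (a ^ n - algebraMap k F (c ^ n)) < 1 := by
  induction n with
  | zero => simp
  | succ n ih => rw [pow_succ, pow_succ]; exact hv.residue_mul ih h

theorem residue_sum {ι : Type*} (s : Finset ι) {a : ι → F} {c : ι → k}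
    (h : ∀ i ∈ s, v (a i - algebraMap k F (c i)) < 1) :
    v (∑ i ∈ s, a i - algebraMap k F (∑ i ∈ s, c i)) < 1 := by
  rw [map_sum, ← Finset.sum_sub_distrib]
  exact v.map_sum_lt one_ne_zero h

theorem eq_one_of_residue_ne_zero (hv : IsRationalPlace k v) {a : F} {c : k}
    (h : v (a - algebraMap k F c) < 1) (hc : c ≠ 0) : v a = 1 := by
  refine le_antisymm (hv.le_one h) ?_
  by_contra! h'
  exact hc (hv.residue_unique h (by simpa using h'))

end IsRationalPlace

end Place

/-! ### Zariski's theorem: successive blowing up of the center of a place. -/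

section Zariski

open Polynomial IntermediateField

variable {K k F : Type*} [Field K] [Field k] [Field F] [Algebra K k] [Algebra k F] [Algebra K F]
  [IsScalarTower K k F]

/-- A subring `R` of the valuation ring of a place, with residue field `K` at the center of the
place, whose maximal ideal at the center is generated by the two elements `x` and `y`. -/
structure IsTwoGeneratedAtCenter (k : Type*) [Field k] [Algebra K k] [Algebra k F]
    (v : Valuation F (WithZero (Multiplicative ℤ))) (R : Subalgebra K F) (x y : F) : Prop where
  noetherian : IsNoetherianRing R
  exists_residue : ∀ r ∈ R, ∃ c : K, v (r - algebraMap k F (algebraMap K k c)) < 1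
  left_mem : x ∈ R
  right_mem : y ∈ R
  left_lt : v x < 1
  right_lt : v y < 1
  exists_eq : ∀ r ∈ R, v r < 1 → ∃ a ∈ R, ∃ b ∈ R, r = a * x + b * y
  exists_mul_eq : ∀ u : F, ∃ g ∈ R, ∃ f ∈ R, g ≠ 0 ∧ u * g = f

namespace IsTwoGeneratedAtCenter

variable {v : Valuation F (WithZero (Multiplicative ℤ))} {R : Subalgebra K F} {x y : F}

omit [IsScalarTower K k F] in
theorem symm (h : IsTwoGeneratedAtCenter k v R x y) : IsTwoGeneratedAtCenter k v R y x where
  noetherian := h.noetherian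
  exists_residue := h.exists_residue
  left_mem := h.right_mem
  right_mem := h.left_mem
  left_lt := h.right_lt
  right_lt := h.left_lt
  exists_eq r hr hr' := by
    obtain ⟨a, ha, b, hb, e⟩ := h.exists_eq r hr hr'
    exact ⟨b, hb, a, ha, by rw [e, add_comm]⟩
  exists_mul_eq := h.exists_mul_eq

/-- The ideal of elements of `R` that vanish at the center of the place. -/
def centerIdeal (h : IsTwoGeneratedAtCenter k v R x y) : Ideal R :=
  Ideal.span {⟨x, h.left_mem⟩, ⟨y, h.right_mem⟩}

omit [IsScalarTower K k F] in
theorem mem_centerIdeal (h : IsTwoGeneratedAtCenter k v R x y) (r : R) (hr : v r < 1) :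
    r ∈ h.centerIdeal := by
  obtain ⟨a, ha, b, hb, e⟩ := h.exists_eq r r.2 hr
  rw [centerIdeal, Ideal.mem_span_pair]
  exact ⟨⟨a, ha⟩, ⟨b, hb⟩, Subtype.ext e.symm⟩

omit [IsScalarTower K k F] in
theorem valuation_lt_of_mem_centerIdeal (hv : IsRationalPlace k v)
    (h : IsTwoGeneratedAtCenter k v R x y) (r : R) (hr : r ∈ h.centerIdeal) : v r < 1 := by
  rw [centerIdeal, Ideal.mem_span_pair] at hr
  obtain ⟨a, b, rfl⟩ := hr
  obtain ⟨c, hc⟩ := h.exists_residue a a.2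
  obtain ⟨d, hd⟩ := h.exists_residue b b.2
  refine (v.map_add _ _).trans_lt (max_lt ?_ ?_)
  · change v ((a : F) * x) < 1
    rw [map_mul, mul_comm]
    exact mul_lt_one_of_lt_of_le h.left_lt (hv.le_one hc)
  · change v ((b : F) * y) < 1
    rw [map_mul, mul_comm]
    exact mul_lt_one_of_lt_of_le h.right_lt (hv.le_one hd)

omit [IsScalarTower K k F] in
-- Elements of `(x, y)ⁿ` are forms of degree `n` in `x` and `y` with coefficients in `R`; `P` is
-- such a form dehomogenized by `xⁿ`.
theorem exists_form_of_mem_pow (h : IsTwoGeneratedAtCenter k v R x y) (hx : x ≠ 0) (n : ℕ) (f : R)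
    (hf : f ∈ h.centerIdeal ^ n) :
    ∃ P : R[X], P.natDegree ≤ n ∧ (f : F) = x ^ n * aeval (y / x) P := by
  induction n generalizing f with
  | zero => exact ⟨C f, by simp, by rw [aeval_C]; simp⟩
  | succ n ih =>
    rw [pow_succ'] at hf
    refine Submodule.mul_induction_on hf ?_ ?_
    · intro m hm r hr
      rw [centerIdeal, Ideal.mem_span_pair] at hm
      obtain ⟨a, b, rfl⟩ := hm
      obtain ⟨P, hP, e⟩ := ih r hr
      refine ⟨(C a + C b * X) * P, ?_, ?_⟩
      · refine natDegree_mul_le.trans ?_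
        have : (C a + C b * X : R[X]).natDegree ≤ 1 := by
          rw [add_comm]; exact natDegree_linear_le
        omega
      · simp only [map_mul, map_add, aeval_C, aeval_X]
        change ((a : F) * x + b * y) * r = x ^ (n + 1) * (((a : F) + b * (y / x)) * _)
        rw [e]
        field_simp
        ring
    · rintro r s ⟨P, hP, e⟩ ⟨Q, hQ, e'⟩
      refine ⟨P + Q, natDegree_add_le_of_degree_le hP hQ, ?_⟩
      rw [map_add, mul_add, ← e, ← e']
      rfl

omit [IsScalarTower K k F] in
theorem mem_pow_of_coeff_mem (h : IsTwoGeneratedAtCenter k v R x y) (hx : x ≠ 0) (n : ℕ) (f : R)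
    (P : R[X]) (hP : P.natDegree ≤ n) (e : (f : F) = x ^ n * aeval (y / x) P)
    (hc : ∀ i, P.coeff i ∈ h.centerIdeal) : f ∈ h.centerIdeal ^ (n + 1) := by
  have hf : f = ∑ i ∈ Finset.range (n + 1),
      P.coeff i * (⟨x, h.left_mem⟩ ^ (n - i) * ⟨y, h.right_mem⟩ ^ i) := by
    apply Subtype.ext
    rw [e, aeval_eq_sum_range' (Nat.lt_succ_of_le hP), Finset.mul_sum]
    push_cast
    refine Finset.sum_congr rfl fun i hi => ?_
    rw [Algebra.smul_def]
    change x ^ n * ((P.coeff i : F) * _) = _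
    obtain ⟨m, rfl⟩ := Nat.exists_eq_add_of_le (Nat.lt_succ_iff.mp (Finset.mem_range.mp hi))
    rw [Nat.add_sub_cancel_left, pow_add, div_pow]
    field_simp
  rw [hf]
  refine Ideal.sum_mem _ fun i hi => ?_
  rw [pow_succ']
  refine Ideal.mul_mem_mul (hc i) ?_
  obtain ⟨m, rfl⟩ := Nat.exists_eq_add_of_le (Nat.lt_succ_iff.mp (Finset.mem_range.mp hi))
  rw [Nat.add_sub_cancel_left, add_comm, pow_add]
  exact Ideal.mul_mem_mul (Ideal.pow_mem_pow (Ideal.subset_span (by simp)) _)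
    (Ideal.pow_mem_pow (Ideal.subset_span (by simp)) _)

omit [IsScalarTower K k F] in
/-- If the residue `τ` of `y / x` is transcendental, every element of `R` is a power of `x` times
an element with nonzero residue in `K(τ)`. -/
theorem exists_leading_form (hv : IsRationalPlace k v) (h : IsTwoGeneratedAtCenter k v R x y)
    (hx : x ≠ 0) {τ : k} (hτ : v (y / x - algebraMap k F τ) < 1) (htr : Transcendental K τ)
    (f : F) (hf : f ∈ R) (hf0 : f ≠ 0) :
    ∃ (n : ℕ) (f' : F) (w : k), w ∈ K⟮τ⟯ ∧ w ≠ 0 ∧ f = x ^ n * f' ∧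
      v (f' - algebraMap k F w) < 1 := by
  have := h.noetherian
  have htop : h.centerIdeal ≠ ⊤ := by
    rw [Ideal.ne_top_iff_one]
    intro h1
    simpa using h.valuation_lt_of_mem_centerIdeal hv 1 h1
  -- By Krull's intersection theorem `f` has a finite order `n` at the center. Its form of degree
  -- `n` therefore has a coefficient that does not vanish there, and the reduction `Q` of this form
  -- is nonzero.
  have hkrull := Ideal.iInf_pow_eq_bot_of_isDomain _ htop
  obtain ⟨n, hn, hn'⟩ : ∃ n, (⟨f, hf⟩ : R) ∈ h.centerIdeal ^ n ∧
      (⟨f, hf⟩ : R) ∉ h.centerIdeal ^ (n + 1) := by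
    by_contra! H
    have : ∀ n, (⟨f, hf⟩ : R) ∈ h.centerIdeal ^ n := fun n => by
      induction n with
      | zero => simp
      | succ n ih => exact H n ih
    have h0 : (⟨f, hf⟩ : R) ∈ (⊥ : Ideal R) := by
      rw [← hkrull]
      exact (Submodule.mem_iInf _).mpr this
    exact hf0 (congrArg Subtype.val ((Submodule.mem_bot R).mp h0))
  obtain ⟨P, hP, e⟩ := h.exists_form_of_mem_pow hx n _ hn
  obtain ⟨i, hi⟩ : ∃ i, P.coeff i ∉ h.centerIdeal := by
    by_contra! H
    exact hn' (h.mem_pow_of_coeff_mem hx n _ P hP e H)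
  choose c hc using fun r : R => h.exists_residue r r.2
  have hsupp : ∀ j, c (P.coeff j) ≠ 0 → j ≤ n := by
    intro j hj
    by_contra! hlt
    rw [coeff_eq_zero_of_natDegree_lt (hP.trans_lt hlt)] at hj
    refine hj ((algebraMap K k).injective (hv.residue_unique (hc 0) ?_))
    simp
  let Q : K[X] := ∑ j ∈ Finset.range (n + 1), monomial j (c (P.coeff j))
  have hQ : Q ≠ 0 := by
    intro hQ
    apply hi
    have h1 : c (P.coeff i) = 0 := by
      by_contra hne
      have h2 := congrArg (fun q : K[X] => q.coeff i) hQ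
      simp only [Q, finsetSum_coeff, coeff_monomial, coeff_zero] at h2
      rw [Finset.sum_ite_eq' , if_pos (Finset.mem_range.mpr (Nat.lt_succ_of_le (hsupp i hne)))] at h2
      exact hne h2
    apply h.mem_centerIdeal
    simpa [h1] using hc (P.coeff i)
  refine ⟨n, aeval (y / x) P, aeval τ Q, ?_, ?_, e, ?_⟩
  · exact (mem_adjoin_simple_iff K _).mpr ⟨Q, 1, by simp⟩
  · exact fun h0 => hQ (transcendental_iff.mp htr Q h0)
  · rw [aeval_eq_sum_range' (Nat.lt_succ_of_le hP), map_sum]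
    refine IsRationalPlace.residue_sum _ fun j _ => ?_
    rw [aeval_monomial, Algebra.smul_def]
    exact hv.residue_mul (hc _) (hv.residue_pow hτ j)

omit [IsScalarTower K k F] in
-- Write an element of `k` as `f / g` with `f` and `g` in `R`. Their leading forms are powers of `x`
-- times elements with nonzero residue in `K(τ)`. The exponents agree because nonzero constants in
-- `k` have value one, so the element is the quotient of the two residues.
theorem adjoin_residue_eq_top (hv : IsRationalPlace k v) (h : IsTwoGeneratedAtCenter k v R x y)
    (hx : x ≠ 0) {τ : k} (hτ : v (y / x - algebraMap k F τ) < 1) (htr : Transcendental K τ) :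
    K⟮τ⟯ = ⊤ := by
  rw [eq_top_iff]
  rintro z -
  by_cases hz : z = 0
  · rw [hz]; exact zero_mem _
  obtain ⟨g, hg, f, hf, hg0, e⟩ := h.exists_mul_eq (algebraMap k F z)
  have hz' : algebraMap k F z ≠ 0 := by simpa using hz
  have hf0 : f ≠ 0 := by rw [← e]; exact mul_ne_zero hz' hg0
  obtain ⟨n, f', w, hw, hw0, e1, hfw⟩ := h.exists_leading_form hv hx hτ htr f hf hf0
  obtain ⟨m, g', w', hw', hw0', e2, hgw⟩ := h.exists_leading_form hv hx hτ htr g hg hg0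
  have hvx : v x ≠ 0 := by simpa using hx
  have hnm : m = n := by
    have := congrArg v e
    rw [e1, e2] at this
    simp only [map_mul, map_pow, hv.map_algebraMap z hz, hv.eq_one_of_residue_ne_zero hfw hw0,
      hv.eq_one_of_residue_ne_zero hgw hw0', one_mul, mul_one] at this
    exact (pow_right_injective₀ (zero_lt_iff.mpr hvx) h.left_lt.ne) this
  subst hnm
  have e3 : algebraMap k F z * g' = f' := by
    apply mul_left_cancel₀ (pow_ne_zero m hx)
    rw [← e1, ← e, e2]; ring
  have h4 := hv.residue_mul (IsRationalPlace.residue_algebraMap z) hgw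
  rw [e3] at h4
  have h5 := hv.residue_unique h4 hfw
  have : z = w / w' := by rw [← h5]; field_simp
  rw [this]
  exact div_mem hw hw'

/-- The structure passes to a chart of the blowing up at the center. -/
theorem blowup (hv : IsRationalPlace k v) (h : IsTwoGeneratedAtCenter k v R x y)
    (hx : x ≠ 0) {c : K} (hc : v (y / x - algebraMap k F (algebraMap K k c)) < 1) :
    ∃ R' : Subalgebra K F, R ≤ R' ∧ y / x ∈ R' ∧
      IsTwoGeneratedAtCenter k v R' x (y / x - algebraMap K F c) := by
  set t := y / x - algebraMap K F c with ht
  have hct : algebraMap k F (algebraMap K k c) = algebraMap K F c :=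
    (IsScalarTower.algebraMap_apply K k F c).symm
  rw [hct] at hc
  let R' : Subalgebra K F := ((aeval t : R[X] →ₐ[R] F).restrictScalars K).range
  have hR' : ∀ z, z ∈ R' ↔ ∃ P : R[X], aeval t P = z := fun z => Iff.rfl
  have hle : R ≤ R' := fun r hr => (hR' r).mpr ⟨C ⟨r, hr⟩, aeval_C t (⟨r, hr⟩ : R)⟩
  have htR' : t ∈ R' := (hR' t).mpr ⟨X, aeval_X t⟩
  have hyx : y / x ∈ R' := by
    have : y / x = t + algebraMap K F c := by rw [ht]; ring
    rw [this]
    exact add_mem htR' (R'.algebraMap_mem c)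
  -- `R' = R[t]` and `t` vanishes at the new center. Modulo `t` everything comes from `R`, which
  -- gives the residues, and `y = x * (y / x)` makes `x` and `t` generators.
  have hmul : ∀ z ∈ R', ∃ a ∈ R, ∃ b ∈ R', z = a + b * t := by
    intro z hz
    obtain ⟨P, rfl⟩ := (hR' z).mp hz
    refine ⟨P.coeff 0, (P.coeff 0).2, aeval t P.divX, (hR' _).mpr ⟨_, rfl⟩, ?_⟩
    conv_lhs => rw [← divX_mul_X_add P]
    rw [map_add, map_mul, aeval_X, aeval_C, add_comm]
    rfl
  have hres' : ∀ r ∈ R', v r ≤ 1 := by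
    intro r hr
    obtain ⟨P, rfl⟩ := (hR' r).mp hr
    rw [aeval_eq_sum_range]
    refine v.map_sum_le fun i _ => ?_
    obtain ⟨d, hd⟩ := h.exists_residue _ (P.coeff i).2
    rw [Algebra.smul_def, map_mul, map_pow]
    exact mul_le_one' (hv.le_one hd) (pow_le_one' hc.le i)
  have hlt : ∀ b ∈ R', v (b * t) < 1 := fun b hb => by
    rw [map_mul, mul_comm]; exact mul_lt_one_of_lt_of_le hc (hres' b hb)
  refine ⟨R', hle, hyx, ?_, ?_, hle h.left_mem, htR', h.left_lt, hc, ?_, ?_⟩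
  · have := h.noetherian
    exact isNoetherianRing_of_surjective R[X] R'
      ((aeval t : R[X] →ₐ[R] F).restrictScalars K).rangeRestrict.toRingHom
      (AlgHom.rangeRestrict_surjective _)
  · intro r hr
    obtain ⟨a, ha, b, hb, rfl⟩ := hmul r hr
    obtain ⟨d, hd⟩ := h.exists_residue a ha
    refine ⟨d, ?_⟩
    have : a + b * t - algebraMap k F (algebraMap K k d) =
      (a - algebraMap k F (algebraMap K k d)) + b * t := by ring
    rw [this]
    exact (v.map_add _ _).trans_lt (max_lt hd (hlt b hb))
  · intro r hr hr'
    obtain ⟨a, ha, b, hb, rfl⟩ := hmul r hr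
    have hva : v a < 1 := by
      have : a = a + b * t - b * t := by ring
      rw [this]
      exact (v.map_sub _ _).trans_lt (max_lt hr' (hlt b hb))
    obtain ⟨p, hp, q, hq, rfl⟩ := h.exists_eq a ha hva
    refine ⟨p + q * (y / x), add_mem (hle hp) (mul_mem (hle hq) hyx), b, hb, ?_⟩
    field_simp
  · intro u
    obtain ⟨g, hg, f, hf, hg0, e⟩ := h.exists_mul_eq u
    exact ⟨g, hle hg, f, hle hf, hg0, e⟩

/-- Fix a fraction `u = f / g` whose residue `z` is not in `K`. While the centers stay rational, `f`
and `g` both vanish at the center and can be divided by `x` after blowing up. This lowers the order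
of `g`, so the process stops, and it can only stop at a transcendental `τ`. -/
theorem exists_adjoin_eq_top_aux (hv : IsRationalPlace k v)
    (hK : ∀ z : k, IsAlgebraic K z → z ∈ (algebraMap K k).range) {u : F} {z : k}
    (hu : v (u - algebraMap k F z) < 1) (hz : z ∉ (algebraMap K k).range) (N : ℕ)
    (R : Subalgebra K F) (x y : F) (h : IsTwoGeneratedAtCenter k v R x y) (f g : F) (hf : f ∈ R)
    (hg : g ∈ R) (hg0 : g ≠ 0) (e : u * g = f) (hN : -WithZero.log (v g) < N) :
    ∃ τ : k, Transcendental K τ ∧ K⟮τ⟯ = ⊤ := by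
  induction N generalizing R x y f g with
  | zero =>
    exfalso
    obtain ⟨c, hc⟩ := h.exists_residue g hg
    have h1 := hv.le_one hc
    rw [← WithZero.log_le_log (by simpa using hg0) one_ne_zero, WithZero.log_one] at h1
    simp at hN
    omega
  | succ N ih =>
    have hz0 : z ≠ 0 := fun h0 => hz ⟨0, by simp [h0]⟩
    have hvu := hv.eq_one_of_residue_ne_zero hu hz0
    obtain ⟨c, hc⟩ := h.exists_residue g hg
    by_cases hc0 : c = 0
    swap
    -- If `g` did not vanish at the center, `z` would be the quotient of the residues of `f` and
    -- `g`, which lie in `K`.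
    · exfalso
      obtain ⟨d, hd⟩ := h.exists_residue f hf
      have h1 := hv.residue_mul hu hc
      rw [e] at h1
      have h2 := hv.residue_unique h1 hd
      apply hz
      refine ⟨d / c, ?_⟩
      have hc0' : algebraMap K k c ≠ 0 := by simpa using hc0
      rw [map_div₀, ← h2]
      field_simp
    have hvg : v g < 1 := by simpa [hc0] using hc
    have hvf : v f < 1 := by rw [← e, map_mul, hvu, one_mul]; exact hvg
    -- The larger value selects the chart of the blowing up that contains the next center.
    wlog hxy : v y ≤ v x generalizing x y
    · exact this y x h.symm (le_of_not_ge hxy)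
    obtain ⟨a, ha, b, hb, hfab⟩ := h.exists_eq f hf hvf
    obtain ⟨a', ha', b', hb', hgab⟩ := h.exists_eq g hg hvg
    have hx : x ≠ 0 := by
      rintro rfl
      have hy : y = 0 := by simpa using hxy
      exact hg0 (by rw [hgab, hy]; simp)
    have hvx : v x ≠ 0 := by simpa using hx
    have hvt : v (y / x) ≤ 1 := by
      rw [map_div₀]
      exact div_le_one_of_le₀ hxy zero_le
    obtain ⟨τ, hτ⟩ := hv.exists_residue _ hvt
    -- If `τ` is transcendental, the center on the blowing up is the generic point of the
    -- exceptional line. Otherwise `τ` lies in `K` and the center is again a rational point.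
    by_cases htr : Transcendental K τ
    · exact ⟨τ, htr, h.adjoin_residue_eq_top hv hx hτ htr⟩
    obtain ⟨d, hd⟩ := hK τ (by simpa [Transcendental] using htr)
    rw [← hd] at hτ
    obtain ⟨R', hle, hyx, h'⟩ := h.blowup hv hx hτ
    have hg1 : g = x * (a' + b' * (y / x)) := by rw [hgab]; field_simp
    have hg0' : a' + b' * (y / x) ≠ 0 := by
      intro h0
      rw [h0, mul_zero] at hg1
      exact hg0 hg1
    refine ih R' _ _ h' (a + b * (y / x)) (a' + b' * (y / x))
      (add_mem (hle ha) (mul_mem (hle hb) hyx)) (add_mem (hle ha') (mul_mem (hle hb') hyx))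
      hg0' ?_ ?_
    · apply mul_left_cancel₀ hx
      have hf1 : f = x * (a + b * (y / x)) := by rw [hfab]; field_simp
      rw [← hf1, ← e, hg1]; ring
    · have h1 := congrArg (fun r => WithZero.log (v r)) hg1
      simp only [map_mul] at h1
      rw [WithZero.log_mul hvx (by simpa using hg0')] at h1
      have h2 := h.left_lt
      rw [← WithZero.log_lt_log hvx one_ne_zero, WithZero.log_one] at h2
      push_cast at hN
      omega

/-- The residue field of a prime divisor whose center on a surface is a rational regular point is
purely transcendental. -/
theorem exists_adjoin_eq_top (hv : IsRationalPlace k v) (h : IsTwoGeneratedAtCenter k v R x y)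
    (hK : ∀ z : k, IsAlgebraic K z → z ∈ (algebraMap K k).range) {z : k}
    (hz : z ∉ (algebraMap K k).range) :
    ∃ τ : k, Transcendental K τ ∧ K⟮τ⟯ = ⊤ := by
  obtain ⟨g, hg, f, hf, hg0, e⟩ := h.exists_mul_eq (algebraMap k F z)
  obtain ⟨N, hN⟩ := exists_nat_gt (-WithZero.log (v g))
  exact exists_adjoin_eq_top_aux hv hK (IsRationalPlace.residue_algebraMap z) hz N R x y h f g hf hg
    hg0 e (by exact_mod_cast hN)

end IsTwoGeneratedAtCenter

end Zariski

/-! ### Normality and transcendence degree of smooth algebras. -/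

section SmoothAlgebras

open TensorProduct

/-- Over `L = Frac P` the algebra `B ⊗ L` is étale and a domain, hence a finite field extension of
`L`, and it is the field of fractions of `B`. Normality descends from `P` because integral closure
commutes with smooth base change. -/
theorem etale_fractionField_facts {P B : Type u} [CommRing P] [IsDomain P] [IsIntegrallyClosed P]
    [CommRing B] [IsDomain B] [Algebra P B] [Algebra.Etale P B] :
    IsIntegrallyClosed B ∧ Algebra.IsAlgebraic P B ∧ FaithfulSMul P B := by
  have : Module.Flat P B := inferInstance
  have hinj : Function.Injective (algebraMap P B) := by
    have := Module.Flat.isTorsionFree (R := P) (M := B)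
    exact FaithfulSMul.algebraMap_injective P B
  have hfaith : FaithfulSMul P B := (faithfulSMul_iff_algebraMap_injective P B).mpr hinj
  let L := FractionRing P
  let T := B ⊗[P] L
  have hloc : IsLocalization (Algebra.algebraMapSubmonoid B (nonZeroDivisors P)) T :=
    inferInstance
  have hM : Algebra.algebraMapSubmonoid B (nonZeroDivisors P) ≤ nonZeroDivisors B :=
    map_le_nonZeroDivisors_of_injective _ hinj le_rfl
  have hTdom : IsDomain T := IsLocalization.isDomain_of_le_nonZeroDivisors T hM
  let : Algebra L T := Algebra.TensorProduct.rightAlgebra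
  have : Algebra.Etale L T :=
    Algebra.Etale.of_equiv (A := L ⊗[P] B)
      { Algebra.TensorProduct.comm P L B with commutes' := fun _ => rfl }
  have hfin : Module.Finite L T := Algebra.FormallyUnramified.finite_of_free L T
  have hfield : IsField T := isField_of_isIntegral_of_isField' (Field.toIsField L)
  let := hfield.toField
  have hBT : Function.Injective (algebraMap B T) := IsLocalization.injective T hM
  have hfrac : IsFractionRing B T := by
    refine IsLocalization.of_le _ _ hM fun r hr => ?_
    refine (IsUnit.mk0 _ ?_)
    rw [Ne, map_eq_zero_iff _ hBT]
    exact nonZeroDivisors.ne_zero hr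
  refine ⟨?_, ?_, hfaith⟩
  · rw [isIntegrallyClosed_iff T]
    intro x hx
    obtain ⟨y, hy⟩ := (TensorProduct.toIntegralClosure_bijective_of_smooth (R := P) (S := B)
      (B := L)).2 ⟨x, hx⟩
    have hbot : integralClosure P L = ⊥ := IsIntegrallyClosed.integralClosure_eq_bot P L
    have key : ∀ y : B ⊗[P] integralClosure P L, ∃ b : B,
        (TensorProduct.toIntegralClosure P B L y : T) = algebraMap B T b := by
      intro y
      induction y with
      | zero => exact ⟨0, by simp⟩
      | add p q hp hq =>
        obtain ⟨a, ha⟩ := hp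
        obtain ⟨b, hb⟩ := hq
        exact ⟨a + b, by rw [map_add, map_add, ← ha, ← hb]; rfl⟩
      | tmul b c =>
        obtain ⟨c, hc⟩ := c
        obtain ⟨p, rfl⟩ := Algebra.mem_bot.mp (hbot ▸ hc)
        refine ⟨p • b, ?_⟩
        change b ⊗ₜ[P] algebraMap P L p = (p • b) ⊗ₜ[P] (1 : L)
        rw [TensorProduct.smul_tmul, Algebra.smul_def, mul_one]
    obtain ⟨b, hb⟩ := key y
    rw [hy] at hb
    exact ⟨b, hb.symm⟩
  · have h1 : Algebra.IsAlgebraic L T := inferInstance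
    have : IsScalarTower P L T := by
      refine IsScalarTower.of_algebraMap_eq fun p => ?_
      rw [Algebra.TensorProduct.right_algebraMap_apply, Algebra.TensorProduct.algebraMap_apply]
      rw [Algebra.algebraMap_eq_smul_one, Algebra.algebraMap_eq_smul_one, TensorProduct.smul_tmul]
    have h2 : Algebra.IsAlgebraic P T := IsFractionRing.comap_isAlgebraic_iff (K := L) |>.mpr h1
    exact h2.of_injective (IsScalarTower.toAlgHom P B T) hBT

/-- A standard smooth algebra is étale over a polynomial ring, which is normal. -/
theorem Algebra.IsStandardSmoothOfRelativeDimension.isIntegrallyClosed (K : Type u) {B : Type u}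
    [Field K] [CommRing B] [IsDomain B] [Algebra K B] (n : ℕ)
    [Algebra.IsStandardSmoothOfRelativeDimension n K B] : IsIntegrallyClosed B := by
  obtain ⟨g, hg⟩ :=
    Algebra.IsStandardSmoothOfRelativeDimension.exists_etale_mvPolynomial n K B
  algebraize [g.toRingHom]
  exact (etale_fractionField_facts (P := MvPolynomial (Fin n) K)).1

theorem Algebra.IsStandardSmoothOfRelativeDimension.trdeg_eq (K : Type u) (B : Type u)
    [Field K] [CommRing B] [IsDomain B] [Algebra K B] (n : ℕ)
    [Algebra.IsStandardSmoothOfRelativeDimension n K B] (k : Type u) [Field k] [Algebra B k]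
    [IsFractionRing B k] [Algebra K k] [IsScalarTower K B k] : Algebra.trdeg K k = n := by
  obtain ⟨g, hg⟩ :=
    Algebra.IsStandardSmoothOfRelativeDimension.exists_etale_mvPolynomial n K B
  algebraize [g.toRingHom]
  obtain ⟨-, h2, h3⟩ := etale_fractionField_facts (P := MvPolynomial (Fin n) K) (B := B)
  have : IsScalarTower K (MvPolynomial (Fin n) K) B :=
    IsScalarTower.of_algebraMap_eq fun c => (g.commutes c).symm
  have e1 := trdeg_add_eq K (S := MvPolynomial (Fin n) K) (A := B)
  have e2 := trdeg_add_eq K (S := B) (A := k)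
  have : Algebra.IsAlgebraic B k := IsLocalization.isAlgebraic k (nonZeroDivisors B)
  rw [trdeg_eq_zero (R := MvPolynomial (Fin n) K), add_zero] at e1
  rw [trdeg_eq_zero (R := B), add_zero] at e2
  rw [← e2, ← e1, MvPolynomial.trdeg_of_isDomain]
  simp

end SmoothAlgebras

/-! ### Two local parameters at a rational point of a smooth surface. -/

section RationalPoint

variable {K B : Type u} [Field K] [CommRing B] [Algebra K B]

/-- The derivation `b ↦ b - χ b` with values in the cotangent space of a rational point `χ`. -/
noncomputable def AlgHom.cotangentDerivation (χ : B →ₐ[K] K) :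
    Derivation K B (RingHom.ker χ).Cotangent :=
  Derivation.mk'
    { toFun := fun b => (RingHom.ker χ).toCotangent ⟨b - algebraMap K B (χ b), by
        simp [RingHom.mem_ker]⟩
      map_add' := fun a b => by
        rw [← map_add]
        congr 1
        ext
        simp only [map_add, Submodule.coe_add]
        ring
      map_smul' := fun c b => by
        rw [RingHom.id_apply, ← algebraMap_smul B c ((RingHom.ker χ).toCotangent _), ← map_smul,
          Ideal.toCotangent_eq]
        simp [Algebra.smul_def, mul_sub] }
    (fun a b => by
      change (RingHom.ker χ).toCotangent _ = a • (RingHom.ker χ).toCotangent _ +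
        b • (RingHom.ker χ).toCotangent _
      rw [← map_smul, ← map_smul, ← map_add, Ideal.toCotangent_eq]
      have h : (a - algebraMap K B (χ a)) * (b - algebraMap K B (χ b)) ∈ RingHom.ker χ ^ 2 := by
        rw [pow_two]
        refine Ideal.mul_mem_mul ?_ ?_ <;> simp [RingHom.mem_ker]
      rw [← neg_mem_iff]
      convert h using 1
      simp only [map_mul, Submodule.coe_add, Submodule.coe_smul, smul_eq_mul]
      ring)

theorem AlgHom.cotangentDerivation_apply (χ : B →ₐ[K] K) (y : RingHom.ker χ) :
    χ.cotangentDerivation y = (RingHom.ker χ).toCotangent y := by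
  change (RingHom.ker χ).toCotangent _ = _
  congr 1
  ext
  have := y.2
  rw [RingHom.mem_ker] at this
  simp [this]

/-- The derivation `b ↦ b - χ b` factors through the differentials, which are free of rank two. So
lifts `x`, `y` of the images of a basis generate the kernel modulo its square. Nakayama's lemma
supplies `s`, congruent to one modulo the kernel, that multiplies the kernel into `(x, y)`. -/
theorem AlgHom.exists_two_generators_ker [Algebra.IsStandardSmoothOfRelativeDimension 2 K B]
    (χ : B →ₐ[K] K) : ∃ x y s : B, χ x = 0 ∧ χ y = 0 ∧ χ s ≠ 0 ∧
      ∀ q, χ q = 0 → ∃ a b, s * q = a * x + b * y := by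
  have := Algebra.IsStandardSmoothOfRelativeDimension.isStandardSmooth 2 (R := K) (S := B)
  have : Algebra.FiniteType K B := inferInstance
  have : IsNoetherianRing B := Algebra.FiniteType.isNoetherianRing K B
  have : Nontrivial B := χ.toRingHom.domain_nontrivial
  have : Module.Free B Ω[B⁄K] := Algebra.IsStandardSmooth.free_kaehlerDifferential
  have hr : Module.finrank B Ω[B⁄K] = 2 := by
    rw [Module.finrank, Algebra.IsStandardSmoothOfRelativeDimension.rank_kaehlerDifferential 2]
    simp
  let w := Module.finBasisOfFinrankEq B Ω[B⁄K] hr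
  let Q := RingHom.ker χ
  let ℓ := χ.cotangentDerivation.liftKaehlerDifferential
  obtain ⟨x, hx⟩ := Q.toCotangent_surjective (ℓ (w 0))
  obtain ⟨y, hy⟩ := Q.toCotangent_surjective (ℓ (w 1))
  have hle : Q ≤ Ideal.span {x.1, y.1} ⊔ Q • Q := by
    intro q hq
    have h1 : Q.toCotangent ⟨q, hq⟩ = ℓ (KaehlerDifferential.D K B q) := by
      rw [Derivation.liftKaehlerDifferential_comp_D, ← AlgHom.cotangentDerivation_apply]
    rw [← w.sum_repr (KaehlerDifferential.D K B q), Fin.sum_univ_two, map_add, map_smul, map_smul,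
      ← hx, ← hy, ← map_smul, ← map_smul, ← map_add, Ideal.toCotangent_eq] at h1
    rw [smul_eq_mul, ← pow_two]
    rw [← sub_add_cancel q ((w.repr (KaehlerDifferential.D K B q) 0 • x +
      w.repr (KaehlerDifferential.D K B q) 1 • y : Q) : B), add_comm]
    refine Submodule.add_mem_sup ?_ h1
    exact Ideal.mem_span_pair.mpr ⟨_, _, rfl⟩
  obtain ⟨s, hs, hsQ⟩ := Submodule.exists_sub_one_mem_and_smul_le_of_fg_of_le_sup
    (IsNoetherian.noetherian Q) le_rfl hle
  refine ⟨x, y, s, x.2, y.2, ?_, fun q hq => ?_⟩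
  · have : χ (s - 1) = 0 := hs
    rw [map_sub, map_one, sub_eq_zero] at this
    rw [this]
    exact one_ne_zero
  · obtain ⟨a, b, h⟩ := Ideal.mem_span_pair.mp
      (hsQ (Submodule.smul_mem_pointwise_smul q s Q (show q ∈ Q from hq)))
    exact ⟨a, b, h.symm⟩

end RationalPoint

/-! ### Local rings as subalgebras of the function field. -/

section LocalSubalgebras

/-- The closed point of the spectrum of a local ring. -/
def closedPt (V : Type u) [CommRing V] [IsLocalRing V] : Spec (.of V) := IsLocalRing.closedPoint V

theorem specMap_closedPt {V W : Type u} [CommRing V] [IsLocalRing V] [CommRing W] [IsLocalRing W]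
    (φ : V →+* W) [IsLocalHom φ] : Spec.map (CommRingCat.ofHom φ) (closedPt W) = closedPt V :=
  IsLocalRing.comap_closedPoint φ

theorem fromSpecStalk_closedPt {X : Scheme.{u}} (x : X) :
    X.fromSpecStalk x (closedPt (X.presheaf.stalk x)) = x :=
  Scheme.fromSpecStalk_closedPoint

variable {K : Type u} [Field K] {X : Scheme.{u}} [IsIntegral X] (s : X ⟶ Spec (.of K))

/-- The function field of an integral `K`-scheme, as a `K`-algebra. -/
def FunField (_ : X ⟶ Spec (.of K)) : Type u := X.functionField

noncomputable instance : Field (FunField s) := inferInstanceAs (Field X.functionField)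

noncomputable instance : Algebra K (FunField s) := (DelPezzo.toFunctionField s).toAlgebra

/-- The structure map from `K` to a stalk. -/
noncomputable def toStalk {X : Scheme.{u}} (s : X ⟶ Spec (.of K)) (x : X) : K →+* X.presheaf.stalk x :=
  (X.presheaf.germ ⊤ x trivial).hom.comp
    (s.appTop.hom.comp (Scheme.ΓSpecIso (.of K)).inv.hom)

theorem algebraMap_toStalk (x : X) (c : K) :
    algebraMap (X.presheaf.stalk x) X.functionField (toStalk s x c) =
      algebraMap K (FunField s) c := by
  have : Nonempty (⊤ : X.Opens) := ⟨⟨x, trivial⟩⟩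
  exact Scheme.algebraMap_germ_eq_germToFunctionField X (U := ⊤) (x := x) trivial _

theorem fromSpecStalk_comp {X : Scheme.{u}} (s : X ⟶ Spec (.of K)) (x : X) :
    X.fromSpecStalk x ≫ s = Spec.map (CommRingCat.ofHom (toStalk s x)) := by
  have h := Scheme.toSpecΓ_naturality s
  have h2 : (Spec (.of K)).toSpecΓ = Spec.map (Scheme.ΓSpecIso (.of K)).hom :=
    (SpecMap_ΓSpecIso_hom _).symm
  rw [h2] at h
  rw [← cancel_mono (Spec.map (Scheme.ΓSpecIso (.of K)).hom), Category.assoc, h,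
    Scheme.fromSpecStalk_toSpecΓ_assoc, ← Spec.map_comp, ← Spec.map_comp]
  congr 1
  ext c
  simp [toStalk]

/-- The local ring of a point as a `K`-subalgebra of the function field. -/
noncomputable def localAlg (x : X) : Subalgebra K (FunField s) where
  __ := DelPezzo.localRing X x
  algebraMap_mem' c := ⟨toStalk s x c, algebraMap_toStalk s x c⟩

/-- The stalk is isomorphic to its image in the function field. -/
noncomputable def stalkEquiv (x : X) : X.presheaf.stalk x ≃+* localAlg s x :=
  RingEquiv.ofBijective
    ((algebraMap (X.presheaf.stalk x) X.functionField).rangeRestrict :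
      X.presheaf.stalk x →+* (DelPezzo.localRing X x))
    ⟨fun _ _ h => IsFractionRing.injective _ X.functionField (congrArg Subtype.val h),
      RingHom.rangeRestrict_surjective _⟩

instance (x : X) : IsLocalRing (localAlg s x) := (stalkEquiv s x).isLocalRing

theorem stalkEquiv_toStalk (x : X) (c : K) :
    stalkEquiv s x (toStalk s x c) = algebraMap K (localAlg s x) c :=
  Subtype.ext (algebraMap_toStalk s x c)

/-- The canonical morphism from the spectrum of the local ring. -/
noncomputable def fromSpecLocal (x : X) : Spec (.of (localAlg s x)) ⟶ X :=
  Spec.map (CommRingCat.ofHom (stalkEquiv s x).toRingHom) ≫ X.fromSpecStalk x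

instance (x : X) : IsIso (CommRingCat.ofHom (stalkEquiv s x).toRingHom) :=
  (stalkEquiv s x).toCommRingCatIso.isIso_hom

instance (x : X) : IsPreimmersion (fromSpecLocal s x) := by
  unfold fromSpecLocal; infer_instance

theorem fromSpecLocal_comp (x : X) : fromSpecLocal s x ≫ s =
    Spec.map (CommRingCat.ofHom (algebraMap K (localAlg s x))) := by
  rw [fromSpecLocal, Category.assoc, fromSpecStalk_comp, ← Spec.map_comp]
  congr 1
  ext c
  exact congrArg Subtype.val (stalkEquiv_toStalk s x c)

theorem fromSpecLocal_closedPt (x : X) :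
    fromSpecLocal s x (closedPt (localAlg s x)) = x := by
  have : IsLocalHom (stalkEquiv s x).toRingHom :=
    ⟨fun a ha => (MulEquiv.isUnit_map (stalkEquiv s x)).mp ha⟩
  rw [fromSpecLocal, Scheme.Hom.comp_apply]
  exact (congrArg (X.fromSpecStalk x) (specMap_closedPt (stalkEquiv s x).toRingHom)).trans
    (fromSpecStalk_closedPt x)

theorem algebraMap_stalkSpecializes {x y : X} (h : x ⤳ y) (f : X.presheaf.stalk y) :
    algebraMap (X.presheaf.stalk x) X.functionField (X.presheaf.stalkSpecializes h f) =
      algebraMap (X.presheaf.stalk y) X.functionField f := by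
  change (X.presheaf.stalkSpecializes h ≫ X.presheaf.stalkSpecializes _).hom f = _
  rw [TopCat.Presheaf.stalkSpecializes_comp]
  rfl

theorem localAlg_le_of_specializes {x y : X} (h : x ⤳ y) : localAlg s y ≤ localAlg s x := by
  rintro _ ⟨f, rfl⟩
  exact ⟨X.presheaf.stalkSpecializes h f, algebraMap_stalkSpecializes h f⟩

theorem specMap_inclusion_fromSpecLocal {x y : X} (h : x ⤳ y) :
    Spec.map (CommRingCat.ofHom (Subalgebra.inclusion (localAlg_le_of_specializes s h)).toRingHom) ≫
      fromSpecLocal s y = fromSpecLocal s x := by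
  rw [fromSpecLocal, fromSpecLocal, ← Scheme.SpecMap_stalkSpecializes_fromSpecStalk h,
    ← Spec.map_comp_assoc, ← Spec.map_comp_assoc]
  congr 2
  ext f
  exact (algebraMap_stalkSpecializes h f).symm

/-- The inclusion of the generic point. -/
noncomputable def fromSpecFunField : Spec (.of (FunField s)) ⟶ X :=
  X.fromSpecStalk (genericPoint X)

theorem fromSpecFunField_comp : fromSpecFunField s ≫ s =
    Spec.map (CommRingCat.ofHom (algebraMap K (FunField s))) :=
  fromSpecStalk_comp s _

theorem specMap_val_fromSpecLocal (x : X) :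
    Spec.map (CommRingCat.ofHom (localAlg s x).val.toRingHom) ≫ fromSpecLocal s x =
      fromSpecFunField s := by
  rw [fromSpecLocal, ← Spec.map_comp_assoc, fromSpecFunField,
    ← Scheme.SpecMap_stalkSpecializes_fromSpecStalk ((genericPoint_spec X).specializes trivial)]
  rfl

theorem localAlg_genericPoint : localAlg s (genericPoint X) = ⊤ := by
  refine top_le_iff.mp fun f _ => ⟨f, ?_⟩
  change (X.presheaf.stalkSpecializes _).hom f = _
  rw [TopCat.Presheaf.stalkSpecializes_refl]
  rfl

theorem fromSpecFunField_apply (y : Spec (.of (FunField s))) :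
    fromSpecFunField s y = genericPoint X := by
  have : y = IsLocalRing.closedPoint (FunField s) := Subsingleton.elim _ _
  subst this
  exact Scheme.fromSpecStalk_closedPoint (X := X) (x := genericPoint X)

/-- A morphism from the spectrum of a local ring is given by a local homomorphism. -/
theorem exists_fromSpecLocal_factor {V : Type u} [CommRing V] [IsLocalRing V] [Algebra K V]
    (f : Spec (.of V) ⟶ X) (hf : f ≫ s = Spec.map (CommRingCat.ofHom (algebraMap K V))) (x : X)
    (hx : f (closedPt V) = x) :
    ∃ φ : localAlg s x →ₐ[K] V, IsLocalHom φ ∧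
      Spec.map (CommRingCat.ofHom φ.toRingHom) ≫ fromSpecLocal s x = f := by
  subst hx
  let ψ : localAlg s (f (closedPt V)) →+* V :=
    (Scheme.stalkClosedPointTo f).hom.comp (stalkEquiv s (f (closedPt V))).symm.toRingHom
  have hψ : Spec.map (CommRingCat.ofHom ψ) ≫ fromSpecLocal s (f (closedPt V)) = f := by
    rw [fromSpecLocal, ← Spec.map_comp_assoc]
    conv_rhs => rw [← Scheme.Spec_stalkClosedPointTo_fromSpecStalk f]
    congr 2
    ext g
    exact congrArg (Scheme.stalkClosedPointTo f).hom ((stalkEquiv s (f (closedPt V))).symm_apply_apply g)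
  refine ⟨{ ψ with commutes' := fun c => ?_ }, ?_, hψ⟩
  · rw [← hψ, Category.assoc, fromSpecLocal_comp, ← Spec.map_comp, Spec.map_inj] at hf
    exact DFunLike.congr_fun (congrArg CommRingCat.Hom.hom hf) c
  · have h2 : IsLocalHom (Scheme.stalkClosedPointTo f).hom :=
      Scheme.isLocalHom_stalkClosedPointTo' f
    refine ⟨fun a ha => ?_⟩
    exact (MulEquiv.isUnit_map (stalkEquiv s (f (closedPt V))).symm).mp (h2.map_nonunit _ ha)

theorem fromSpecLocal_apply_of_isLocalHom {V : Type u} [CommRing V] [IsLocalRing V] {x : X}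
    (φ : localAlg s x →+* V) [IsLocalHom φ] :
    (Spec.map (CommRingCat.ofHom φ) ≫ fromSpecLocal s x) (closedPt V) = x := by
  rw [Scheme.Hom.comp_apply, specMap_closedPt, fromSpecLocal_closedPt]

end LocalSubalgebras

/-! ### Centers of valuation rings: the valuative criteria. -/

section Centers

variable {K : Type u} [Field K] {X : Scheme.{u}} [IsIntegral X] (s : X ⟶ Spec (.of K))

theorem Subalgebra.isUnit_mk_iff {K F : Type*} [Field K] [Field F] [Algebra K F]
    {R : Subalgebra K F} {f : F} (hf : f ∈ R) :
    IsUnit (⟨f, hf⟩ : R) ↔ f ≠ 0 ∧ f⁻¹ ∈ R := by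
  constructor
  · intro h
    obtain ⟨⟨g, hg⟩, h⟩ := isUnit_iff_exists_inv.mp h
    have h : f * g = 1 := congrArg Subtype.val h
    have hf0 : f ≠ 0 := left_ne_zero_of_mul_eq_one h
    exact ⟨hf0, by rwa [← eq_inv_of_mul_eq_one_right h]⟩
  · rintro ⟨h0, h⟩
    exact isUnit_iff_exists_inv.mpr ⟨⟨f⁻¹, h⟩, Subtype.ext (mul_inv_cancel₀ h0)⟩

/-- The `K`-algebra structure on a valuation ring containing the field `K`. -/
abbrev ValuationSubring.algebraOfMem {κ : Type u} [Field κ] [Algebra K κ] (V : ValuationSubring κ)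
    (hV : ∀ c : K, algebraMap K κ c ∈ V) : Algebra K V :=
  ((algebraMap K κ).codRestrict V hV).toAlgebra

/-- The existence half of the valuative criterion: `Spec κ → X` extends to `Spec V`, and `q` is the
image of the closed point. The map `𝒪_q → V` is local, which is the last clause. Allowing an
arbitrary `η` gives centers on the closure of `η` and not only on `X`. -/
theorem exists_center [UniversallyClosed s] (η : X) {κ : Type u} [Field κ] [Algebra K κ]
    (φ : localAlg s η →ₐ[K] κ) [IsLocalHom φ] (V : ValuationSubring κ)
    (hV : ∀ c : K, algebraMap K κ c ∈ V) :
    ∃ q, η ⤳ q ∧ ∃ h : localAlg s q ≤ localAlg s η, ∀ f (hf : f ∈ localAlg s q),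
      φ ⟨f, h hf⟩ ∈ V ∧ (φ ⟨f, h hf⟩ ∉ V.nonunits → IsUnit (⟨f, hf⟩ : localAlg s q)) := by
  let := V.algebraOfMem hV
  have hφ : IsLocalHom φ.toRingHom := ⟨fun a ha => IsLocalHom.map_nonunit (f := φ) a ha⟩
  let i₁ : Spec (.of κ) ⟶ X :=
    Spec.map (CommRingCat.ofHom φ.toRingHom) ≫ fromSpecLocal s η
  have hi₁ : i₁ (closedPt κ) = η := fromSpecLocal_apply_of_isLocalHom s φ.toRingHom
  have hsq : CommSq i₁ (Spec.map (CommRingCat.ofHom (algebraMap V κ))) s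
      (Spec.map (CommRingCat.ofHom (algebraMap K V))) := by
    refine ⟨?_⟩
    rw [Category.assoc, fromSpecLocal_comp, ← Spec.map_comp, ← Spec.map_comp]
    congr 1
    ext c
    exact φ.commutes c
  have hex : ValuativeCriterion.Existence s := by
    have : UniversallyClosed s := inferInstance
    rw [UniversallyClosed.eq_valuativeCriterion] at this
    exact this.1
  obtain ⟨l, hl₁, hl₂⟩ := (hex { R := V, K := κ, commSq := hsq, .. }).exists_lift
  dsimp only at l hl₁ hl₂
  obtain ⟨ψ, hψ, hψl⟩ := exists_fromSpecLocal_factor s l hl₂ _ rfl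
  have hsp : η ⤳ l (closedPt V) := by
    have h := (IsLocalRing.specializes_closedPoint
      (Spec.map (CommRingCat.ofHom (algebraMap V κ)) (closedPt κ))).map l.continuous
    have h2 : l (Spec.map (CommRingCat.ofHom (algebraMap V κ)) (closedPt κ)) = η := by
      rw [← Scheme.Hom.comp_apply, hl₁, hi₁]
    exact h2 ▸ h
  refine ⟨_, hsp, localAlg_le_of_specializes s hsp, fun f hf => ?_⟩
  have key : (ψ ⟨f, hf⟩ : κ) = φ ⟨f, localAlg_le_of_specializes s hsp hf⟩ := by
    rw [← hψl, ← Spec.map_comp_assoc] at hl₁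
    change _ = Spec.map _ ≫ _ at hl₁
    rw [← specMap_inclusion_fromSpecLocal s hsp, ← Spec.map_comp_assoc, cancel_mono,
      Spec.map_inj] at hl₁
    exact DFunLike.congr_fun (congrArg CommRingCat.Hom.hom hl₁) (⟨f, hf⟩ : localAlg s _)
  rw [← key]
  refine ⟨(ψ ⟨f, hf⟩).2, fun h => ?_⟩
  refine hψ.map_nonunit _ ?_
  by_contra h'
  exact h (V.mem_nonunits_iff_exists_mem_maximalIdeal.mpr ⟨(ψ ⟨f, hf⟩).2, h'⟩)

/-- Domination of `𝒪_q` by `W` is the same as a morphism `Spec W → X` that extends the generic point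
and sends the closed point to `q`. Separatedness allows only one such extension. -/
theorem center_unique [IsSeparated s] (W : ValuationSubring (FunField s)) {q q' : X}
    (h : ∀ f (hf : f ∈ localAlg s q), f ∈ W ∧ (f ∉ W.nonunits → IsUnit (⟨f, hf⟩ : localAlg s q)))
    (h' : ∀ f (hf : f ∈ localAlg s q'),
      f ∈ W ∧ (f ∉ W.nonunits → IsUnit (⟨f, hf⟩ : localAlg s q'))) : q = q' := by
  have hV (c : K) : algebraMap K (FunField s) c ∈ W := (h _ ((localAlg s q).algebraMap_mem c)).1
  let := W.algebraOfMem hV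
  have main (q : X) (h : ∀ f (hf : f ∈ localAlg s q),
      f ∈ W ∧ (f ∉ W.nonunits → IsUnit (⟨f, hf⟩ : localAlg s q))) :
      ∃ l : Spec (.of W) ⟶ X, l (closedPt W) = q ∧
        Spec.map (CommRingCat.ofHom (algebraMap W (FunField s))) ≫ l = fromSpecFunField s ∧
        l ≫ s = Spec.map (CommRingCat.ofHom (algebraMap K W)) := by
    let ψ : localAlg s q →+* W :=
      (localAlg s q).val.toRingHom.codRestrict W.toSubring fun f => (h f f.2).1
    have hψ : IsLocalHom ψ := by
      refine ⟨fun f hf => (h f f.2).2 fun hn => ?_⟩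
      obtain ⟨h1, h2⟩ := W.mem_nonunits_iff_exists_mem_maximalIdeal.mp hn
      exact h2 hf
    refine ⟨Spec.map (CommRingCat.ofHom ψ) ≫ fromSpecLocal s q,
      fromSpecLocal_apply_of_isLocalHom s ψ, ?_, ?_⟩
    · rw [← Spec.map_comp_assoc, ← specMap_val_fromSpecLocal s q]
      rfl
    · rw [Category.assoc, fromSpecLocal_comp, ← Spec.map_comp]
      rfl
  obtain ⟨l, hl, hl₁, hl₂⟩ := main q h
  obtain ⟨l', hl', hl₁', hl₂'⟩ := main q' h'
  have hsq : CommSq (fromSpecFunField s)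
      (Spec.map (CommRingCat.ofHom (algebraMap W (FunField s)))) s
      (Spec.map (CommRingCat.ofHom (algebraMap K W))) := ⟨by rw [← hl₁, Category.assoc, hl₂]⟩
  have := IsSeparated.valuativeCriterion s { R := W, K := FunField s, commSq := hsq, .. }
  have heq : l = l' :=
    congrArg CommSq.LiftStruct.l (Subsingleton.elim (⟨l, hl₁, hl₂⟩ : hsq.LiftStruct) ⟨l', hl₁', hl₂'⟩)
  rw [← hl, ← hl', heq]

end Centers

/-! ### Affine charts and their coordinate rings in the function field. -/

section Charts

variable {K : Type u} [Field K] {X : Scheme.{u}} [IsIntegral X] (s : X ⟶ Spec (.of K))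
  {B : Type u} [CommRing B] [IsDomain B] [Algebra K B]

omit [IsDomain B] [Algebra K B] in
-- The stalk of `Spec B` at `Q` is the localization of `B` at `Q`; an open immersion identifies it
-- with the stalk at the image point, and this with the local ring in the function field.
theorem exists_toLocalAlg (u : Spec (.of B) ⟶ X) [IsOpenImmersion u]
    (Q : Spec (.of B)) : ∃ ψ : B →+* localAlg s (u Q),
      Spec.map (CommRingCat.ofHom ψ) ≫ u = fromSpecLocal s (u Q) ∧
      (∀ b, b ∉ (show PrimeSpectrum B from Q).asIdeal ↔ IsUnit (ψ b)) ∧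
      ∀ f, ∃ a b, b ∉ (show PrimeSpectrum B from Q).asIdeal ∧ f * ψ b = ψ a := by
  have hiso : IsIso (u.stalkMap Q) := inferInstanceAs (IsIso (Scheme.Hom.stalkMap u Q))
  obtain ⟨τ, hτ, hloc⟩ : ∃ τ : CommRingCat.of B ⟶ (Spec (.of B)).presheaf.stalk Q,
      (Spec (.of B)).fromSpecStalk Q = Spec.map τ ∧
      @IsLocalization.AtPrime B _ ((Spec (.of B)).presheaf.stalk Q) _ τ.hom.toAlgebra
        (show PrimeSpectrum B from Q).asIdeal _ :=
    ⟨StructureSheaf.toStalk B Q, Spec.fromSpecStalk_eq' _ _,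
      StructureSheaf.IsLocalization.to_stalk B Q⟩
  let σ : B →+* (Spec (.of B)).presheaf.stalk Q := τ.hom
  obtain ⟨I, hI⟩ : ∃ I : X.presheaf.stalk (u Q) ≅ (Spec (.of B)).presheaf.stalk Q,
      I.hom = u.stalkMap Q := ⟨@asIso _ _ _ _ (u.stalkMap Q) hiso, rfl⟩
  let ν : X.presheaf.stalk (u Q) ⟶ .of (localAlg s (u Q)) :=
    CommRingCat.ofHom (stalkEquiv s (u Q)).toRingHom
  let ε : (Spec (.of B)).presheaf.stalk Q ≃+* localAlg s (u Q) :=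
    I.symm.commRingCatIsoToRingEquiv.trans (stalkEquiv s (u Q))
  refine ⟨ε.toRingHom.comp σ, ?_, fun b => ?_, fun f => ?_⟩
  · have h1 : CommRingCat.ofHom (ε.toRingHom.comp σ) = τ ≫
      I.inv ≫ ν := rfl
    rw [h1, Spec.map_comp, Spec.map_comp, Category.assoc, Category.assoc]
    change Spec.map ν ≫ _ = Spec.map ν ≫ _
    congr 1
    have h2 : X.fromSpecStalk (u Q) =
        Spec.map I.inv ≫ Spec.map (u.stalkMap Q) ≫ X.fromSpecStalk (u Q) := by
      rw [← Spec.map_comp_assoc]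
      rw [← hI, I.hom_inv_id, Spec.map_id, Category.id_comp]
    rw [h2, Scheme.SpecMap_stalkMap_fromSpecStalk, hτ]
  · let := σ.toAlgebra
    have h2 := IsLocalization.AtPrime.isUnit_to_map_iff ((Spec (.of B)).presheaf.stalk Q)
      (show PrimeSpectrum B from Q).asIdeal b
    exact h2.symm.trans (MulEquiv.isUnit_map ε).symm
  · let := σ.toAlgebra
    obtain ⟨⟨a, b⟩, h⟩ := IsLocalization.surj
      (show PrimeSpectrum B from Q).asIdeal.primeCompl (ε.symm f)
    refine ⟨a, b, b.2, ?_⟩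
    have := congrArg ε h
    rw [map_mul, ε.apply_symm_apply] at this
    exact this

theorem exists_chartMap (u : Spec (.of B) ⟶ X) [IsOpenImmersion u]
    (hu : u ≫ s = Spec.map (CommRingCat.ofHom (algebraMap K B))) :
    ∃ θ : B →ₐ[K] FunField s,
      Spec.map (CommRingCat.ofHom θ.toRingHom) ≫ u = fromSpecFunField s := by
  obtain ⟨ψ, h, -⟩ := exists_toLocalAlg s u (⊥ : PrimeSpectrum B)
  have h2 : Spec.map (CommRingCat.ofHom ((localAlg s _).val.toRingHom.comp ψ)) ≫ u =
      fromSpecFunField s := by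
    rw [CommRingCat.ofHom_comp, Spec.map_comp, Category.assoc, h, specMap_val_fromSpecLocal]
  refine ⟨{ (localAlg s _).val.toRingHom.comp ψ with commutes' := fun c => ?_ }, h2⟩
  have h3 := fromSpecFunField_comp s
  rw [← h2, Category.assoc, hu, ← Spec.map_comp, Spec.map_inj] at h3
  exact DFunLike.congr_fun (congrArg CommRingCat.Hom.hom h3) c

/-- The inclusion of the coordinate ring of an affine chart in the function field. -/
noncomputable def chartMap (u : Spec (.of B) ⟶ X) [IsOpenImmersion u]
    (hu : u ≫ s = Spec.map (CommRingCat.ofHom (algebraMap K B))) : B →ₐ[K] FunField s :=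
  (exists_chartMap s u hu).choose

variable (u : Spec (.of B) ⟶ X) [IsOpenImmersion u]
  (hu : u ≫ s = Spec.map (CommRingCat.ofHom (algebraMap K B)))

theorem specMap_chartMap : Spec.map (CommRingCat.ofHom (chartMap s u hu).toRingHom) ≫ u =
    fromSpecFunField s :=
  (exists_chartMap s u hu).choose_spec

theorem eq_chartMap (θ : B →+* FunField s)
    (h : Spec.map (CommRingCat.ofHom θ) ≫ u = fromSpecFunField s) (b : B) :
    θ b = chartMap s u hu b := by
  rw [← specMap_chartMap s u hu, cancel_mono, Spec.map_inj] at h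
  exact DFunLike.congr_fun (congrArg CommRingCat.Hom.hom h) b

/-- A point of the chart that is given by a prime ideal. -/
noncomputable def chartPoint {X : Scheme.{u}} {B : Type u} [CommRing B]
    (u : Spec (.of B) ⟶ X) (Q : Ideal B) [hQ : Q.IsPrime] : X := u (⟨Q, hQ⟩ : PrimeSpectrum B)

theorem exists_chartPoint_eq {X : Scheme.{u}} {B : Type u} [CommRing B]
    (u : Spec (.of B) ⟶ X) {q : X} (hq : q ∈ Set.range u) :
    ∃ (Q : Ideal B) (_ : Q.IsPrime), chartPoint u Q = q := by
  obtain ⟨Q, rfl⟩ := hq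
  exact ⟨(show PrimeSpectrum B from Q).asIdeal, inferInstance, rfl⟩

theorem chartMap_mem (Q : Ideal B) [hQ : Q.IsPrime] (b : B) :
    chartMap s u hu b ∈ localAlg s (chartPoint u Q) := by
  obtain ⟨ψ, h, -⟩ := exists_toLocalAlg s u (⟨Q, hQ⟩ : PrimeSpectrum B)
  rw [← eq_chartMap s u hu ((localAlg s _).val.toRingHom.comp ψ)]
  · exact (ψ b).2
  · rw [CommRingCat.ofHom_comp, Spec.map_comp, Category.assoc, h, specMap_val_fromSpecLocal]

theorem isUnit_chartMap_iff (Q : Ideal B) [hQ : Q.IsPrime] (b : B) :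
    IsUnit (⟨chartMap s u hu b, chartMap_mem s u hu Q b⟩ : localAlg s (chartPoint u Q)) ↔
      b ∉ Q := by
  obtain ⟨ψ, h, h2, -⟩ := exists_toLocalAlg s u (⟨Q, hQ⟩ : PrimeSpectrum B)
  refine Iff.trans ?_ (h2 b).symm
  have : ψ b = ⟨chartMap s u hu b, chartMap_mem s u hu Q b⟩ := by
    refine Subtype.ext (eq_chartMap s u hu ((localAlg s _).val.toRingHom.comp ψ) ?_ b)
    rw [CommRingCat.ofHom_comp, Spec.map_comp, Category.assoc, h, specMap_val_fromSpecLocal]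
  rw [this]
  rfl

theorem mem_localAlg_chartPoint_iff (Q : Ideal B) [hQ : Q.IsPrime] (f : FunField s) :
    f ∈ localAlg s (chartPoint u Q) ↔
      ∃ a b, b ∉ Q ∧ f * chartMap s u hu b = chartMap s u hu a := by
  constructor
  · intro hf
    obtain ⟨ψ, h, -, h3⟩ := exists_toLocalAlg s u (⟨Q, hQ⟩ : PrimeSpectrum B)
    obtain ⟨a, b, hb, hab⟩ := h3 ⟨f, hf⟩
    refine ⟨a, b, hb, ?_⟩
    have h4 : Spec.map (CommRingCat.ofHom ((localAlg s _).val.toRingHom.comp ψ)) ≫ u =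
        fromSpecFunField s := by
      rw [CommRingCat.ofHom_comp, Spec.map_comp, Category.assoc, h, specMap_val_fromSpecLocal]
    rw [← eq_chartMap s u hu _ h4, ← eq_chartMap s u hu _ h4]
    exact congrArg Subtype.val hab
  · rintro ⟨a, b, hb, h⟩
    obtain ⟨h1, h2⟩ := (Subalgebra.isUnit_mk_iff (chartMap_mem s u hu Q b)).mp
      ((isUnit_chartMap_iff s u hu Q b).mpr hb)
    rw [(eq_mul_inv_iff_mul_eq₀ h1).mpr h]
    exact mul_mem (chartMap_mem s u hu Q a) h2

theorem chartMap_injective : Function.Injective (chartMap s u hu) := by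
  rw [injective_iff_map_eq_zero]
  intro b hb
  by_contra h0
  have h1 := (isUnit_chartMap_iff s u hu ⊥ b).mpr h0
  exact ((Subalgebra.isUnit_mk_iff _).mp h1).1 hb

theorem chartPoint_bot : chartPoint u ⊥ = genericPoint X := by
  have : IsDomain (CommRingCat.of B) := ‹_›
  have h := genericPoint_eq_of_isOpenImmersion u
  rw [genericPoint_eq_bot_of_affine] at h
  exact h

theorem exists_mul_chartMap_eq (f : FunField s) :
    ∃ a b, b ≠ 0 ∧ f * chartMap s u hu b = chartMap s u hu a := by
  have h : f ∈ localAlg s (chartPoint u ⊥) := by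
    rw [chartPoint_bot, localAlg_genericPoint]
    exact Algebra.mem_top
  exact (mem_localAlg_chartPoint_iff s u hu ⊥ f).mp h

theorem isFractionRing_chartMap :
    @IsFractionRing B _ (FunField s) _ (chartMap s u hu).toRingHom.toAlgebra := by
  let := (chartMap s u hu).toRingHom.toAlgebra
  have : FaithfulSMul B (FunField s) :=
    (faithfulSMul_iff_algebraMap_injective B (FunField s)).mpr (chartMap_injective s u hu)
  refine IsFractionRing.of_field B (FunField s) fun f => ?_
  obtain ⟨a, b, hb, h⟩ := exists_mul_chartMap_eq s u hu f
  refine ⟨a, b, (eq_div_iff ?_).mpr h⟩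
  exact (map_ne_zero_iff _ (chartMap_injective s u hu)).mpr hb

end Charts

theorem exists_smooth_chart {K : Type u} [Field K] {X : Scheme.{u}} [IsIntegral X]
    (s : X ⟶ Spec (.of K)) (n : ℕ) [SmoothOfRelativeDimension n s] (x : X) :
    ∃ (B : Type u) (_ : CommRing B) (_ : IsDomain B) (_ : Algebra K B)
      (_ : Algebra.IsStandardSmoothOfRelativeDimension n K B) (u : Spec (.of B) ⟶ X)
      (_ : IsOpenImmersion u) (_ : u ≫ s = Spec.map (CommRingCat.ofHom (algebraMap K B))),
      x ∈ Set.range u := by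
  obtain ⟨U, hU, V, hV, hxV, e, h⟩ :=
    SmoothOfRelativeDimension.exists_isStandardSmoothOfRelativeDimension (n := n) (f := s) x
  -- The spectrum of a field is a single point.
  have hUtop : U = ⊤ := by
    refine top_le_iff.mp fun y _ => ?_
    have : y = s x := Subsingleton.elim (α := PrimeSpectrum K) _ _
    exact this ▸ e hxV
  subst hUtop
  have : Nonempty V := ⟨⟨x, hxV⟩⟩
  let g : K →+* Γ(X, V) := (s.appLE ⊤ V e).hom.comp (Scheme.ΓSpecIso (.of K)).inv.hom
  let := g.toAlgebra
  refine ⟨Γ(X, V), inferInstance, inferInstance, g.toAlgebra, ?_, hV.fromSpec, inferInstance, ?_, ?_⟩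
  · change g.IsStandardSmoothOfRelativeDimension n
    exact RingHom.isStandardSmoothOfRelativeDimension_respectsIso.2 _
      (Scheme.ΓSpecIso (.of K)).symm.commRingCatIsoToRingEquiv h
  · have h1 := IsAffineOpen.SpecMap_appLE_fromSpec s hU hV e
    rw [← h1, IsAffineOpen.fromSpec_top, Scheme.isoSpec_Spec_inv, ← Spec.map_comp]
    rfl
  · rw [hV.range_fromSpec]
    exact hxV

/-! ### Local rings of smooth schemes: normal, Noetherian, valuation rings on curves. -/

section SmoothLocalRings

variable {K : Type u} [Field K] {X : Scheme.{u}} [IsIntegral X] (s : X ⟶ Spec (.of K))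

theorem exists_isLocalization_localAlg {B : Type u} [CommRing B] [IsDomain B] [Algebra K B]
    (u : Spec (.of B) ⟶ X) [IsOpenImmersion u]
    (hu : u ≫ s = Spec.map (CommRingCat.ofHom (algebraMap K B))) (Q : Ideal B) [hQ : Q.IsPrime] :
    ∃ ψ : B →ₐ[K] localAlg s (chartPoint u Q), (∀ b, (ψ b : FunField s) = chartMap s u hu b) ∧
      @IsLocalization.AtPrime B _ (localAlg s (chartPoint u Q)) _ ψ.toRingHom.toAlgebra Q _ := by
  let ψ : B →ₐ[K] localAlg s (chartPoint u Q) :=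
    (chartMap s u hu).codRestrict _ (chartMap_mem s u hu Q)
  refine ⟨ψ, fun b => rfl, ?_⟩
  let := ψ.toRingHom.toAlgebra
  have hmap : ∀ b, algebraMap B (localAlg s (chartPoint u Q)) b =
    ⟨chartMap s u hu b, chartMap_mem s u hu Q b⟩ := fun b => rfl
  refine ⟨fun b => ?_, fun f => ?_, fun {a b} h => ⟨1, ?_⟩⟩
  · rw [hmap]
    exact (isUnit_chartMap_iff s u hu Q b).mpr b.2
  · obtain ⟨a, b, hb, h⟩ := (mem_localAlg_chartPoint_iff s u hu Q f).mp f.2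
    exact ⟨⟨a, ⟨b, hb⟩⟩, Subtype.ext h⟩
  · rw [chartMap_injective s u hu (congrArg Subtype.val h)]

instance isFractionRing_localAlg (q : X) : IsFractionRing (localAlg s q) (FunField s) := by
  refine IsFractionRing.of_field _ _ fun f => ?_
  obtain ⟨a, b, h⟩ := IsFractionRing.div_surjective (X.presheaf.stalk q) (show X.functionField from f)
  exact ⟨stalkEquiv s q a, stalkEquiv s q b, h.2.symm⟩

variable (n : ℕ) [SmoothOfRelativeDimension n s]

include n in
theorem mem_localAlg_of_isIntegral (q : X) (y : FunField s)
    (hy : IsIntegral (localAlg s q).toSubring y) : y ∈ localAlg s q := by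
  obtain ⟨B, _, _, _, hB, u, _, hu, hq⟩ := exists_smooth_chart s n q
  obtain ⟨Q, hQ, rfl⟩ := exists_chartPoint_eq u hq
  obtain ⟨ψ, -, hψ⟩ := exists_isLocalization_localAlg s u hu Q
  let := ψ.toRingHom.toAlgebra
  have := Algebra.IsStandardSmoothOfRelativeDimension.isIntegrallyClosed K n (B := B)
  have h2 : IsIntegrallyClosed (localAlg s (chartPoint u Q)) :=
    isIntegrallyClosed_of_isLocalization _ Q.primeCompl Q.primeCompl_le_nonZeroDivisors
  have h3 := isFractionRing_localAlg s (chartPoint u Q)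
  obtain ⟨z, rfl⟩ := (@isIntegrallyClosed_iff (localAlg s (chartPoint u Q)) _ (FunField s) _ _ h3).mp h2 hy
  exact z.2

include n in
theorem isNoetherianRing_localAlg (q : X) : IsNoetherianRing (localAlg s q) := by
  obtain ⟨B, _, _, _, hB, u, _, hu, hq⟩ := exists_smooth_chart s n q
  obtain ⟨Q, hQ, rfl⟩ := exists_chartPoint_eq u hq
  obtain ⟨ψ, -, hψ⟩ := exists_isLocalization_localAlg s u hu Q
  let := ψ.toRingHom.toAlgebra
  have := Algebra.IsStandardSmoothOfRelativeDimension.isStandardSmooth n (R := K) (S := B)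
  have : Algebra.FiniteType K B := inferInstance
  exact IsLocalization.isNoetherianRing Q.primeCompl _ (Algebra.FiniteType.isNoetherianRing K B)

theorem trdeg_funField : Algebra.trdeg K (FunField s) = n := by
  obtain ⟨B, _, _, _, hB, u, _, hu, hq⟩ := exists_smooth_chart s n (genericPoint X)
  let := (chartMap s u hu).toRingHom.toAlgebra
  have := isFractionRing_chartMap s u hu
  have : IsScalarTower K B (FunField s) :=
    IsScalarTower.of_algebraMap_eq fun c => ((chartMap s u hu).commutes c).symm
  exact Algebra.IsStandardSmoothOfRelativeDimension.trdeg_eq K B n (FunField s)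

include n in
theorem isAlgebraic_mem_localAlg (q : X) {y : FunField s}
    (hy : IsAlgebraic K y) : y ∈ localAlg s q :=
  (localAlg s q).toSubring.mem_of_isAlgebraic (mem_localAlg_of_isIntegral s n q)
    (localAlg s q).algebraMap_mem hy

theorem mem_or_inv_mem_localAlg [SmoothOfRelativeDimension 1 s] (q : X) (y : FunField s) :
    y ∈ localAlg s q ∨ y⁻¹ ∈ localAlg s q := by
  have : IsLocalRing (localAlg s q).toSubring := inferInstanceAs (IsLocalRing (localAlg s q))
  refine (localAlg s q).toSubring.mem_or_inv_mem_of_isAlgebraic_adjoin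
    (mem_localAlg_of_isIntegral s 1 q) (localAlg s q).algebraMap_mem (fun y => ?_)
    (isAlgebraic_adjoin_of_trdeg_eq_one ((trdeg_funField s 1).trans Nat.cast_one)) y
  obtain ⟨a, b, hb, h⟩ := IsFractionRing.div_surjective (localAlg s q) y
  refine ⟨a, a.2, b, b.2, ?_, ?_⟩
  · exact fun h0 => nonZeroDivisors.ne_zero hb (Subtype.ext h0)
  · rw [← h]
    exact div_mul_cancel₀ _ fun h0 => nonZeroDivisors.ne_zero hb (Subtype.ext h0)

/-- The maximal ideal at a rational point of a smooth surface has two generators. -/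
theorem exists_two_generators_localAlg [SmoothOfRelativeDimension 2 s] (c : X)
    (hc : ∀ f : localAlg s c, ∃ a : K, ¬ IsUnit (f - algebraMap K _ a)) :
    ∃ x y : localAlg s c, ¬ IsUnit x ∧ ¬ IsUnit y ∧
      ∀ f, ¬ IsUnit f → ∃ a b, f = a * x + b * y := by
  obtain ⟨B, _, _, _, hB, u, _, hu, hq⟩ := exists_smooth_chart s 2 c
  obtain ⟨Q, hQ, rfl⟩ := exists_chartPoint_eq u hq
  obtain ⟨ψ, -, hψ⟩ := exists_isLocalization_localAlg s u hu Q
  let κ := IsLocalRing.ResidueField (localAlg s (chartPoint u Q))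
  -- The hypothesis says that the residue field is `K`. The point is thus given by a `K`-algebra
  -- homomorphism `χ : B → K`, and the two generators of its kernel can be used.
  have hbij : Function.Bijective (algebraMap K κ) := by
    refine ⟨(algebraMap K κ).injective, fun z => ?_⟩
    obtain ⟨f, rfl⟩ := IsLocalRing.residue_surjective z
    obtain ⟨a, ha⟩ := hc f
    refine ⟨a, ?_⟩
    have : IsLocalRing.residue _ (f - algebraMap K _ a) = 0 :=
      (IsLocalRing.residue_eq_zero_iff _).mpr ha
    rw [map_sub, sub_eq_zero] at this
    exact this.symm
  let e : K ≃ₐ[K] κ := AlgEquiv.ofBijective (Algebra.ofId K κ) hbij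
  let ρ : localAlg s (chartPoint u Q) →ₐ[K] κ := IsScalarTower.toAlgHom K _ κ
  let χ : B →ₐ[K] K := e.symm.toAlgHom.comp (ρ.comp ψ)
  have hχ : ∀ b, χ b = 0 ↔ ¬ IsUnit (ψ b) := fun b => by
    change e.symm (IsLocalRing.residue _ (ψ b)) = 0 ↔ _
    rw [map_eq_zero_iff _ e.symm.injective, IsLocalRing.residue_eq_zero_iff]
    rfl
  obtain ⟨x, y, t, hx, hy, ht, h⟩ := χ.exists_two_generators_ker
  refine ⟨ψ x, ψ y, (hχ x).mp hx, (hχ y).mp hy, fun f hf => ?_⟩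
  let := ψ.toRingHom.toAlgebra
  obtain ⟨⟨a, b⟩, hab⟩ := IsLocalization.surj Q.primeCompl f
  change f * ψ b = ψ a at hab
  have hb : IsUnit (ψ b) := IsLocalization.map_units _ b
  have ha : χ a = 0 := by
    rw [hχ, ← hab]
    exact fun h => hf (isUnit_of_mul_isUnit_left h)
  have ht' : IsUnit (ψ t) := by
    by_contra h
    exact ht ((hχ t).mpr h)
  obtain ⟨p, q, hpq⟩ := h a ha
  have h1 : f * (ψ b * ψ t) = ψ p * ψ x + ψ q * ψ y := by
    rw [← map_mul ψ p x, ← map_mul ψ q y, ← map_add, ← hpq, map_mul, ← hab]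
    ring
  obtain ⟨w, hw⟩ := (hb.mul ht').exists_right_inv
  refine ⟨w * ψ p, w * ψ q, ?_⟩
  linear_combination w * h1 - f * hw

end SmoothLocalRings

/-! ### Residues along a center of small dimension. -/

section ResidueField

open Polynomial

variable {K k F : Type*} [Field K] [Field k] [Field F] [Algebra K k] [Algebra k F] [Algebra K F]
  [IsScalarTower K k F] {v : Valuation F (WithZero (Multiplicative ℤ))}

theorem isAlgebraic_algebraAdjoin_of_trdeg_eq_one (h : Algebra.trdeg K k = 1) (ξ : k)
    (hξ : Transcendental K ξ) : Algebra.IsAlgebraic (Algebra.adjoin K {ξ}) k := by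
  have h1 : AlgebraicIndependent K (fun _ : Unit => ξ) :=
    (algebraicIndependent_unique_type_iff (ι := Unit)).mpr hξ
  have h2 := h1.isTranscendenceBasis_of_lift_trdeg_le (by simp [h]) (by simp [h])
  have h3 := h2.isAlgebraic
  rw [show Set.range (fun _ : Unit => ξ) = {ξ} from Set.range_const] at h3
  exact h3

theorem aeval_mem_of_mem (R : Subalgebra K F) {f : F} (hf : f ∈ R) (g : K[X]) : aeval f g ∈ R := by
  rw [show f = R.val ⟨f, hf⟩ from rfl, aeval_algHom_apply]
  exact Subtype.prop _

theorem IsRationalPlace.residue_aeval (hv : IsRationalPlace k v) {f : F} {y : k}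
    (h : v (f - algebraMap k F y) < 1) (g : K[X]) :
    v (aeval f g - algebraMap k F (aeval y g)) < 1 := by
  rw [aeval_eq_sum_range, aeval_eq_sum_range]
  refine IsRationalPlace.residue_sum _ fun i _ => ?_
  rw [Algebra.smul_def, Algebra.smul_def, IsScalarTower.algebraMap_apply K k F]
  exact hv.residue_mul (IsRationalPlace.residue_algebraMap _) (hv.residue_pow h i)

/-- If `v` dominates `R` and the residue of `x ∈ k` is transcendental over that of `R`, then the
residues of `R` are algebraic over `K`. -/
theorem IsRationalPlace.isAlgebraic_residue (hv : IsRationalPlace k v)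
    (htr : Algebra.trdeg K k = 1) (R : Subalgebra K F)
    (hR : ∀ f (hf : f ∈ R), v f = 1 → IsUnit (⟨f, hf⟩ : R)) (x : k)
    (hx : ∀ P : R[X], (∃ i, IsUnit (P.coeff i)) → ¬ v (aeval (algebraMap k F x) P) < 1)
    {f : F} (hf : f ∈ R) {y : k} (hy : v (f - algebraMap k F y) < 1) : IsAlgebraic K y := by
  by_contra htrans
  -- If `y` were transcendental, `x` would satisfy an equation with coefficients in `K[y]`.
  -- Replacing `y` by its lift `f` gives a polynomial over `R` whose leading coefficient is a unit,
  -- its residue being nonzero, and whose value at `x` has residue zero. This contradicts `hx`.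
  obtain ⟨p, hp0, hp⟩ := (isAlgebraic_algebraAdjoin_of_trdeg_eq_one htr y htrans).isAlgebraic x
  have hg (i : ℕ) : ∃ g : K[X], aeval y g = (p.coeff i : k) := by
    have h1 := (Algebra.adjoin_singleton_eq_range_aeval K y).le (p.coeff i).2
    exact h1
  choose g hg using hg
  let P : R[X] := ∑ i ∈ Finset.range (p.natDegree + 1), monomial i (aeval (⟨f, hf⟩ : R) (g i))
  refine hx P ⟨p.natDegree, ?_⟩ ?_
  · have : P.coeff p.natDegree = aeval (⟨f, hf⟩ : R) (g p.natDegree) := by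
      simp [P, coeff_monomial]
    rw [this]
    have h1 : (aeval (⟨f, hf⟩ : R) (g p.natDegree) : R) =
        (⟨aeval f (g p.natDegree), aeval_mem_of_mem R hf _⟩ : R) :=
      Subtype.ext (aeval_algHom_apply R.val _ _).symm
    rw [h1]
    refine hR _ _ (hv.eq_one_of_residue_ne_zero (hv.residue_aeval hy _) ?_)
    rw [hg]
    simpa using hp0
  · have h1 : aeval (algebraMap k F x) P =
        ∑ i ∈ Finset.range (p.natDegree + 1), aeval f (g i) * algebraMap k F x ^ i := by
      simp only [P, map_sum, aeval_monomial]
      refine Finset.sum_congr rfl fun i _ => ?_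
      congr 1
      exact (aeval_algHom_apply R.val _ _).symm
    have h2 : ∑ i ∈ Finset.range (p.natDegree + 1), (p.coeff i : k) * x ^ i = 0 := by
      rw [aeval_eq_sum_range] at hp
      exact hp
    have h3 := IsRationalPlace.residue_sum (v := v) (Finset.range (p.natDegree + 1))
      (a := fun i => aeval f (g i) * algebraMap k F x ^ i)
      (c := fun i => (p.coeff i : k) * x ^ i) fun i _ => by
        refine hv.residue_mul ?_ (hv.residue_pow (IsRationalPlace.residue_algebraMap x) i)
        rw [← hg]
        exact hv.residue_aeval hy _
    rw [h2, map_zero, sub_zero] at h3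
    rw [h1]
    exact h3

end ResidueField

/-! ### Uniqueness of the valuation ring of `k(t)` at infinity. -/

section RationalFunctions

open Polynomial

variable {k F : Type*} [Field k] [Field F] [Algebra k F] {t : F}

/-- The value is a nonzero constant of `k` plus an element of the maximal ideal, hence a unit. -/
theorem ValuationSubring.aeval_inv_notMem_nonunits (W : ValuationSubring F)
    (hk : ∀ x : k, algebraMap k F x ∈ W) (ht : t⁻¹ ∈ W.nonunits) (P : k[X])
    (hP : P.coeff 0 ≠ 0) : aeval t⁻¹ P ∈ W ∧ (aeval t⁻¹ P)⁻¹ ∈ W ∧ aeval t⁻¹ P ≠ 0 := by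
  let f : k →+* W := (algebraMap k F).codRestrict W hk
  obtain ⟨htW, htm⟩ := W.mem_nonunits_iff_exists_mem_maximalIdeal.mp ht
  let τ : W := ⟨t⁻¹, htW⟩
  have h1 : (((P.map f).eval τ : W) : F) = aeval t⁻¹ P := by
    rw [Polynomial.eval_map, ← W.coe_subtype, hom_eval₂]
    rfl
  have h2 : IsUnit ((P.map f).eval τ) := by
    rw [← divX_mul_X_add (P.map f), eval_add, eval_mul, eval_X, eval_C, coeff_map]
    have hu : IsUnit (f (P.coeff 0)) := (IsUnit.mk0 _ hP).map f
    by_contra h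
    have h3 := Ideal.sub_mem _ (show _ ∈ IsLocalRing.maximalIdeal W from h)
      (Ideal.mul_mem_left _ (eval τ (P.map f).divX) htm)
    rw [add_sub_cancel_left] at h3
    exact h3 hu
  obtain ⟨w, hw⟩ := h2.exists_right_inv
  have hw' : aeval t⁻¹ P * (w : F) = 1 := by rw [← h1]; exact congrArg Subtype.val hw
  refine ⟨h1 ▸ ((P.map f).eval τ).2, ?_, left_ne_zero_of_mul_eq_one hw'⟩
  rw [inv_eq_of_mul_eq_one_right hw']
  exact w.2

theorem exists_aeval_eq_pow_mul_aeval_inv (ht : t ≠ 0) (P : k[X]) (hP : P ≠ 0) :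
    ∃ (n : ℕ) (P' : k[X]), P'.coeff 0 ≠ 0 ∧ aeval t P = t ^ n * aeval t⁻¹ P' := by
  refine ⟨P.natDegree, P.reverse, by simpa using hP, ?_⟩
  let := invertibleOfNonzero ht
  have h3 := eval₂_reverse_mul_pow (algebraMap k F) t P
  rw [invOf_eq_inv] at h3
  rw [aeval_def, aeval_def, ← h3, mul_comm]

/-- A valuation ring of `k(t)` containing `k` with `t⁻¹` in its maximal ideal is unique. -/
theorem ValuationSubring.le_of_inv_mem_nonunits
    (hgen : ∀ f : F, ∃ P Q : k[X], aeval t Q ≠ 0 ∧ f * aeval t Q = aeval t P)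
    (W W' : ValuationSubring F) (hk : ∀ x : k, algebraMap k F x ∈ W)
    (ht : t⁻¹ ∈ W.nonunits) (hk' : ∀ x : k, algebraMap k F x ∈ W')
    (ht' : t⁻¹ ∈ W'.nonunits) (h0 : t ≠ 0) : W ≤ W' := by
  intro f hf
  by_cases hf0 : f = 0
  · rw [hf0]; exact W'.zero_mem
  obtain ⟨P, Q, hQ, hfQ⟩ := hgen f
  have hQ0 : Q ≠ 0 := fun h => hQ (by rw [h, map_zero])
  have hP0 : P ≠ 0 := fun h => mul_ne_zero hf0 hQ (by rw [hfQ, h, map_zero])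
  -- This gives `f = t ^ (n - m)` times an element that is a unit in both valuation rings.
  -- Membership in `W` forces `n ≤ m`, and this gives membership in `W'`.
  obtain ⟨n, P', hP', hP⟩ := exists_aeval_eq_pow_mul_aeval_inv h0 P hP0
  obtain ⟨m, Q', hQ', hQ⟩ := exists_aeval_eq_pow_mul_aeval_inv h0 Q hQ0
  obtain ⟨a1, a2, a3⟩ := W.aeval_inv_notMem_nonunits hk ht P' hP'
  obtain ⟨b1, b2, b3⟩ := W.aeval_inv_notMem_nonunits hk ht Q' hQ'
  obtain ⟨a1', a2', a3'⟩ := W'.aeval_inv_notMem_nonunits hk' ht' P' hP'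
  obtain ⟨b1', b2', b3'⟩ := W'.aeval_inv_notMem_nonunits hk' ht' Q' hQ'
  rw [hP, hQ] at hfQ
  obtain ⟨htW, htm⟩ := W.mem_nonunits_iff_exists_mem_maximalIdeal.mp ht
  obtain ⟨htW', htm'⟩ := W'.mem_nonunits_iff_exists_mem_maximalIdeal.mp ht'
  have hnm : n ≤ m := by
    by_contra! hlt
    obtain ⟨d, rfl⟩ := Nat.exists_eq_add_of_lt hlt
    have h1 : t⁻¹ * (t⁻¹ ^ d * (f * aeval t⁻¹ Q' * (aeval t⁻¹ P')⁻¹)) = 1 := by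
      have h2 : f * aeval t⁻¹ Q' = t ^ (d + 1) * aeval t⁻¹ P' := by
        refine mul_left_cancel₀ (pow_ne_zero m h0) ?_
        linear_combination hfQ
      rw [h2, mul_inv_cancel_right₀ a3, inv_pow, ← mul_assoc, ← mul_inv, ← pow_succ',
        inv_mul_cancel₀ (pow_ne_zero _ h0)]
    have h2 : t⁻¹ ^ d * (f * aeval t⁻¹ Q' * (aeval t⁻¹ P')⁻¹) ∈ W :=
      W.mul_mem _ _ (pow_mem htW d) (W.mul_mem _ _ (W.mul_mem _ _ hf b1) a2)
    exact htm (IsUnit.of_mul_eq_one ⟨_, h2⟩ (Subtype.ext h1))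
  obtain ⟨d, rfl⟩ := Nat.exists_eq_add_of_le hnm
  have h1 : f = t⁻¹ ^ d * (aeval t⁻¹ P' * (aeval t⁻¹ Q')⁻¹) := by
    have h2 : f * aeval t⁻¹ Q' * t ^ d = aeval t⁻¹ P' := by
      refine mul_left_cancel₀ (pow_ne_zero n h0) ?_
      linear_combination hfQ
    rw [← h2, mul_right_comm, mul_inv_cancel_right₀ b3, inv_pow, mul_comm,
      mul_inv_cancel_right₀ (pow_ne_zero _ h0)]
  rw [h1]
  exact W'.mul_mem _ _ (pow_mem htW' d) (W'.mul_mem _ _ a1' b2')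

end RationalFunctions

/-! ### Fundamental points as centers of the place at infinity of the cylinder. -/

section FundamentalPoints

open Polynomial

variable {K : Type u} [Field K] {S Z' : Scheme.{u}} [IsIntegral S] [IsIntegral Z']
  (s : S ⟶ Spec (.of K)) (z' : Z' ⟶ Spec (.of K)) [Algebra (FunField z') (FunField s)]

/-- The points of `S` whose local ring does not induce a valuation ring on the function field of
the curve `Z'`. -/
def IsFundamental (q : S) : Prop :=
  ∃ x : FunField z', algebraMap _ (FunField s) x ∉ localAlg s q ∧
    (algebraMap _ (FunField s) x)⁻¹ ∉ localAlg s q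

/-- An affine chart `Spec A` of `Z'` with an open immersion of `Spec A[X]` in `S` that is
compatible with the embedding of the function fields. -/
structure CylinderChart where
  /-- The coordinate ring of the chart of the curve. -/
  A : Type u
  [commRing : CommRing A]
  [isDomain : IsDomain A]
  [algebra : Algebra K A]
  [finiteType : Algebra.FiniteType K A]
  /-- The chart of the curve. -/
  a : Spec (.of A) ⟶ Z'
  [isOpenImmersion_a : IsOpenImmersion a]
  a_comp : a ≫ z' = Spec.map (CommRingCat.ofHom (algebraMap K A))
  /-- The chart of the surface. -/
  u : Spec (.of A[X]) ⟶ S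
  [isOpenImmersion_u : IsOpenImmersion u]
  u_comp : u ≫ s = Spec.map (CommRingCat.ofHom (algebraMap K A[X]))
  chartMap_C : ∀ b : A, chartMap s u u_comp (C b) =
    algebraMap (FunField z') (FunField s) (chartMap z' a a_comp b)

namespace CylinderChart

attribute [instance] commRing isDomain algebra finiteType isOpenImmersion_a isOpenImmersion_u

variable {s z'} (D : CylinderChart s z')

/-- The coordinate along the fibers. -/
noncomputable def t : FunField s := chartMap s D.u D.u_comp X

theorem chartMap_eq_aeval (p : D.A[X]) : chartMap s D.u D.u_comp p =
    aeval D.t (p.map (chartMap z' D.a D.a_comp).toRingHom) := by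
  induction p using Polynomial.induction_on' with
  | add p q hp hq => rw [map_add, hp, hq, Polynomial.map_add, map_add]
  | monomial n b =>
    rw [← C_mul_X_pow_eq_monomial, map_mul, map_pow, D.chartMap_C, Polynomial.map_mul,
      Polynomial.map_pow, map_C, map_X, map_mul, map_pow, aeval_C, aeval_X]
    rfl

/-- Clearing denominators in a relation over the function field of the curve gives one over `A`,
that is, an element of `A[X]` killed by the injective chart map. -/
theorem transcendental_t : Transcendental (FunField z') D.t := by
  let := (chartMap z' D.a D.a_comp).toRingHom.toAlgebra
  have := isFractionRing_chartMap z' D.a D.a_comp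
  let : Algebra D.A (FunField s) := ((algebraMap (FunField z') (FunField s)).comp
    (algebraMap D.A (FunField z'))).toAlgebra
  have : IsScalarTower D.A (FunField z') (FunField s) := IsScalarTower.of_algebraMap_eq fun _ => rfl
  rw [Transcendental, ← IsFractionRing.isAlgebraic_iff D.A (FunField z') (FunField s)]
  rintro ⟨p, hp0, hp⟩
  apply hp0
  apply chartMap_injective s D.u D.u_comp
  rw [map_zero, D.chartMap_eq_aeval, ← hp]
  exact (aeval_map_algebraMap (FunField z') D.t p)

theorem t_ne_zero : D.t ≠ 0 := fun h => by
  have := D.transcendental_t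
  rw [h] at this
  exact this isAlgebraic_zero

theorem exists_mul_aeval_eq (f : FunField s) : ∃ P Q : (FunField z')[X],
    aeval D.t Q ≠ 0 ∧ f * aeval D.t Q = aeval D.t P := by
  obtain ⟨p, q, hq, h⟩ := exists_mul_chartMap_eq s D.u D.u_comp f
  refine ⟨p.map (chartMap z' D.a D.a_comp).toRingHom, q.map (chartMap z' D.a D.a_comp).toRingHom,
    ?_, ?_⟩
  · rw [← D.chartMap_eq_aeval]
    exact (map_ne_zero_iff _ (chartMap_injective s D.u D.u_comp)).mpr hq
  · rw [← D.chartMap_eq_aeval, ← D.chartMap_eq_aeval, h]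

theorem exists_algEquiv_ratFunc :
    ∃ e : RatFunc (FunField z') ≃ₐ[FunField z'] FunField s, e RatFunc.X = D.t := by
  let : Algebra (FunField z')[X] (FunField s) := (aeval D.t).toRingHom.toAlgebra
  have : FaithfulSMul (FunField z')[X] (FunField s) :=
    (faithfulSMul_iff_algebraMap_injective _ _).mpr
      (transcendental_iff_injective.mp D.transcendental_t)
  have : IsFractionRing (FunField z')[X] (FunField s) := by
    refine IsFractionRing.of_field _ _ fun f => ?_
    obtain ⟨P, Q, hQ, h⟩ := D.exists_mul_aeval_eq f
    exact ⟨P, Q, (eq_div_iff hQ).mpr h⟩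
  have : IsScalarTower (FunField z') (FunField z')[X] (FunField s) :=
    IsScalarTower.of_algebraMap_eq fun x => (aeval_C D.t x).symm
  let e := IsLocalization.algEquiv (nonZeroDivisors (FunField z')[X]) (RatFunc (FunField z'))
    (FunField s)
  refine ⟨e.restrictScalars (FunField z'), ?_⟩
  rw [← RatFunc.algebraMap_X]
  exact (e.commutes X).trans (aeval_X D.t)

/-- The section at infinity of the cylinder: minus the degree in `t`, with residue field the
function field of the curve. -/
theorem exists_place : ∃ v : Valuation (FunField s) (WithZero (Multiplicative ℤ)),
    IsRationalPlace (FunField z') v ∧ 1 < v D.t := by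
  obtain ⟨e, he⟩ := D.exists_algEquiv_ratFunc
  rw [← he]
  exact exists_isRationalPlace_ratFunc e

/-- The point lies over a point of the curve, whose local ring is a valuation ring and maps into
`𝒪_q`. -/
theorem not_isFundamental [SmoothOfRelativeDimension 1 z'] {q : S} (hq : q ∈ Set.range D.u) :
    ¬ IsFundamental s z' q := by
  obtain ⟨Q, hQ, rfl⟩ := exists_chartPoint_eq D.u hq
  rintro ⟨x, hx, hx'⟩
  let P : Ideal D.A := Q.comap C
  have hP : P.IsPrime := Ideal.IsPrime.comap C
  have key (x : FunField z') (h : x ∈ localAlg z' (chartPoint D.a P)) :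
      algebraMap _ (FunField s) x ∈ localAlg s (chartPoint D.u Q) := by
    obtain ⟨b, c, hc, h⟩ := (mem_localAlg_chartPoint_iff z' D.a D.a_comp P x).mp h
    refine (mem_localAlg_chartPoint_iff s D.u D.u_comp Q _).mpr ⟨C b, C c, hc, ?_⟩
    rw [D.chartMap_C, D.chartMap_C, ← map_mul, h]
  rcases mem_or_inv_mem_localAlg z' (chartPoint D.a P) x with h | h
  · exact hx (key x h)
  · exact hx' (by rw [← map_inv₀]; exact key _ h)

/-- A valuation ring of the function field dominates a local ring. -/
def _root_.Dominates (W : ValuationSubring (FunField s)) (q : S) : Prop :=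
  ∀ f (hf : f ∈ localAlg s q), f ∈ W ∧ (f ∉ W.nonunits → IsUnit (⟨f, hf⟩ : localAlg s q))

/-- A valuation ring containing `k` and `t` contains the coordinate ring `A[X]` of the chart, so it
has a center in the chart. Centers are unique on a separated scheme. -/
theorem mem_range_of_dominates [IsSeparated s] {W : ValuationSubring (FunField s)} {q : S}
    (h : Dominates W q) (hk : ∀ x : FunField z', algebraMap _ (FunField s) x ∈ W) (ht : D.t ∈ W) :
    q ∈ Set.range D.u := by
  have hmem (p : D.A[X]) : chartMap s D.u D.u_comp p ∈ W := by
    rw [D.chartMap_eq_aeval, aeval_eq_sum_range]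
    refine sum_mem fun i _ => ?_
    rw [Algebra.smul_def]
    exact W.mul_mem _ _ (hk _) (pow_mem ht i)
  let θ : D.A[X] →+* W := (chartMap s D.u D.u_comp).toRingHom.codRestrict W.toSubring hmem
  let Q : Ideal D.A[X] := (IsLocalRing.maximalIdeal W).comap θ
  have hQ : Q.IsPrime := Ideal.IsPrime.comap θ
  have hunit (p : D.A[X]) (hp : p ∉ Q) : (chartMap s D.u D.u_comp p)⁻¹ ∈ W := by
    have : IsUnit (θ p) := by
      by_contra h
      exact hp h
    obtain ⟨w, hw⟩ := this.exists_right_inv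
    have hw' : chartMap s D.u D.u_comp p * w = 1 := congrArg Subtype.val hw
    rw [inv_eq_of_mul_eq_one_right hw']
    exact w.2
  have h' : Dominates W (chartPoint D.u Q) := by
    intro f hf
    obtain ⟨a, b, hb, hab⟩ := (mem_localAlg_chartPoint_iff s D.u D.u_comp Q f).mp hf
    have hb0 : chartMap s D.u D.u_comp b ≠ 0 :=
      (map_ne_zero_iff _ (chartMap_injective s D.u D.u_comp)).mpr fun h => hb (h ▸ Q.zero_mem)
    have hfW : f ∈ W := by
      rw [(eq_mul_inv_iff_mul_eq₀ hb0).mpr hab]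
      exact W.mul_mem _ _ (hmem a) (hunit b hb)
    refine ⟨hfW, fun hn => ?_⟩
    rw [ValuationSubring.mem_nonunits_iff_or] at hn
    push Not at hn
    have ha : a ∉ Q := by
      intro ha
      have h1 : IsUnit (θ b) := by
        by_contra h
        exact hb h
      have h2 : (⟨f, hfW⟩ : W) * θ b = θ a := Subtype.ext hab
      have h3 : IsUnit (⟨f, hfW⟩ : W) :=
        IsUnit.of_mul_eq_one ⟨f⁻¹, hn.2⟩ (Subtype.ext (mul_inv_cancel₀ hn.1))
      exact ha (h2 ▸ h3.mul h1)
    rw [Subalgebra.isUnit_mk_iff]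
    refine ⟨hn.1, (mem_localAlg_chartPoint_iff s D.u D.u_comp Q _).mpr ⟨b, a, ha, ?_⟩⟩
    rw [← hab, inv_mul_cancel_left₀ hn.1]
  exact center_unique s W h h' ▸ ⟨_, rfl⟩

theorem _root_.Valuation.mem_nonunits_valuationSubring_iff {F Γ : Type*} [Field F]
    [LinearOrderedCommGroupWithZero Γ] (v : Valuation F Γ) (f : F) :
    f ∈ v.valuationSubring.nonunits ↔ v f < 1 := by
  rw [ValuationSubring.mem_nonunits_iff_or, Valuation.mem_valuationSubring_iff, map_inv₀]
  by_cases hf : f = 0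
  · simp [hf]
  · rw [or_iff_right hf, not_le, one_lt_inv₀ (by simpa [zero_lt_iff] using hf)]

theorem inv_t_mem_nonunits {v : Valuation (FunField s) (WithZero (Multiplicative ℤ))}
    (ht : 1 < v D.t) : D.t⁻¹ ∈ v.valuationSubring.nonunits := by
  rw [ValuationSubring.mem_nonunits_iff_or, inv_inv]
  exact Or.inr fun h => absurd ht (not_lt.mpr h)

variable [IsScalarTower K (FunField z') (FunField s)]
  [SmoothOfRelativeDimension 2 s] [SmoothOfRelativeDimension 1 z']
  {v : Valuation (FunField s) (WithZero (Multiplicative ℤ))}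

/-- The valuation ring `W` built from `𝒪_q` and `x` has `x` residually transcendental, so it
contains `k`. It does not contain `t`, because `q` is outside the cylinder chart. Hence `W` is the
ring of `v`, which thereby dominates `𝒪_q` and inherits the transcendence of `x` over the residues.
-/
theorem dominates_of_isFundamental [IsSeparated s] (hv : IsRationalPlace (FunField z') v)
    (ht : 1 < v D.t) {q : S} (hq : IsFundamental s z' q) :
    Dominates v.valuationSubring q ∧ ∃ x : FunField z', ∀ P : (localAlg s q)[X],
      (∃ i, IsUnit (P.coeff i)) → ¬ v (aeval (algebraMap (FunField z') (FunField s) x) P) < 1 := by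
  obtain ⟨x, hx, hx'⟩ := id hq
  have : IsLocalRing (localAlg s q).toSubring := inferInstanceAs (IsLocalRing (localAlg s q))
  obtain ⟨W, hRW, hnu, hW⟩ := (localAlg s q).toSubring.exists_valuationSubring_of_notMem
    (mem_localAlg_of_isIntegral s 2 q) hx hx'
  -- Elements algebraic over `K` lie in every local ring, by normality, so they cannot witness that
  -- a point is fundamental.
  have hxt : Transcendental K x := fun h => hx (isAlgebraic_mem_localAlg s 2 q (h.algebraMap))
  have hk : ∀ y : FunField z', algebraMap _ (FunField s) y ∈ W := by
    refine W.algebraMap_mem_of_isAlgebraic_adjoin (K := K)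
      (isAlgebraic_adjoin_of_trdeg_eq_one ((trdeg_funField z' 1).trans Nat.cast_one) x hxt)
      fun P hP => ?_
    have := (localAlg s q).toSubring.aeval_mem_of_coeff_isUnit (localAlg s q).algebraMap_mem hW P hP
    rwa [aeval_algebraMap_apply] at this
  have hdom : Dominates W q := by
    intro f hf
    refine ⟨hRW hf, fun hn => ?_⟩
    by_contra h
    exact hn (hnu ⟨f, hf⟩ h)
  have htW : D.t⁻¹ ∈ W.nonunits := by
    rw [ValuationSubring.mem_nonunits_iff_or, inv_inv]
    refine Or.inr fun h => ?_
    exact D.not_isFundamental (D.mem_range_of_dominates hdom hk h) hq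
  have hkv : ∀ y : FunField z', algebraMap _ (FunField s) y ∈ v.valuationSubring :=
    fun y => hv.map_algebraMap_le y
  have heq : W = v.valuationSubring := le_antisymm
    (W.le_of_inv_mem_nonunits D.exists_mul_aeval_eq _ hk htW hkv (D.inv_t_mem_nonunits ht)
      D.t_ne_zero)
    (ValuationSubring.le_of_inv_mem_nonunits D.exists_mul_aeval_eq _ W hkv
      (D.inv_t_mem_nonunits ht) hk htW D.t_ne_zero)
  subst heq
  refine ⟨hdom, x, fun P hP hlt => ?_⟩
  exact (hW P hP).2 ((v.mem_nonunits_valuationSubring_iff _).mpr hlt)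

include D in
theorem isFundamental_unique [IsSeparated s] {q q' : S} (hq : IsFundamental s z' q)
    (hq' : IsFundamental s z' q') : q = q' := by
  obtain ⟨v, hv, ht⟩ := D.exists_place
  exact center_unique s v.valuationSubring (D.dominates_of_isFundamental hv ht hq).1
    (D.dominates_of_isFundamental hv ht hq').1

/-- The residue field at the fundamental point is `K`. -/
theorem exists_residue_of_isFundamental [IsSeparated s] (hv : IsRationalPlace (FunField z') v)
    (ht : 1 < v D.t) {q : S} (hq : IsFundamental s z' q)
    (hK : ∀ y : FunField s, IsAlgebraic K y → y ∈ (algebraMap K (FunField s)).range)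
    {f : FunField s} (hf : f ∈ localAlg s q) :
    ∃ c : K, v (f - algebraMap K (FunField s) c) < 1 := by
  obtain ⟨hdom, x, hx⟩ := D.dominates_of_isFundamental hv ht hq
  obtain ⟨y, hy⟩ := hv.exists_residue f (hdom f hf).1
  have hR : ∀ g (hg : g ∈ localAlg s q), v g = 1 → IsUnit (⟨g, hg⟩ : localAlg s q) := by
    intro g hg h1
    refine (hdom g hg).2 fun h => ?_
    exact ((v.mem_nonunits_valuationSubring_iff _).mp h).ne h1
  have halg := hv.isAlgebraic_residue ((trdeg_funField z' 1).trans Nat.cast_one) (localAlg s q)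
    hR x hx hf hy
  obtain ⟨c, hc⟩ := hK _ (halg.algebraMap (A := FunField s))
  exact ⟨c, by rw [hc]; exact hy⟩

end CylinderChart

end FundamentalPoints

/-! ### Rationality of the fundamental point and of the curve. -/

section RationalPoints

open IntermediateField

variable {K : Type u} [Field K] {S : Scheme.{u}} [IsIntegral S] (s : S ⟶ Spec (.of K))

theorem exists_point_of_residue (c : S)
    (hc : ∀ f : localAlg s c, ∃ a : K, ¬ IsUnit (f - algebraMap K _ a)) :
    ∃ p : Spec (.of K) ⟶ S, p ≫ s = 𝟙 _ ∧ Set.range p = {c} := by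
  let κ := IsLocalRing.ResidueField (localAlg s c)
  have hbij : Function.Bijective (algebraMap K κ) := by
    refine ⟨(algebraMap K κ).injective, fun z => ?_⟩
    obtain ⟨f, rfl⟩ := IsLocalRing.residue_surjective z
    obtain ⟨a, ha⟩ := hc f
    refine ⟨a, ?_⟩
    have : IsLocalRing.residue _ (f - algebraMap K _ a) = 0 :=
      (IsLocalRing.residue_eq_zero_iff _).mpr ha
    rw [map_sub, sub_eq_zero] at this
    exact this.symm
  let e : K ≃ₐ[K] κ := AlgEquiv.ofBijective (Algebra.ofId K κ) hbij
  let χ : localAlg s c →ₐ[K] K := e.symm.toAlgHom.comp (IsScalarTower.toAlgHom K _ κ)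
  have hχ : IsLocalHom χ.toRingHom := by
    refine ⟨fun f hf => ?_⟩
    have h1 : IsUnit (IsLocalRing.residue (localAlg s c) f) :=
      (MulEquiv.isUnit_map e.symm).mp hf
    exact (isUnit_map_iff (IsLocalRing.residue (localAlg s c)) f).mp h1
  refine ⟨Spec.map (CommRingCat.ofHom χ.toRingHom) ≫ fromSpecLocal s c, ?_, ?_⟩
  · rw [Category.assoc, fromSpecLocal_comp, ← Spec.map_comp, ← Spec.map_id]
    congr 1
    ext a
    exact χ.commutes a
  · have h1 := fromSpecLocal_apply_of_isLocalHom s χ.toRingHom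
    refine Set.eq_singleton_iff_unique_mem.mpr ⟨⟨_, h1⟩, ?_⟩
    rintro _ ⟨y, rfl⟩
    have hy : y = closedPt K := Subsingleton.elim (α := PrimeSpectrum K) _ _
    subst hy
    exact h1

namespace CylinderChart

variable {Z' : Scheme.{u}} [IsIntegral Z'] {s} {z' : Z' ⟶ Spec (.of K)}
  [Algebra (FunField z') (FunField s)] [IsScalarTower K (FunField z') (FunField s)]
  [SmoothOfRelativeDimension 2 s] [SmoothOfRelativeDimension 1 z'] (D : CylinderChart s z')

include D in
theorem exists_residue_localAlg [IsSeparated s] {c : S} (hc : IsFundamental s z' c)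
    (hK : ∀ y : FunField s, IsAlgebraic K y → y ∈ (algebraMap K (FunField s)).range)
    (f : localAlg s c) : ∃ a : K, ¬ IsUnit (f - algebraMap K _ a) := by
  obtain ⟨v, hv, ht⟩ := D.exists_place
  obtain ⟨a, ha⟩ := D.exists_residue_of_isFundamental hv ht hc hK f.2
  refine ⟨a, fun hu => ?_⟩
  obtain ⟨w, hw⟩ := hu.exists_right_inv
  have hw' : (f - algebraMap K (FunField s) a) * (w : FunField s) = 1 := congrArg Subtype.val hw
  have h1 := congrArg v hw'
  have h2 : v (w : FunField s) ≤ 1 := ((D.dominates_of_isFundamental hv ht hc).1 w w.2).1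
  rw [map_mul, map_one] at h1
  exact (mul_lt_one_of_lt_of_le ha h2).ne h1

include D in
theorem exists_point_of_isFundamental [IsSeparated s] {c : S} (hc : IsFundamental s z' c)
    (hK : ∀ y : FunField s, IsAlgebraic K y → y ∈ (algebraMap K (FunField s)).range) :
    ∃ p : Spec (.of K) ⟶ S, p ≫ s = 𝟙 _ ∧ Set.range p = {q | IsFundamental s z' q} := by
  obtain ⟨p, h1, h2⟩ := exists_point_of_residue s c (D.exists_residue_localAlg hc hK)
  refine ⟨p, h1, h2.trans ?_⟩
  ext q
  exact ⟨fun h => (show q = c from h) ▸ hc, fun h => D.isFundamental_unique h hc⟩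

include D in
-- The local ring at the fundamental point is Noetherian with residue field `K` and two generators
-- of its maximal ideal, and it is dominated by `v`. This is the starting point of Zariski's
-- argument.
theorem exists_adjoin_eq_top [IsSeparated s] {c : S} (hc : IsFundamental s z' c)
    (hK : ∀ y : FunField s, IsAlgebraic K y → y ∈ (algebraMap K (FunField s)).range) :
    ∃ τ : FunField z', Transcendental K τ ∧ K⟮τ⟯ = ⊤ := by
  obtain ⟨v, hv, ht⟩ := D.exists_place
  have hdom := (D.dominates_of_isFundamental hv ht hc).1
  have hnu : ∀ f : localAlg s c, ¬ IsUnit f ↔ v f < 1 := by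
    intro f
    rw [← v.mem_nonunits_valuationSubring_iff]
    refine ⟨fun h => ?_, fun h hu => ?_⟩
    · by_contra h'
      exact h ((hdom f f.2).2 h')
    · obtain ⟨h0, h1⟩ := (Subalgebra.isUnit_mk_iff f.2).mp hu
      rw [ValuationSubring.mem_nonunits_iff_or] at h
      exact h.elim h0 fun h => h (hdom _ h1).1
  obtain ⟨x, y, hx, hy, hxy⟩ :=
    exists_two_generators_localAlg s c (D.exists_residue_localAlg hc hK)
  have h : IsTwoGeneratedAtCenter (FunField z') v (localAlg s c) (x : FunField s) y :=
    { noetherian := isNoetherianRing_localAlg s 2 c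
      exists_residue := fun r hr => by
        obtain ⟨a, ha⟩ := D.exists_residue_of_isFundamental hv ht hc hK hr
        exact ⟨a, by rwa [← IsScalarTower.algebraMap_apply]⟩
      left_mem := x.2
      right_mem := y.2
      left_lt := (hnu x).mp hx
      right_lt := (hnu y).mp hy
      exists_eq := fun r hr hlt => by
        obtain ⟨a, b, hab⟩ := hxy ⟨r, hr⟩ ((hnu ⟨r, hr⟩).mpr hlt)
        exact ⟨a, a.2, b, b.2, congrArg Subtype.val hab⟩
      exists_mul_eq := fun f => by
        obtain ⟨a, b, hb, hab⟩ := IsFractionRing.div_surjective (localAlg s c) f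
        have hb0 : (b : FunField s) ≠ 0 := fun h => nonZeroDivisors.ne_zero hb (Subtype.ext h)
        exact ⟨b, b.2, a, a.2, hb0, by rw [← hab]; exact div_mul_cancel₀ _ hb0⟩ }
  -- The descent needs a nonconstant residue. It exists because the function field of the curve has
  -- transcendence degree one.
  have hz : ∃ z : FunField z', z ∉ (algebraMap K (FunField z')).range := by
    by_contra! hall
    have : Algebra.IsAlgebraic K (FunField z') := ⟨fun z => by
      obtain ⟨a, rfl⟩ := hall z
      exact isAlgebraic_algebraMap a⟩
    have h1 := trdeg_funField z' 1
    rw [trdeg_eq_zero] at h1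
    simp at h1
  obtain ⟨z, hz⟩ := hz
  refine h.exists_adjoin_eq_top hv (fun z hz => ?_) hz
  obtain ⟨a, ha⟩ := hK _ (hz.algebraMap (A := FunField s))
  refine ⟨a, (algebraMap (FunField z') (FunField s)).injective ?_⟩
  rw [← ha, ← IsScalarTower.algebraMap_apply]

end CylinderChart

end RationalPoints

/-! ### Regular functions on complete subsets are algebraic. -/

section CompleteSubsets

variable {K : Type u} [Field K]

/-- The integral closure of `K` is the intersection of the valuation rings that contain it. -/
theorem exists_valuationSubring_notMem {κ : Type u} [Field κ] [Algebra K κ] {z : κ}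
    (hz : ¬ IsAlgebraic K z) :
    ∃ V : ValuationSubring κ, (∀ c : K, algebraMap K κ c ∈ V) ∧ z ∉ V := by
  have h : z ∉ (integralClosure K κ).toSubring := fun h => hz (IsIntegral.isAlgebraic h)
  have : IsIntegrallyClosedIn (integralClosure K κ).toSubring κ :=
    inferInstanceAs (IsIntegrallyClosedIn (integralClosure K κ) κ)
  obtain ⟨V, hV, hzV⟩ := Subring.exists_le_valuationSubring_of_isIntegrallyClosedIn h
  exact ⟨V, fun c => hV ((integralClosure K κ).algebraMap_mem c), hzV⟩

variable {X : Scheme.{u}} [IsIntegral X] (s : X ⟶ Spec (.of K))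

/-- A function that is regular along an irreducible closed subset of a complete variety is
algebraic over the ground field on this subset. -/
theorem isAlgebraic_of_forall_specializes [UniversallyClosed s] (η : X) {κ : Type u} [Field κ]
    [Algebra K κ] (φ : localAlg s η →ₐ[K] κ) [IsLocalHom φ] (g : localAlg s η)
    (hg : ∀ q, η ⤳ q → (g : FunField s) ∈ localAlg s q) : IsAlgebraic K (φ g) := by
  by_contra h
  -- A transcendental value has a pole at some `V`. The center of `V` is a specialization of `η`
  -- where `g` is regular, which puts the value in `V`.
  obtain ⟨V, hV, hgV⟩ := exists_valuationSubring_notMem h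
  obtain ⟨q, hq, hle, hc⟩ := exists_center s η φ V hV
  exact hgV (hc g (hg q hq)).1

theorem isAlgebraic_of_forall_mem [UniversallyClosed s] (g : FunField s)
    (hg : ∀ q, g ∈ localAlg s q) : IsAlgebraic K g := by
  have : IsLocalHom (localAlg s (genericPoint X)).val := by
    refine ⟨fun f hf => ?_⟩
    refine (Subalgebra.isUnit_mk_iff f.2).mpr ⟨hf.ne_zero, ?_⟩
    exact (localAlg_genericPoint s).ge Algebra.mem_top
  exact isAlgebraic_of_forall_specializes s (genericPoint X) (localAlg s (genericPoint X)).val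
    ⟨g, hg _⟩ fun q _ => hg q

theorem exists_affine_chart (U : X.Opens) (hU : IsAffineOpen U) (x : X) (hx : x ∈ U) :
    ∃ (B : Type u) (_ : CommRing B) (_ : IsDomain B) (_ : Algebra K B) (u : Spec (.of B) ⟶ X)
      (_ : IsOpenImmersion u) (_ : u ≫ s = Spec.map (CommRingCat.ofHom (algebraMap K B))),
      Set.range u = U := by
  have : Nonempty U := ⟨⟨x, hx⟩⟩
  exact ⟨Γ(X, U), inferInstance, inferInstance,
    (Spec.preimage (hU.fromSpec ≫ s)).hom.toAlgebra, hU.fromSpec, inferInstance,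
    (Spec.map_preimage _).symm, hU.range_fromSpec⟩

theorem exists_open_forall_mem_localAlg {f : FunField s} {q : X} (hf : f ∈ localAlg s q) :
    ∃ U : X.Opens, q ∈ U ∧ ∀ y ∈ U, f ∈ localAlg s y := by
  obtain ⟨g, rfl⟩ := hf
  obtain ⟨U, hU, g, rfl⟩ := X.presheaf.exists_germ_eq g
  have : Nonempty U := ⟨⟨q, hU⟩⟩
  refine ⟨U, hU, fun y hy => ⟨X.presheaf.germ U y hy g, ?_⟩⟩
  rw [Scheme.algebraMap_germ_eq_germToFunctionField, Scheme.algebraMap_germ_eq_germToFunctionField]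

/-- An invertible rational function as an element of the function field. -/
def unitVal (x : (X.functionField)ˣ) : FunField s := (x : X.functionField)

theorem unitVal_ne_zero (x : (X.functionField)ˣ) : unitVal s x ≠ 0 := x.ne_zero

theorem unitVal_mul (x y : (X.functionField)ˣ) : unitVal s (x * y) = unitVal s x * unitVal s y :=
  rfl

theorem unitVal_inv (x : (X.functionField)ˣ) : unitVal s x⁻¹ = (unitVal s x)⁻¹ :=
  Units.val_inv_eq_inv_val x

theorem unitVal_pow (x : (X.functionField)ˣ) (n : ℕ) : unitVal s (x ^ n) = unitVal s x ^ n :=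
  Units.val_pow_eq_pow_val x n

theorem exists_unitVal_eq {f : FunField s} (hf : f ≠ 0) : ∃ x, unitVal s x = f :=
  ⟨Units.mk0 (show X.functionField from f) hf, rfl⟩

theorem mem_localUnits_iff (q : X) (f : (X.functionField)ˣ) : f ∈ DelPezzo.localUnits X q ↔
    unitVal s f ∈ localAlg s q ∧ (unitVal s f)⁻¹ ∈ localAlg s q := by
  rw [DelPezzo.localUnits, Submonoid.mem_units_iff, ← unitVal_inv]
  rfl

theorem germ_eq_one_iff (q : X) (f : (X.functionField)ˣ) : DelPezzo.germ X q f = 1 ↔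
    unitVal s f ∈ localAlg s q ∧ (unitVal s f)⁻¹ ∈ localAlg s q := by
  rw [← mem_localUnits_iff]
  exact QuotientGroup.eq_one_iff f

end CompleteSubsets

/-! ### Pole divisors and linear relations in Picard rank one. -/

section PoleDivisor

variable {K : Type u} [Field K] {X : Scheme.{u}} [IsIntegral X] (s : X ⟶ Spec (.of K))

open Classical in
/-- The divisor of poles of a rational function without points of indeterminacy. -/
noncomputable def poleDivisor (x : (X.functionField)ˣ)
    (hx : ∀ q, unitVal s x ∈ localAlg s q ∨ (unitVal s x)⁻¹ ∈ localAlg s q) :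
    DelPezzo.cartierDivisors X :=
  ⟨fun q => if (unitVal s x)⁻¹ ∈ localAlg s q then DelPezzo.germ X q x⁻¹ else 1, by
    intro q
    rcases hx q with h | h
    · obtain ⟨U, hU, hmem⟩ := exists_open_forall_mem_localAlg s h
      refine ⟨U, hU, 1, fun y hy => ?_⟩
      rw [map_one]
      beta_reduce
      split_ifs with h'
      · rw [map_inv, inv_eq_one, germ_eq_one_iff s]
        exact ⟨hmem y hy, h'⟩
      · rfl
    · obtain ⟨U, hU, hmem⟩ := exists_open_forall_mem_localAlg s h
      exact ⟨U, hU, x⁻¹, fun y hy => if_pos (hmem y hy)⟩⟩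

variable (x : (X.functionField)ˣ)
    (hx : ∀ q, unitVal s x ∈ localAlg s q ∨ (unitVal s x)⁻¹ ∈ localAlg s q)

theorem poleDivisor_of_inv_mem {q : X} (h : (unitVal s x)⁻¹ ∈ localAlg s q) :
    (poleDivisor s x hx).1 q = DelPezzo.germ X q x⁻¹ := if_pos h

theorem poleDivisor_of_mem {q : X} (h : unitVal s x ∈ localAlg s q) :
    (poleDivisor s x hx).1 q = 1 := by
  by_cases h' : (unitVal s x)⁻¹ ∈ localAlg s q
  · rw [poleDivisor_of_inv_mem s x hx h', map_inv, inv_eq_one, germ_eq_one_iff s]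
    exact ⟨h, h'⟩
  · exact if_neg h'

end PoleDivisor

/-- In rank one the two classes are linearly dependent over `ℤ`. The alternatives are whether the
coefficient of `H` vanishes or not; the sign of the relation is chosen to make the exponents
positive. -/
theorem exists_relation_of_picardNumber_eq_one {X : Scheme.{u}} [IsIntegral X]
    (hρ : DelPezzo.picardNumber X = 1) (D H : DelPezzo.cartierDivisors X) :
    (∃ a : ℕ, 0 < a ∧ ∃ h, D ^ a = DelPezzo.principalDivisor X h) ∨
      ∃ (a : ℤ) (b : ℕ), 0 < b ∧ ∃ h, D ^ a * H ^ b = DelPezzo.principalDivisor X h := by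
  let M := Additive (DelPezzo.PicardGroup X)
  let d : M := Additive.ofMul (QuotientGroup.mk D)
  let e : M := Additive.ofMul (QuotientGroup.mk H)
  -- The value one of `finrank` is not a default value, so the cardinal rank is one as well.
  have hrank : Module.rank ℤ M = 1 := by
    have h : Cardinal.toNat (Module.rank ℤ M) = 1 := hρ
    exact Cardinal.toNat_eq_one.mp h
  have hdep : ¬ LinearIndependent ℤ ![d, e] := fun h => by
    have h1 := h.cardinal_lift_le_rank
    rw [hrank] at h1
    simp at h1
  rw [LinearIndependent.pair_iff] at hdep
  push Not at hdep
  obtain ⟨a, b, hab, h0⟩ := hdep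
  have hrel (a b : ℤ) (hab : a • d + b • e = 0) :
      ∃ h, D ^ a * H ^ b = DelPezzo.principalDivisor X h := by
    have h1 : (QuotientGroup.mk (D ^ a * H ^ b) : DelPezzo.PicardGroup X) = 1 := hab
    rw [QuotientGroup.eq_one_iff] at h1
    obtain ⟨h, hh⟩ := h1
    exact ⟨h, hh.symm⟩
  have hneg : (-a) • d + (-b) • e = 0 := by rw [neg_smul, neg_smul, ← neg_add, hab, neg_zero]
  rcases lt_trichotomy b 0 with hb | hb | hb
  · refine Or.inr ⟨-a, (-b).toNat, by omega, ?_⟩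
    rw [← zpow_natCast, Int.toNat_of_nonneg (by omega)]
    exact hrel _ _ hneg
  · subst hb
    rcases lt_or_gt_of_ne (fun h : a = 0 => h0 h rfl) with ha | ha
    · refine Or.inl ⟨(-a).toNat, by omega, ?_⟩
      obtain ⟨h, hh⟩ := hrel _ _ hneg
      refine ⟨h, ?_⟩
      rw [← zpow_natCast, Int.toNat_of_nonneg (by omega), ← hh, neg_zero, zpow_zero, mul_one]
    · refine Or.inl ⟨a.toNat, by omega, ?_⟩
      obtain ⟨h, hh⟩ := hrel _ _ hab
      refine ⟨h, ?_⟩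
      rw [← zpow_natCast, Int.toNat_of_nonneg (by omega), ← hh, zpow_zero, mul_one]
  · refine Or.inr ⟨a, b.toNat, by omega, ?_⟩
    rw [← zpow_natCast, Int.toNat_of_nonneg (by omega)]
    exact hrel _ _ hab

/-! ### Existence of a fundamental point when the Picard number is one. -/

section PicardNumberOne

open Polynomial

variable {K : Type u} [Field K] {S Z' : Scheme.{u}} [IsIntegral S] [IsIntegral Z']
  {s : S ⟶ Spec (.of K)} {z' : Z' ⟶ Spec (.of K)} [Algebra (FunField z') (FunField s)]
  [IsScalarTower K (FunField z') (FunField s)]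

/-- Let `p` be the minimal polynomial of the nonzero residue `ρ`, so `p(0) ≠ 0`. If `g` vanished at
`q`, then `p(g)` would be a unit at `q`, hence at `η`, contradicting `p(ρ) = 0`. In short, a nonzero
constant has no zeros. -/
theorem isUnit_localAlg_of_isAlgebraic_residue {X : Scheme.{u}} [IsIntegral X]
    (s : X ⟶ Spec (.of K)) {η q : X} (hq : η ⤳ q) {g : FunField s} (hg : g ∈ localAlg s q)
    (halg : IsAlgebraic K (IsLocalRing.residue (localAlg s η)
      ⟨g, localAlg_le_of_specializes s hq hg⟩))
    (hu : IsUnit (⟨g, localAlg_le_of_specializes s hq hg⟩ : localAlg s η)) :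
    IsUnit (⟨g, hg⟩ : localAlg s q) := by
  set ρ := IsLocalRing.residue (localAlg s η) ⟨g, localAlg_le_of_specializes s hq hg⟩
  have hρ : ρ ≠ 0 := fun h => (IsLocalRing.residue_eq_zero_iff _).mp h hu
  let p := minpoly K ρ
  have hp0 : p.coeff 0 ≠ 0 := minpoly.coeff_zero_ne_zero halg.isIntegral hρ
  have hp : aeval ρ p = 0 := minpoly.aeval K ρ
  by_contra hn
  have h1 : IsUnit (aeval (⟨g, hg⟩ : localAlg s q) p) := by
    rw [← divX_mul_X_add p, map_add, map_mul, aeval_X, aeval_C]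
    have h2 : IsUnit (algebraMap K (localAlg s q) (p.coeff 0)) := (IsUnit.mk0 _ hp0).map _
    by_contra h
    have h3 := Ideal.sub_mem _ (show _ ∈ IsLocalRing.maximalIdeal (localAlg s q) from h)
      (Ideal.mul_mem_left _ (aeval (⟨g, hg⟩ : localAlg s q) p.divX)
        (show _ ∈ IsLocalRing.maximalIdeal (localAlg s q) from hn))
    rw [add_sub_cancel_left] at h3
    exact h3 h2
  have h4 := h1.map (Subalgebra.inclusion (localAlg_le_of_specializes s hq))
  rw [← aeval_algHom_apply] at h4
  have h5 := h4.map (IsScalarTower.toAlgHom K (localAlg s η)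
    (IsLocalRing.ResidueField (localAlg s η)))
  rw [← aeval_algHom_apply] at h5
  exact h5.ne_zero hp

namespace CylinderChart

variable (D : CylinderChart s z')

omit [IsScalarTower K (FunField z') (FunField s)] in
/-- The generic point of the fiber over a maximal ideal of the chart of the curve. -/
theorem exists_generic_point_of_fiber [SmoothOfRelativeDimension 1 z'] :
    ∃ (η : S) (x : FunField z'), (∃ h : algebraMap _ (FunField s) x ∈ localAlg s η,
      ¬ IsUnit (⟨_, h⟩ : localAlg s η)) ∧ x ≠ 0 ∧ ∃ ht : D.t ∈ localAlg s η,
      Transcendental K (IsLocalRing.residue (localAlg s η) ⟨D.t, ht⟩) := by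
  -- A field of finite type over `K` is finite over `K`, which contradicts transcendence degree one.
  have hnf : ¬ IsField D.A := by
    intro hf
    let := hf.toField
    have : Module.Finite K D.A := finite_of_finite_type_of_isJacobsonRing K D.A
    let := (chartMap z' D.a D.a_comp).toRingHom.toAlgebra
    have hfr := isFractionRing_chartMap z' D.a D.a_comp
    have : Algebra.IsAlgebraic K (FunField z') := ⟨fun f => by
      obtain ⟨a, b, hb, h⟩ := IsFractionRing.div_surjective D.A f
      rw [← h]
      refine IsAlgebraic.mul ?_ (IsAlgebraic.inv ?_)
      · exact (Algebra.IsAlgebraic.isAlgebraic (R := K) a).algHom (chartMap z' D.a D.a_comp)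
      · exact (Algebra.IsAlgebraic.isAlgebraic (R := K) b).algHom (chartMap z' D.a D.a_comp)⟩
    have h1 := trdeg_funField z' 1
    rw [trdeg_eq_zero] at h1
    simp at h1
  obtain ⟨P, hP0, hP⟩ := Ring.not_isField_iff_exists_prime.mp hnf
  obtain ⟨b, hb, hb0⟩ := Submodule.exists_mem_ne_zero_of_ne_bot hP0
  -- The prime `P A[X]` is the generic point of the fibre over `P`. A nonzero `b` in `P` vanishes
  -- along this fibre, while the coordinate `t` stays transcendental on it, since `P` contains no
  -- nonzero constant.
  have hQ : (P.map C).IsPrime := Ideal.isPrime_map_C_of_isPrime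
  have hbC := D.chartMap_C b
  refine ⟨chartPoint D.u (P.map C), chartMap z' D.a D.a_comp b, ⟨?_, ?_⟩, ?_, ?_, ?_⟩
  · rw [← hbC]
    exact chartMap_mem s D.u D.u_comp (P.map C) (C b)
  · have h1 := (isUnit_chartMap_iff s D.u D.u_comp (P.map C) (C b)).not.mpr
      (not_not.mpr (Ideal.mem_map_of_mem C hb))
    simp only [hbC] at h1
    exact h1
  · exact (map_ne_zero_iff _ (chartMap_injective z' D.a D.a_comp)).mpr hb0
  · exact chartMap_mem s D.u D.u_comp (P.map C) X
  · rintro ⟨p, hp0, hp⟩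
    obtain ⟨ψ, hψ, -⟩ := exists_isLocalization_localAlg s D.u D.u_comp (P.map C)
    have h1 : (⟨D.t, chartMap_mem s D.u D.u_comp (P.map C) X⟩ :
        localAlg s (chartPoint D.u (P.map C))) = ψ X := Subtype.ext (hψ X).symm
    rw [h1] at hp
    have h2 : aeval (IsLocalRing.residue (localAlg s (chartPoint D.u (P.map C))) (ψ X)) p =
        IsLocalRing.residue (localAlg s (chartPoint D.u (P.map C)))
          (ψ (p.map (algebraMap K D.A))) := by
      have h3 := aeval_algHom_apply ((IsScalarTower.toAlgHom K
        (localAlg s (chartPoint D.u (P.map C))) (IsLocalRing.ResidueField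
          (localAlg s (chartPoint D.u (P.map C))))).comp ψ) X p
      rw [aeval_X_left_eq_map] at h3
      exact h3
    rw [h2, IsLocalRing.residue_eq_zero_iff] at hp
    have h4 : ¬ IsUnit (ψ (p.map (algebraMap K D.A))) := hp
    have h5 : ψ (p.map (algebraMap K D.A)) = ⟨_, chartMap_mem s D.u D.u_comp (P.map C)
      (p.map (algebraMap K D.A))⟩ := Subtype.ext (hψ _)
    rw [h5, isUnit_chartMap_iff, not_not, Ideal.mem_map_C_iff] at h4
    apply hp0
    ext i
    by_contra hi
    have h6 := h4 i
    rw [coeff_map] at h6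
    exact hP.ne_top (Ideal.eq_top_of_isUnit_mem _ h6 ((IsUnit.mk0 _ hi).map _))

omit [IsScalarTower K (FunField z') (FunField s)] in
include D in
/-- A surface of Picard number one with a pencil has a fundamental point. -/
theorem exists_isFundamental [SmoothOfRelativeDimension 1 z'] [SmoothOfRelativeDimension 2 s]
    [UniversallyClosed s] (hρ : DelPezzo.picardNumber S = 1)
    (hample : ∃ H : DelPezzo.cartierDivisors S, DelPezzo.IsAmple H) :
    ∃ c, IsFundamental s z' c := by
  by_contra! hno
  obtain ⟨H, -, hH⟩ := hample
  obtain ⟨η, x, ⟨hxη, hxu⟩, hx0, htη, ht⟩ := D.exists_generic_point_of_fiber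
  obtain ⟨ξ, hξ⟩ := exists_unitVal_eq s (f := algebraMap _ (FunField s) x) (by simpa using hx0)
  have hξR : ∀ q, unitVal s ξ ∈ localAlg s q ∨ (unitVal s ξ)⁻¹ ∈ localAlg s q := by
    intro q
    by_contra! h
    exact hno q ⟨x, by rw [← hξ]; exact h.1, by rw [← hξ]; exact h.2⟩
  have hξη : (unitVal s ξ)⁻¹ ∉ localAlg s η := fun h =>
    hxu ((Subalgebra.isUnit_mk_iff hxη).mpr ⟨by simpa using hx0, by rw [← hξ]; exact h⟩)
  -- The closed fibre does not meet the poles of `x`: if `x⁻¹` were regular at a specialization, it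
  -- would be regular at `η`, where `x` vanishes.
  have hcl : ∀ q, η ⤳ q → unitVal s ξ ∈ localAlg s q := fun q hq =>
    (hξR q).resolve_right fun h => hξη (localAlg_le_of_specializes s hq h)
  let Δ := poleDivisor s ξ hξR
  rcases exists_relation_of_picardNumber_eq_one hρ Δ H with ⟨a, ha, h, hrel⟩ | ⟨a, b, hb, h, hrel⟩
  -- Torsion case. The function `h` is regular everywhere, hence algebraic over `K` and invertible
  -- everywhere. So `Δ` has trivial `a`-th power, `x` has no poles and is constant as well, although
  -- it vanishes at `η`.
  · have hgerm (q : S) : DelPezzo.germ S q h = Δ.1 q ^ a := by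
      have := congrFun (congrArg Subtype.val hrel) q
      exact this.symm
    have hmem (q : S) : unitVal s h ∈ localAlg s q := by
      rcases hξR q with hq | hq
      · have h1 := hgerm q
        rw [poleDivisor_of_mem s ξ hξR hq, one_pow, germ_eq_one_iff s] at h1
        exact h1.1
      · have h1 := hgerm q
        rw [poleDivisor_of_inv_mem s ξ hξR hq, ← map_pow, ← inv_mul_eq_one, ← map_inv, ← map_mul,
          germ_eq_one_iff s] at h1
        have h2 := mul_mem (pow_mem hq a) h1.2
        rw [← unitVal_inv, ← unitVal_inv, ← unitVal_pow, ← unitVal_mul, mul_inv_rev, inv_inv,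
          mul_inv_cancel_left] at h2
        exact h2
    have halg := isAlgebraic_of_forall_mem s _ hmem
    have hone (q : S) : Δ.1 q ^ a = 1 := by
      rw [← hgerm q, germ_eq_one_iff s]
      exact ⟨hmem q, isAlgebraic_mem_localAlg s 2 q halg.inv⟩
    have hξmem (q : S) : unitVal s ξ ∈ localAlg s q := by
      rcases hξR q with hq | hq
      · exact hq
      · have h1 := hone q
        rw [poleDivisor_of_inv_mem s ξ hξR hq, ← map_pow, germ_eq_one_iff s] at h1
        obtain ⟨a, rfl⟩ := Nat.exists_eq_succ_of_ne_zero ha.ne'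
        have h2 := mul_mem h1.2 (pow_mem hq a)
        rw [unitVal_pow, unitVal_inv, inv_pow, inv_inv, inv_pow, pow_succ, mul_right_comm,
          mul_inv_cancel₀ (pow_ne_zero _ (unitVal_ne_zero s ξ)), one_mul] at h2
        exact h2
    exact hξη (isAlgebraic_mem_localAlg s 2 η (isAlgebraic_of_forall_mem s _ hξmem).inv)
  · obtain ⟨n, -, f, hf, U, hU, hηU, hfU⟩ := hH η
    -- Where `x` is regular, `Δ` is trivial and `h` is an equation of `H ^ b`. There `g`
    -- trivializes: its divisor is the `b`-th power of that of the section `f` of `H ^ n`, so `g` is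
    -- regular and invertible exactly on `U`.
    obtain ⟨g, hg⟩ : ∃ g : (S.functionField)ˣ, g = f ^ b * h ^ n := ⟨_, rfl⟩
    have hgerm (q : S) (hq : unitVal s ξ ∈ localAlg s q) : DelPezzo.germ S q g =
        (DelPezzo.principalDivisor S f * H ^ n).1 q ^ b := by
      have h1 : DelPezzo.germ S q h = Δ.1 q ^ a * H.1 q ^ b :=
        (congrFun (congrArg Subtype.val hrel) q).symm
      rw [poleDivisor_of_mem s ξ hξR hq, one_zpow, one_mul] at h1
      change DelPezzo.germ S q g = (DelPezzo.germ S q f * H.1 q ^ n) ^ b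
      rw [hg, map_mul, map_pow, map_pow, h1, mul_pow, ← pow_mul, ← pow_mul, mul_comm b n]
    have key (q : S) (hq : unitVal s ξ ∈ localAlg s q) : unitVal s g ∈ localAlg s q ∧
        ((unitVal s g)⁻¹ ∈ localAlg s q ↔ q ∈ U) := by
      obtain ⟨d, hd⟩ := DelPezzo.germ_surjective S q ((DelPezzo.principalDivisor S f * H ^ n).1 q)
      have hdR : unitVal s d ∈ localAlg s q := hf q d hd
      have h1 := hgerm q hq
      rw [← hd, ← map_pow, ← inv_mul_eq_one, ← map_inv, ← map_mul, germ_eq_one_iff s] at h1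
      have hgR : unitVal s g ∈ localAlg s q := by
        have h2 := mul_mem (pow_mem hdR b) h1.2
        rw [← unitVal_inv, ← unitVal_pow, ← unitVal_mul, mul_inv_rev, inv_inv,
          mul_inv_cancel_left] at h2
        exact h2
      refine ⟨hgR, ?_⟩
      rw [hfU, ← hd, germ_eq_one_iff s]
      constructor
      · intro h2
        refine ⟨hdR, ?_⟩
        obtain ⟨b, rfl⟩ := Nat.exists_eq_succ_of_ne_zero hb.ne'
        have h3 := mul_mem (mul_mem h2 h1.2) (pow_mem hdR b)
        have h4 : (unitVal s g)⁻¹ * (unitVal s (g⁻¹ * d ^ (b + 1)))⁻¹ *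
            unitVal s d ^ b = (unitVal s d)⁻¹ := by
          have := unitVal_ne_zero s g
          have := unitVal_ne_zero s d
          rw [unitVal_mul, unitVal_inv, unitVal_pow]
          field_simp
          ring
        rwa [h4] at h3
      · rintro ⟨-, h2⟩
        have h3 := mul_mem h1.1 (pow_mem h2 b)
        have h4 : unitVal s (g⁻¹ * d ^ b) * (unitVal s d)⁻¹ ^ b = (unitVal s g)⁻¹ := by
          have := unitVal_ne_zero s d
          rw [unitVal_mul, unitVal_inv, unitVal_pow, inv_pow,
            mul_inv_cancel_right₀ (pow_ne_zero _ this)]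
        rwa [h4] at h3
    have hgη := key η (hcl η specializes_rfl)
    have hgu : IsUnit (⟨unitVal s g, hgη.1⟩ : localAlg s η) :=
      (Subalgebra.isUnit_mk_iff hgη.1).mpr ⟨unitVal_ne_zero s g, hgη.2.mpr hηU⟩
    let ρ := IsScalarTower.toAlgHom K (localAlg s η) (IsLocalRing.ResidueField (localAlg s η))
    have hρ : IsLocalHom ρ :=
      ⟨fun f hf => (isUnit_map_iff (IsLocalRing.residue (localAlg s η)) f).mp hf⟩
    have halg := isAlgebraic_of_forall_specializes s η ρ ⟨_, hgη.1⟩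
      fun q hq => (key q (hcl q hq)).1
    -- On the complete closed fibre `g` is a nonzero constant up to algebraic extension, so it
    -- vanishes nowhere and the fibre lies in the affine open `U`.
    have hclU (q : S) (hq : η ⤳ q) : q ∈ U := by
      have hk := key q (hcl q hq)
      refine hk.2.mp ((Subalgebra.isUnit_mk_iff hk.1).mp ?_).2
      exact isUnit_localAlg_of_isAlgebraic_residue s hq hk.1 halg hgu
    obtain ⟨B, _, _, _, w, _, hw, hrange⟩ := exists_affine_chart s U hU η hηU
    -- Functions on the affine `U` are regular along the complete fibre, hence algebraic on it; `t`
    -- is a quotient of two of them.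
    have hBalg (b : B) (hbη : chartMap s w hw b ∈ localAlg s η) :
        IsAlgebraic K (ρ ⟨_, hbη⟩) := by
      refine isAlgebraic_of_forall_specializes s η ρ ⟨_, hbη⟩ fun q hq => ?_
      obtain ⟨Q, hQ, rfl⟩ := exists_chartPoint_eq w (hrange.symm ▸ hclU q hq : q ∈ Set.range w)
      exact chartMap_mem s w hw Q b
    obtain ⟨Q, hQ, rfl⟩ := exists_chartPoint_eq w (hrange.symm ▸ hηU : η ∈ Set.range w)
    obtain ⟨p, q, hq, hpq⟩ := (mem_localAlg_chartPoint_iff s w hw Q D.t).mp htη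
    apply ht
    have hqu := (isUnit_chartMap_iff s w hw Q q).mpr hq
    have h1 : ρ ⟨D.t, htη⟩ * ρ ⟨_, chartMap_mem s w hw Q q⟩ = ρ ⟨_, chartMap_mem s w hw Q p⟩ := by
      rw [← map_mul]
      exact congrArg ρ (Subtype.ext hpq)
    have h2 : ρ ⟨_, chartMap_mem s w hw Q q⟩ ≠ 0 := (hqu.map ρ).ne_zero
    change IsAlgebraic K (ρ ⟨D.t, htη⟩)
    rw [(eq_mul_inv_iff_mul_eq₀ h2).mpr h1]
    exact (hBalg p _).mul (hBalg q _).inv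

end CylinderChart

end PicardNumberOne

/-! ### The ground field is algebraically closed in the function field. -/

section AlgebraicallyClosed

open TensorProduct IntermediateField

/-- `Spec (B ⊗ E)` is a nonempty open subscheme of the base change of `X` to `E`, which is integral.
-/
theorem isDomain_tensorProduct_of_geometricallyIntegral {K : Type u} [Field K] {X : Scheme.{u}}
    (s : X ⟶ Spec (.of K)) [GeometricallyIntegral s] {B : Type u} [CommRing B] [Algebra K B]
    [Nontrivial B] (u : Spec (.of B) ⟶ X) [IsOpenImmersion u]
    (hu : u ≫ s = Spec.map (CommRingCat.ofHom (algebraMap K B)))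
    (E : Type u) [Field E] [Algebra K E] : IsDomain (B ⊗[K] E) := by
  let g : Spec (.of E) ⟶ Spec (.of K) := Spec.map (CommRingCat.ofHom (algebraMap K E))
  have h1 : IsIntegral (pullback s g) :=
    GeometricallyIntegral.geometrically_isIntegral (f := s) g _ _ (.of_hasPullback s g)
  let e : Spec (.of (B ⊗[K] E)) ≅ pullback u (pullback.fst s g) :=
    (pullbackSpecIso K B E).symm ≪≫ pullback.congrHom hu.symm rfl ≪≫
      (pullbackRightPullbackFstIso s g u).symm
  have : Nonempty (Spec (CommRingCat.of (B ⊗[K] E))) :=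
    inferInstanceAs (Nonempty (PrimeSpectrum (B ⊗[K] E)))
  have := isIntegral_of_isOpenImmersion (e.hom ≫ pullback.snd u (pullback.fst s g))
  exact affine_isIntegral_iff (.of (B ⊗[K] E)) |>.mp this

/-- The ground field is algebraically closed in the function field of a normal geometrically
integral scheme. -/
theorem mem_range_of_isAlgebraic {K : Type u} [Field K] {X : Scheme.{u}} [IsIntegral X]
    (s : X ⟶ Spec (.of K)) [GeometricallyIntegral s] (n : ℕ) [SmoothOfRelativeDimension n s]
    (y : FunField s) (hy : IsAlgebraic K y) : y ∈ (algebraMap K (FunField s)).range := by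
  obtain ⟨B, _, _, _, hB, u, _, hu, -⟩ := exists_smooth_chart s n (genericPoint X)
  have hBN := Algebra.IsStandardSmoothOfRelativeDimension.isIntegrallyClosed K n (B := B)
  let := (chartMap s u hu).toRingHom.toAlgebra
  have := isFractionRing_chartMap s u hu
  have : IsScalarTower K B (FunField s) :=
    IsScalarTower.of_algebraMap_eq fun c => ((chartMap s u hu).commutes c).symm
  have hfin : FiniteDimensional K K⟮y⟯ := adjoin.finiteDimensional hy.isIntegral
  have hmem (e : K⟮y⟯) : (e : FunField s) ∈ (chartMap s u hu).range := by
    have h1 : IsIntegral K (e : FunField s) := (Algebra.IsIntegral.isIntegral (R := K) e).map K⟮y⟯.val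
    obtain ⟨b, hb⟩ := IsIntegrallyClosed.isIntegral_iff.mp (h1.tower_top (A := B))
    exact ⟨b, hb⟩
  -- By normality `L = K(y)` lies in `B`, so `L ⊗ L` embeds in the domain `B ⊗ L`. Being integral
  -- over `K` it is a field, so the multiplication `L ⊗ L → L` is injective. Comparing dimensions,
  -- `d ^ 2 ≤ d`, hence `d = 1`.
  let θ : K⟮y⟯ →ₐ[K] B := (AlgEquiv.ofInjective (chartMap s u hu) (chartMap_injective s u hu)).symm.toAlgHom.comp
    (K⟮y⟯.val.codRestrict _ hmem)
  have hdom := isDomain_tensorProduct_of_geometricallyIntegral s u hu K⟮y⟯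
  have hinj : Function.Injective (Algebra.TensorProduct.map θ (AlgHom.id K K⟮y⟯)) :=
    Module.Flat.rTensor_preserves_injective_linearMap θ.toLinearMap θ.injective
  have hdom2 : IsDomain (K⟮y⟯ ⊗[K] K⟮y⟯) := hinj.isDomain _
  have hfield :=
    isField_of_isIntegral_of_isField' (R := K) (S := K⟮y⟯ ⊗[K] K⟮y⟯) (Field.toIsField K)
  let := hfield.toField
  have hmul : Function.Injective (Algebra.TensorProduct.lmul' K (S := K⟮y⟯)) :=
    (Algebra.TensorProduct.lmul' K (S := K⟮y⟯)).toRingHom.injective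
  have hle := LinearMap.finrank_le_finrank_of_injective (f := (Algebra.TensorProduct.lmul' K (S := K⟮y⟯)).toLinearMap) hmul
  rw [Module.finrank_tensorProduct] at hle
  have hpos : 0 < Module.finrank K K⟮y⟯ := Module.finrank_pos
  have h1 : Module.finrank K K⟮y⟯ = 1 := by nlinarith
  exact mem_bot.mp (finrank_adjoin_simple_eq_one_iff.mp h1)

end AlgebraicallyClosed

/-! ### From a cylinder to an embedding of function fields. -/

section Cylinder

open DelPezzo Polynomial

theorem exists_isPullback_polynomial {K : Type u} [Field K] (A : Type u) [CommRing A]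
    [Algebra K A] : ∃ b : Spec (.of A[X]) ⟶ affineSpace K 1,
      IsPullback b (Spec.map (CommRingCat.ofHom (C : A →+* A[X]))) (affineSpaceHom K 1)
        (Spec.map (CommRingCat.ofHom (algebraMap K A))) := by
  let e : MvPolynomial (ULift.{u} (Fin 1)) A ≃ₐ[A] A[X] := MvPolynomial.uniqueAlgEquiv A _
  let ε : Spec (.of A[X]) ≅ 𝔸(ULift.{u} (Fin 1); Spec (.of A)) :=
    Scheme.Spec.mapIso e.toRingEquiv.toCommRingCatIso.op ≪≫ (AffineSpace.SpecIso _ (.of A)).symm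
  have hε : ε.hom ≫ 𝔸(ULift.{u} (Fin 1); Spec (.of A)) ↘ Spec (.of A) =
      Spec.map (CommRingCat.ofHom (C : A →+* A[X])) := by
    change (Spec.map e.toRingEquiv.toCommRingCatIso.hom ≫ (AffineSpace.SpecIso _ (.of A)).inv) ≫ _ = _
    rw [Category.assoc, AffineSpace.SpecIso_inv_over, ← Spec.map_comp]
    congr 1
    refine CommRingCat.hom_ext (RingHom.ext fun b => ?_)
    exact e.commutes b
  refine ⟨ε.hom ≫ AffineSpace.map _ (Spec.map (CommRingCat.ofHom (algebraMap K A))), ?_⟩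
  exact (AffineSpace.isPullback_map (n := ULift.{u} (Fin 1))
    (Spec.map (CommRingCat.ofHom (algebraMap K A)))).of_iso ε.symm (Iso.refl _) (Iso.refl _) (Iso.refl _)
    (by simp) (by simp [← hε]) (by simp) (by simp)

variable {K : Type u} [Field K] {S Z Z' : Scheme.{u}} [IsIntegral S] [IsIntegral Z']
  {s : S ⟶ Spec (.of K)} {z : Z ⟶ Spec (.of K)} {z' : Z' ⟶ Spec (.of K)}

/-- The affine line over a chart `Spec A` of the curve is `Spec A[X]`; it is the preimage of the
chart in the cylinder, hence open. -/
theorem exists_cylinder_chart (hz : IsSmoothCurve z) :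
    ∃ (A : Type u) (_ : CommRing A) (_ : IsDomain A) (_ : Algebra K A)
      (_ : Algebra.FiniteType K A) (a : Spec (.of A) ⟶ Z) (w : Spec (.of A[X]) ⟶ cylinder z),
      IsOpenImmersion a ∧ IsOpenImmersion w ∧
      a ≫ z = Spec.map (CommRingCat.ofHom (algebraMap K A)) ∧
      w ≫ cylinderProj z = Spec.map (CommRingCat.ofHom (C : A →+* A[X])) ≫ a := by
  have := hz.integral
  have := hz.smooth
  obtain ⟨A, _, _, _, hA, a, _, ha, -⟩ := exists_smooth_chart z 1 (genericPoint Z)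
  have := Algebra.IsStandardSmoothOfRelativeDimension.isStandardSmooth 1 (R := K) (S := A)
  obtain ⟨b, hb⟩ := exists_isPullback_polynomial (K := K) A
  rw [← ha] at hb
  let w : Spec (.of A[X]) ⟶ cylinder z :=
    pullback.lift (Spec.map (CommRingCat.ofHom (C : A →+* A[X])) ≫ a) b
      (by rw [Category.assoc]; exact hb.w.symm)
  have hw1 : w ≫ cylinderProj z = Spec.map (CommRingCat.ofHom (C : A →+* A[X])) ≫ a :=
    pullback.lift_fst _ _ _
  have hw2 : w ≫ pullback.snd z (affineSpaceHom K 1) = b := pullback.lift_snd _ _ _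
  rw [← hw2] at hb
  have hpb := IsPullback.of_right hb hw1 (IsPullback.of_hasPullback z (affineSpaceHom K 1)).flip
  exact ⟨A, _, ‹_›, _, inferInstance, a, w, ‹_›,
    MorphismProperty.of_isPullback (P := @IsOpenImmersion) hpb.flip ‹_›, ha, hw1⟩

/-- The rational inverse of an open immersion, followed by the immersion, is the identity at the
generic point. This ties the induced rational map to the charts. -/
theorem fromFunctionField_symm_partialIso_comp {U X : Scheme.{u}} [IsIntegral X] (f : U ⟶ X)
    [IsOpenImmersion f] [IsDominant f] :
    f.partialIso.symm.toPartialMap.fromFunctionField ≫ f = X.fromSpecStalk (genericPoint X) := by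
  have h : f.partialIso.symm.toPartialMap.hom ≫ f =
      f.partialIso.symm.toPartialMap.domain.ι := by
    have h1 : f.partialIso.IsOver f (𝟙 X) := by
      change ((U.topIso.hom ≫ f.isoOpensRange.hom ≫ f.opensRange.toScheme.topIso.inv) ≫
        (f.opensRange.toScheme.isoOfEq rfl).hom ≫ f.opensRange.toScheme.topIso.hom) ≫
        f.opensRange.ι ≫ 𝟙 X = (⊤ : U.Opens).ι ≫ f
      simp
    have h2 := h1.symm
    rw [Scheme.PartialIso.IsOver, Category.comp_id] at h2
    exact (Category.assoc _ _ _).trans h2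
  rw [Scheme.PartialMap.fromFunctionField, Scheme.PartialMap.fromSpecStalkOfMem, Category.assoc, h]
  exact Scheme.Opens.fromSpecStalkOfMem_ι _ _ _

/-- The function field of the curve embeds in the function field of a surface that contains a
cylinder over the curve. -/
theorem exists_cylinderChart (hz : IsSmoothCurve z) {i : cylinder z ⟶ S} (hi : IsCylinder s z i)
    (j : Z ⟶ Z') [IsOpenImmersion j] (hj : j ≫ z' = z) :
    ∃ ι : FunField z' →ₐ[K] FunField s,
      (letI := ι.toRingHom.toAlgebra; Nonempty (CylinderChart s z')) ∧
      Spec.map (CommRingCat.ofHom ι.toRingHom) ≫ fromSpecFunField z' =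
        (inducedMap hz hi j).fromFunctionField := by
  have := hi.openImmersion
  have := isDominant_cylinder hz hi
  obtain ⟨A, _, _, _, hA, a₀, w, _, _, ha₀, hw⟩ := exists_cylinder_chart hz
  let a : Spec (.of A) ⟶ Z' := a₀ ≫ j
  have ha : a ≫ z' = Spec.map (CommRingCat.ofHom (algebraMap K A)) := by
    rw [Category.assoc, hj, ha₀]
  let u : Spec (.of A[X]) ⟶ S := w ≫ i
  have hu : u ≫ s = Spec.map (CommRingCat.ofHom (algebraMap K A[X])) := by
    rw [Category.assoc, hi.isOver, reassoc_of% hw, ha₀, ← Spec.map_comp]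
    rfl
  let := (chartMap z' a ha).toRingHom.toAlgebra
  have := isFractionRing_chartMap z' a ha
  have : IsScalarTower K A (FunField z') :=
    IsScalarTower.of_algebraMap_eq fun c => ((chartMap z' a ha).commutes c).symm
  let θ : A →ₐ[K] FunField s := (chartMap s u hu).comp CAlgHom
  have hθ : Function.Injective θ := (chartMap_injective s u hu).comp C_injective
  let ι : FunField z' →ₐ[K] FunField s := IsFractionRing.liftAlgHom (K := FunField z') (g := θ) hθ
  have hι (b : A) : ι (chartMap z' a ha b) = chartMap s u hu (C b) :=
    IsFractionRing.lift_algebraMap hθ b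
  refine ⟨ι, ?_, ?_⟩
  · let := ι.toRingHom.toAlgebra
    exact ⟨{ A := A, a := a, a_comp := ha, u := u, u_comp := hu, chartMap_C := fun b => (hι b).symm }⟩
  · let g : Spec (.of (FunField s)) ⟶ cylinder z :=
      i.partialIso.symm.toPartialMap.fromFunctionField
    have hg : g ≫ i = fromSpecFunField s := fromFunctionField_symm_partialIso_comp i
    have hg2 : g = Spec.map (CommRingCat.ofHom (chartMap s u hu).toRingHom) ≫ w := by
      rw [← cancel_mono i, hg, Category.assoc]
      exact (specMap_chartMap s u hu).symm
    have h1 : (inducedMap hz hi j).fromFunctionField = g ≫ cylinderProj z ≫ j :=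
      Scheme.PartialMap.fromSpecStalkOfMem_compHom _ _ _ _
    rw [h1, hg2, Category.assoc, reassoc_of% hw, ← specMap_chartMap z' a ha]
    change _ = Spec.map _ ≫ Spec.map _ ≫ a
    rw [← Spec.map_comp_assoc, ← Spec.map_comp_assoc]
    congr 2
    refine CommRingCat.hom_ext (RingHom.ext fun b => ?_)
    exact hι b

end Cylinder

/-! ### The domain of the rational map and the fundamental points. -/

section Domain

theorem AlgebraicGeometry.Scheme.PartialMap.specMap_stalkSpecializes_fromSpecStalkOfMem
    {X Y : Scheme.{u}} (f : X.PartialMap Y) {x y : X} (h : x ⤳ y) (hx : x ∈ f.domain)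
    (hy : y ∈ f.domain) :
    Spec.map (X.presheaf.stalkSpecializes h) ≫ f.fromSpecStalkOfMem hy =
      f.fromSpecStalkOfMem hx := by
  rw [Scheme.PartialMap.fromSpecStalkOfMem, Scheme.PartialMap.fromSpecStalkOfMem,
    ← Category.assoc]
  congr 1
  rw [← cancel_mono f.domain.ι, Category.assoc, Scheme.Opens.fromSpecStalkOfMem_ι,
    Scheme.Opens.fromSpecStalkOfMem_ι, Scheme.SpecMap_stalkSpecializes_fromSpecStalk]

variable {K : Type u} [Field K] {S Z' : Scheme.{u}} [IsIntegral S] [IsIntegral Z']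
  (s : S ⟶ Spec (.of K)) (z' : Z' ⟶ Spec (.of K))

/-- The isomorphism of the stalk with the local ring. -/
noncomputable def stalkHom (q : S) : S.presheaf.stalk q ⟶ .of (localAlg s q) :=
  CommRingCat.ofHom (stalkEquiv s q).toRingHom

instance (q : S) : IsIso (stalkHom s q) :=
  (stalkEquiv s q).toCommRingCatIso.isIso_hom

/-- The isomorphism of the spectra of the stalk and of the local ring. -/
noncomputable def specStalkEquiv (q : S) :
    Spec (.of (localAlg s q)) ⟶ Spec (S.presheaf.stalk q) :=
  Spec.map (stalkHom s q)

instance (q : S) : IsIso (specStalkEquiv s q) := by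
  unfold specStalkEquiv
  infer_instance

/-- The morphism from the spectrum of the local ring that is induced by a partial map. -/
noncomputable def fromSpecLocalOfMem {Y : Scheme.{u}} (g : S.PartialMap Y) {q : S}
    (hq : q ∈ g.domain) : Spec (.of (localAlg s q)) ⟶ Y :=
  specStalkEquiv s q ≫ g.fromSpecStalkOfMem hq

theorem specMap_val_fromSpecLocalOfMem {Y : Scheme.{u}} (g : S.PartialMap Y) {q : S}
    (hq : q ∈ g.domain) :
    Spec.map (CommRingCat.ofHom (localAlg s q).val.toRingHom) ≫ fromSpecLocalOfMem s g hq =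
      g.fromFunctionField := by
  rw [fromSpecLocalOfMem, specStalkEquiv, ← Spec.map_comp_assoc, Scheme.PartialMap.fromFunctionField,
    ← g.specMap_stalkSpecializes_fromSpecStalkOfMem ((genericPoint_spec S).specializes trivial) _ hq]
  rfl

variable [Algebra (FunField z') (FunField s)] [IsScalarTower K (FunField z') (FunField s)]
  (φ : S ⤏ Z') (hφ : Spec.map (CommRingCat.ofHom (algebraMap (FunField z') (FunField s))) ≫
    fromSpecFunField z' = φ.fromFunctionField)

include hφ

/-- Where `φ` is defined, the local ring at the image point, a valuation ring of the function field
of the curve, maps into `𝒪_q`. -/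
theorem not_isFundamental_of_mem_domain [SmoothOfRelativeDimension 1 z'] {q : S}
    (hq : q ∈ φ.domain) : ¬ IsFundamental s z' q := by
  obtain ⟨g, hqg, rfl⟩ := Scheme.RationalMap.mem_domain.mp hq
  let f : Spec (.of (localAlg s q)) ⟶ Z' := fromSpecLocalOfMem s g hqg
  have hf : Spec.map (CommRingCat.ofHom (localAlg s q).val.toRingHom) ≫ f =
      Spec.map (CommRingCat.ofHom (algebraMap (FunField z') (FunField s))) ≫ fromSpecFunField z' :=
    (specMap_val_fromSpecLocalOfMem s g hqg).trans hφ.symm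
  have hfK : f ≫ z' = Spec.map (CommRingCat.ofHom (algebraMap K (localAlg s q))) := by
    obtain ⟨ρ, hρ⟩ := Spec.map_surjective (f ≫ z')
    rw [← hρ]
    congr 1
    have h1 := congrArg (· ≫ z') hf
    simp only [Category.assoc] at h1
    rw [← hρ, fromSpecFunField_comp, ← Spec.map_comp, ← Spec.map_comp, Spec.map_inj] at h1
    refine CommRingCat.hom_ext (RingHom.ext fun c => Subtype.ext ?_)
    have h2 := DFunLike.congr_fun (congrArg CommRingCat.Hom.hom h1) c
    refine h2.trans ?_
    exact (IsScalarTower.algebraMap_apply K (FunField z') (FunField s) c).symm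
  obtain ⟨ψ, -, hψ⟩ := exists_fromSpecLocal_factor z' f hfK _ rfl
  have hval (y : localAlg z' (f (closedPt (localAlg s q)))) :
      algebraMap (FunField z') (FunField s) y = (ψ y : FunField s) := by
    rw [← hψ, ← specMap_val_fromSpecLocal z' (f (closedPt (localAlg s q))), ← Category.assoc,
      ← Category.assoc, cancel_mono, ← Spec.map_comp, ← Spec.map_comp, Spec.map_inj] at hf
    exact (DFunLike.congr_fun (congrArg CommRingCat.Hom.hom hf) y).symm
  rintro ⟨x, hx, hx'⟩
  rcases mem_or_inv_mem_localAlg z' (f (closedPt (localAlg s q))) x with h | h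
  · exact hx (hval ⟨x, h⟩ ▸ (ψ ⟨x, h⟩).2)
  · exact hx' (map_inv₀ (algebraMap (FunField z') (FunField s)) x ▸ hval ⟨x⁻¹, h⟩ ▸ (ψ ⟨x⁻¹, h⟩).2)

/-- The valuation ring `𝒪_q ∩ k` has a center `q'` on the complete curve. The inclusion of `𝒪_q'` in
`𝒪_q` gives a morphism from `Spec 𝒪_q`, which extends to a neighbourhood because the curve is
locally of finite type, and which agrees with `φ` generically. -/
theorem mem_domain_of_not_isFundamental [UniversallyClosed z'] [LocallyOfFiniteType z'] {q : S}
    (hq : ¬ IsFundamental s z' q) : q ∈ φ.domain := by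
  let V : ValuationSubring (FunField z') :=
    { (localAlg s q).toSubring.comap (algebraMap (FunField z') (FunField s)) with
      mem_or_inv_mem' := fun x => by
        by_contra! h
        exact hq ⟨x, h.1, map_inv₀ (algebraMap (FunField z') (FunField s)) x ▸ h.2⟩ }
  have hV (x : FunField z') : x ∈ V ↔ algebraMap (FunField z') (FunField s) x ∈ localAlg s q :=
    Iff.rfl
  have hloc : IsLocalHom (localAlg z' (genericPoint Z')).val := by
    refine ⟨fun a ha => (Subalgebra.isUnit_mk_iff a.2).mpr ⟨ha.ne_zero, ?_⟩⟩
    exact (localAlg_genericPoint z').ge Algebra.mem_top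
  obtain ⟨q', -, h, hq'⟩ := exists_center z' (genericPoint Z') (localAlg z' (genericPoint Z')).val V
    (fun c => (hV _).mpr (by
      rw [← IsScalarTower.algebraMap_apply]
      exact (localAlg s q).algebraMap_mem c))
  let ψ : localAlg z' q' →+* localAlg s q :=
    ((algebraMap (FunField z') (FunField s)).comp (localAlg z' q').val.toRingHom).codRestrict
      (localAlg s q).toSubring (fun y => (hq' y y.2).1)
  let F : Spec (.of (localAlg s q)) ⟶ Z' := Spec.map (CommRingCat.ofHom ψ) ≫ fromSpecLocal z' q'
  have hF : F ≫ z' = fromSpecLocal s q ≫ s := by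
    rw [fromSpecLocal_comp, Category.assoc, fromSpecLocal_comp, ← Spec.map_comp]
    congr 1
    refine CommRingCat.hom_ext (RingHom.ext fun c => Subtype.ext ?_)
    exact (IsScalarTower.algebraMap_apply K (FunField z') (FunField s) c).symm
  have hF2 : Spec.map (CommRingCat.ofHom (localAlg s q).val.toRingHom) ≫ F =
      φ.fromFunctionField := by
    rw [← hφ, ← specMap_val_fromSpecLocal z' q', ← Spec.map_comp_assoc, ← Spec.map_comp_assoc]
    rfl
  let f : Spec (S.presheaf.stalk q) ⟶ Z' := inv (specStalkEquiv s q) ≫ F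
  have hf : f ≫ z' = S.fromSpecStalk q ≫ s := by
    rw [Category.assoc, IsIso.inv_comp_eq, hF]
    exact Category.assoc _ _ _
  let g := Scheme.PartialMap.ofFromSpecStalk s z' f hf
  have hg : q ∈ g.domain := Scheme.PartialMap.mem_domain_ofFromSpecStalk s z' f hf
  have hgF : fromSpecLocalOfMem s g hg = F := by
    have h1 : g.fromSpecStalkOfMem hg = inv (specStalkEquiv s q) ≫ F :=
      Scheme.PartialMap.fromSpecStalkOfMem_ofFromSpecStalk s z' f hf
    rw [fromSpecLocalOfMem, h1, IsIso.hom_inv_id_assoc]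
  refine Scheme.RationalMap.mem_domain.mpr
    ⟨g, hg, Scheme.RationalMap.eq_of_fromFunctionField_eq _ _ ?_⟩
  rw [← hF2, ← hgF]
  exact (specMap_val_fromSpecLocalOfMem s g hg).symm

theorem compl_domain_eq [UniversallyClosed z'] [LocallyOfFiniteType z']
    [SmoothOfRelativeDimension 1 z'] : (φ.domain : Set S)ᶜ = {q | IsFundamental s z' q} := by
  ext q
  refine ⟨fun h => by_contra fun h' => h (mem_domain_of_not_isFundamental s z' φ hφ h'),
    fun h h' => not_isFundamental_of_mem_domain s z' φ hφ h' h⟩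

end Domain

/-! ### Birationality from function fields; rationality of the surface. -/

section Birational

theorem isDominant_of_isOpenImmersion {U X : Scheme.{u}} [IsIntegral X] [Nonempty U] (f : U ⟶ X)
    [IsOpenImmersion f] : IsDominant f :=
  ⟨f.isOpenEmbedding.isOpen_range.dense (Set.range_nonempty f)⟩

/-- A birational extension of domains of finite type induces a birational map of spectra. -/
theorem birationalOver_specMap {K A C : Type u} [Field K] [CommRing A] [CommRing C] [IsDomain A]
    [IsDomain C] [Algebra K A] [Algebra K C] [Algebra.FiniteType K C] (φ : A →ₐ[K] C)
    (hinj : Function.Injective φ) (hφ : ∀ c, ∃ a b, a ≠ 0 ∧ φ a * c = φ b) :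
    Scheme.BirationalOver (Spec.map (CommRingCat.ofHom (algebraMap K C)))
      (Spec.map (CommRingCat.ofHom (algebraMap K A))) := by
  -- A common denominator `a` of finitely many generators of `C`: after inverting it, `A` and `C`
  -- coincide.
  obtain ⟨a, ha0, ha⟩ : ∃ a, a ≠ 0 ∧ ∀ c, ∃ n b, φ a ^ n * c = φ b := by
    obtain ⟨T, hT⟩ := ‹Algebra.FiniteType K C›
    choose d b hd hdb using hφ
    refine ⟨∏ c ∈ T, d c, Finset.prod_ne_zero_iff.mpr fun c _ => hd c, fun c => ?_⟩
    have hc : c ∈ Algebra.adjoin K (T : Set C) := hT ▸ Algebra.mem_top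
    induction hc using Algebra.adjoin_induction with
    | mem c hc =>
      obtain ⟨e, he⟩ := Finset.dvd_prod_of_mem d hc
      exact ⟨1, e * b c, by rw [pow_one, he, map_mul, map_mul, ← hdb]; ring⟩
    | algebraMap r => exact ⟨0, algebraMap K A r, by simp⟩
    | add x y _ _ hx hy =>
      obtain ⟨n, p, hp⟩ := hx
      obtain ⟨m, q, hq⟩ := hy
      refine ⟨n + m, (∏ c ∈ T, d c) ^ m * p + (∏ c ∈ T, d c) ^ n * q, ?_⟩
      rw [map_add, map_mul, map_mul, ← hp, ← hq, map_pow, map_pow]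
      ring
    | mul x y _ _ hx hy =>
      obtain ⟨n, p, hp⟩ := hx
      obtain ⟨m, q, hq⟩ := hy
      refine ⟨n + m, p * q, ?_⟩
      rw [map_mul, ← hp, ← hq]
      ring
  have hφa : φ a ≠ 0 := (map_ne_zero_iff _ hinj).mpr ha0
  let L := Localization.Away (φ a)
  have hL : IsDomain L := IsLocalization.isDomain_localization
    (powers_le_nonZeroDivisors_of_noZeroDivisors hφa)
  have hCL : Function.Injective (algebraMap C L) :=
    IsLocalization.injective L (powers_le_nonZeroDivisors_of_noZeroDivisors hφa)
  let : Algebra A L := ((algebraMap C L).comp φ.toRingHom).toAlgebra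
  have hAL : IsLocalization.Away a L := by
    refine ⟨?_, ?_, ?_⟩
    · rintro ⟨_, n, rfl⟩
      change IsUnit (algebraMap C L (φ (a ^ n)))
      rw [map_pow, map_pow]
      exact (IsLocalization.Away.algebraMap_isUnit (φ a)).pow n
    · intro l
      obtain ⟨n, c, hc⟩ := IsLocalization.Away.surj (φ a) l
      obtain ⟨m, b, hb⟩ := ha c
      refine ⟨(b, ⟨a ^ (n + m), n + m, rfl⟩), ?_⟩
      change l * algebraMap C L (φ (a ^ (n + m))) = algebraMap C L (φ b)
      rw [← hb, map_mul, ← hc, map_pow, map_pow, map_pow]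
      ring
    · intro x y hxy
      exact ⟨1, by rw [hinj (hCL hxy)]⟩
  have : Nonempty (Spec (CommRingCat.of L)) := inferInstanceAs (Nonempty (PrimeSpectrum L))
  have : IsIntegral (Spec (.of A)) := (affine_isIntegral_iff (.of A)).mpr ‹_›
  have : IsIntegral (Spec (.of C)) := (affine_isIntegral_iff (.of C)).mpr ‹_›
  let f : Spec (.of L) ⟶ Spec (.of C) := Spec.map (CommRingCat.ofHom (algebraMap C L))
  let g : Spec (.of L) ⟶ Spec (.of A) := Spec.map (CommRingCat.ofHom (algebraMap A L))
  have : IsOpenImmersion f := Scheme.isOpenImmersion_SpecMap_localizationAway (R := .of C) (φ a)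
  have : IsOpenImmersion g := IsOpenImmersion.of_isLocalization a
  have := isDominant_of_isOpenImmersion f
  have := isDominant_of_isOpenImmersion g
  have hf := f.birationalOver _ _
    (show f ≫ Spec.map (CommRingCat.ofHom (algebraMap K C)) =
      Spec.map (CommRingCat.ofHom (algebraMap K L)) by
      rw [← Spec.map_comp]
      congr 1)
  have hg := g.birationalOver _ _
    (show g ≫ Spec.map (CommRingCat.ofHom (algebraMap K A)) =
      Spec.map (CommRingCat.ofHom (algebraMap K L)) by
      rw [← Spec.map_comp]
      congr 1
      refine CommRingCat.hom_ext (RingHom.ext fun c => ?_)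
      exact congrArg (algebraMap C L) (φ.commutes c))
  exact hf.symm.trans hg

/-- Domains of finite type with the same field of fractions have birational spectra. -/
theorem birationalOver_of_fractionField {K A B F : Type u} [Field K] [CommRing A] [CommRing B]
    [IsDomain A] [IsDomain B] [Field F] [Algebra K A] [Algebra K B] [Algebra K F]
    [Algebra.FiniteType K A] [Algebra.FiniteType K B] (α : A →ₐ[K] F) (β : B →ₐ[K] F)
    (hα : Function.Injective α) (hβ : Function.Injective β)
    (hαF : ∀ f, ∃ a b, a ≠ 0 ∧ α a * f = α b) (hβF : ∀ f, ∃ a b, a ≠ 0 ∧ β a * f = β b) :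
    Scheme.BirationalOver (Spec.map (CommRingCat.ofHom (algebraMap K A)))
      (Spec.map (CommRingCat.ofHom (algebraMap K B))) := by
  -- Neither algebra need contain the other; both are compared with the algebra that they generate
  -- together.
  let R : Subalgebra K F := α.range ⊔ β.range
  have hR : Algebra.FiniteType K R := R.fg_iff_finiteType.mp
    ((α.range.fg_iff_finiteType.mpr (.of_surjective α.rangeRestrict α.rangeRestrict_surjective)).sup
      (β.range.fg_iff_finiteType.mpr (.of_surjective β.rangeRestrict β.rangeRestrict_surjective)))
  have key {A : Type u} [CommRing A] [IsDomain A] [Algebra K A] (α : A →ₐ[K] F) (hαR : α.range ≤ R)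
      (hα : Function.Injective α) (hαF : ∀ f, ∃ a b, a ≠ 0 ∧ α a * f = α b) :=
    birationalOver_specMap (α.codRestrict R fun a => hαR ⟨a, rfl⟩)
      ((AlgHom.injective_codRestrict _ _ _).mpr hα) (fun c => by
        obtain ⟨a, b, ha, h⟩ := hαF c
        exact ⟨a, b, ha, Subtype.ext h⟩)
  exact (key α le_sup_left hα hαF).symm.trans (key β le_sup_right hβ hβF)

theorem birationalOver_of_algHom {K : Type u} [Field K] {X Y : Scheme.{u}} [IsIntegral X]
    [IsIntegral Y] (x : X ⟶ Spec (.of K)) (y : Y ⟶ Spec (.of K)) {A B F : Type u} [CommRing A]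
    [CommRing B] [IsDomain A] [IsDomain B] [Field F] [Algebra K A] [Algebra K B] [Algebra K F]
    [Algebra.FiniteType K A] [Algebra.FiniteType K B] (u : Spec (.of A) ⟶ X) [IsOpenImmersion u]
    (v : Spec (.of B) ⟶ Y) [IsOpenImmersion v]
    (hu : u ≫ x = Spec.map (CommRingCat.ofHom (algebraMap K A)))
    (hv : v ≫ y = Spec.map (CommRingCat.ofHom (algebraMap K B))) (α : A →ₐ[K] F) (β : B →ₐ[K] F)
    (hα : Function.Injective α) (hβ : Function.Injective β)
    (hαF : ∀ f, ∃ a b, a ≠ 0 ∧ α a * f = α b) (hβF : ∀ f, ∃ a b, a ≠ 0 ∧ β a * f = β b) :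
    Scheme.BirationalOver x y := by
  have : Nonempty (Spec (CommRingCat.of A)) := inferInstanceAs (Nonempty (PrimeSpectrum A))
  have : Nonempty (Spec (CommRingCat.of B)) := inferInstanceAs (Nonempty (PrimeSpectrum B))
  have := isDominant_of_isOpenImmersion u
  have := isDominant_of_isOpenImmersion v
  exact (u.birationalOver _ _ hu).symm.trans
    ((birationalOver_of_fractionField α β hα hβ hαF hβF).trans (v.birationalOver _ _ hv))

open DelPezzo

variable {K : Type u} [Field K] {S Z' : Scheme.{u}} [IsIntegral S] [IsIntegral Z']
  {s : S ⟶ Spec (.of K)} {z' : Z' ⟶ Spec (.of K)} [Algebra (FunField z') (FunField s)]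
  [IsScalarTower K (FunField z') (FunField s)]

/-- `F = K(τ)(t)` with `τ` transcendental over `K` and `t` transcendental over `K(τ)`. -/
theorem CylinderChart.exists_mvPolynomial (D : CylinderChart s z') {τ : FunField z'}
    (hτ : Transcendental K τ) (htop : IntermediateField.adjoin K {τ} = ⊤) :
    ∃ β : MvPolynomial (ULift.{u} (Fin 2)) K →ₐ[K] FunField s, Function.Injective β ∧
      ∀ f, ∃ a b, a ≠ 0 ∧ β a * f = β b := by
  let x : ULift.{u} (Fin 2) → FunField s :=
    fun i => ![algebraMap (FunField z') (FunField s) τ, D.t] i.down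
  have hx : AlgebraicIndependent K x := by
    let y : Unit → FunField s := fun _ => algebraMap (FunField z') (FunField s) τ
    have hy : AlgebraicIndependent K y := algebraicIndependent_unique_type_iff.mpr
      ((transcendental_algebraMap_iff (algebraMap (FunField z') (FunField s)).injective).mpr hτ)
    let R := Algebra.adjoin K (Set.range y)
    let g := IsScalarTower.toAlgHom K (FunField z') (FunField s)
    have hg : Function.Injective g := (algebraMap (FunField z') (FunField s)).injective
    have hR : R ≤ g.range := Algebra.adjoin_le (by rintro _ ⟨_, rfl⟩; exact ⟨τ, rfl⟩)
    let ρ : R →+* FunField z' :=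
      ((AlgEquiv.ofInjective g hg).symm.toAlgHom.comp (Subalgebra.inclusion hR)).toRingHom
    have hρ (r : R) : algebraMap (FunField z') (FunField s) (ρ r) = r :=
      congrArg Subtype.val ((AlgEquiv.ofInjective g hg).apply_symm_apply (Subalgebra.inclusion hR r))
    have hyt : AlgebraicIndependent K fun o : Option Unit => o.elim D.t y := by
      refine (hy.option_iff_transcendental D.t).mpr fun halg => D.transcendental_t ?_
      let := ρ.toAlgebra
      have : IsScalarTower R (FunField z') (FunField s) :=
        IsScalarTower.of_algebraMap_eq fun r => (hρ r).symm
      refine halg.extendScalars (fun r r' h => Subtype.ext ?_)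
      rw [← hρ, ← hρ]
      exact congrArg (algebraMap (FunField z') (FunField s)) h
    let e : ULift.{u} (Fin 2) → Option Unit := fun i => ![some (), none] i.down
    have he : Function.Injective e := by
      rintro ⟨i⟩ ⟨j⟩ h
      fin_cases i <;> fin_cases j <;> simp_all [e]
    convert! hyt.comp e he using 1
    ext ⟨i⟩
    fin_cases i <;> rfl
  refine ⟨MvPolynomial.aeval x, hx, fun f => ?_⟩
  have hrange (y : FunField z') : algebraMap (FunField z') (FunField s) y ∈
      IntermediateField.adjoin K (Set.range x) := by
    have h : IntermediateField.adjoin K {τ} ≤ (IntermediateField.adjoin K (Set.range x)).comap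
        (IsScalarTower.toAlgHom K (FunField z') (FunField s)) := by
      rw [IntermediateField.adjoin_le_iff, Set.singleton_subset_iff]
      exact IntermediateField.subset_adjoin K _ ⟨⟨0⟩, rfl⟩
    exact h (htop ▸ IntermediateField.mem_top)
  have ht : D.t ∈ IntermediateField.adjoin K (Set.range x) :=
    IntermediateField.subset_adjoin K _ ⟨⟨1⟩, rfl⟩
  have hpoly (P : Polynomial (FunField z')) :
      Polynomial.aeval D.t P ∈ IntermediateField.adjoin K (Set.range x) := by
    rw [Polynomial.aeval_eq_sum_range]
    refine sum_mem fun i _ => ?_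
    rw [Algebra.smul_def]
    exact mul_mem (hrange _) (pow_mem ht i)
  obtain ⟨P, Q, hQ, h⟩ := D.exists_mul_aeval_eq f
  have hf : f ∈ IntermediateField.adjoin K (Set.range x) := by
    rw [(eq_div_iff hQ).mpr h]
    exact div_mem (hpoly P) (hpoly Q)
  obtain ⟨p, q, hpq⟩ := (IntermediateField.mem_adjoin_range_iff K x f).mp hf
  -- With a zero denominator the quotient is zero by convention, so `f = 0`.
  by_cases hq : MvPolynomial.aeval x q = 0
  · refine ⟨1, 0, one_ne_zero, ?_⟩
    rw [hpq, hq, div_zero, mul_zero, map_zero]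
  · refine ⟨q, p, fun h0 => hq (by rw [h0, map_zero]), ?_⟩
    rw [hpq, mul_div_cancel₀ _ hq]

/-- A surface with a cylinder over a rational curve is rational. -/
theorem CylinderChart.birationalOver_affineSpace (D : CylinderChart s z')
    [SmoothOfRelativeDimension 2 s] {τ : FunField z'}
    (hτ : Transcendental K τ) (htop : IntermediateField.adjoin K {τ} = ⊤) :
    Scheme.BirationalOver s (affineSpaceHom K 2) := by
  obtain ⟨β, hβ, hβF⟩ := D.exists_mvPolynomial hτ htop
  obtain ⟨B, _, _, _, hB, u, _, hu, -⟩ := exists_smooth_chart s 2 (genericPoint S)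
  have := Algebra.IsStandardSmoothOfRelativeDimension.isStandardSmooth 2 (R := K) (S := B)
  exact birationalOver_of_algHom s (affineSpaceHom K 2) u
    (AffineSpace.SpecIso (ULift.{u} (Fin 2)) (.of K)).inv hu (AffineSpace.SpecIso_inv_over _)
    (chartMap s u hu) β (chartMap_injective s u hu) hβ (fun f => by
      obtain ⟨a, b, hb, h⟩ := exists_mul_chartMap_eq s u hu f
      exact ⟨b, a, hb, by rw [mul_comm, h]⟩) hβF

end Birational

/-! ### Proper curves are determined by their function fields. -/

section ProperCurves

theorem AlgebraicGeometry.Scheme.PartialMap.fromSpecStalk_comp_hom {X Y : Scheme.{u}}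
    [IrreducibleSpace X] (g : X.PartialMap Y) (e : X ⟶ g.domain) (he : e ≫ g.domain.ι = 𝟙 X) :
    X.fromSpecStalk (genericPoint X) ≫ e ≫ g.hom = g.fromFunctionField := by
  rw [Scheme.PartialMap.fromFunctionField, Scheme.PartialMap.fromSpecStalkOfMem, ← Category.assoc]
  congr 1
  rw [← cancel_mono g.domain.ι, Category.assoc, he, Scheme.Opens.fromSpecStalkOfMem_ι,
    Category.comp_id]

variable {K : Type u} [Field K] {X Y : Scheme.{u}} [IsIntegral X] [IsIntegral Y]
  (x : X ⟶ Spec (.of K)) (y : Y ⟶ Spec (.of K))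

instance : IsDominant (fromSpecFunField x) := by
  refine ⟨(dense_iff_closure_eq.mpr ?_)⟩
  have : Set.range (fromSpecFunField x) = {genericPoint X} := by
    refine Set.eq_singleton_iff_nonempty_unique_mem.mpr ⟨Set.range_nonempty _, ?_⟩
    rintro _ ⟨p, rfl⟩
    exact fromSpecFunField_apply x p
  rw [this]
  exact genericPoint_closure X

omit [IsIntegral Y] in
theorem isSeparated_of_isSeparated_over [IsSeparated y] : Y.IsSeparated := by
  refine ⟨?_⟩
  rw [← terminal.comp_from y]
  infer_instance

/-- An embedding of function fields is induced by a morphism if the local rings of the source are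
valuation rings and the target is proper. -/
theorem exists_hom_of_algHom [IsProper y] (ι : FunField y →ₐ[K] FunField x)
    (hx : ∀ q f, f ∈ localAlg x q ∨ f⁻¹ ∈ localAlg x q) :
    ∃ f : X ⟶ Y, fromSpecFunField x ≫ f =
      Spec.map (CommRingCat.ofHom ι.toRingHom) ≫ fromSpecFunField y := by
  have := isSeparated_of_isSeparated_over y
  let := ι.toRingHom.toAlgebra
  have : IsScalarTower K (FunField y) (FunField x) :=
    IsScalarTower.of_algebraMap_eq fun c => (ι.commutes c).symm
  let h : Spec (.of (FunField x)) ⟶ Y :=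
    Spec.map (CommRingCat.ofHom ι.toRingHom) ≫ fromSpecFunField y
  have hh : h ≫ y = fromSpecFunField x ≫ x := by
    rw [fromSpecFunField_comp, Category.assoc, fromSpecFunField_comp, ← Spec.map_comp]
    congr 1
    exact CommRingCat.hom_ext (RingHom.ext fun c => ι.commutes c)
  obtain ⟨φ, hφ⟩ : ∃ φ : X ⤏ Y, φ.fromFunctionField = h :=
    ⟨_, Scheme.RationalMap.fromFunctionField_ofFunctionField x y h hh⟩
  -- No point is fundamental when all local rings are valuation rings, so the rational map is
  -- defined everywhere.
  obtain ⟨g, hgφ, hdom⟩ : ∃ g : X.PartialMap Y, g.toRationalMap = φ ∧ g.domain = ⊤ :=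
    ⟨φ.toPartialMap, φ.toRationalMap_toPartialMap, by
      refine top_le_iff.mp fun q _ => mem_domain_of_not_isFundamental x y φ hφ.symm ?_
      rintro ⟨f, hf, hf'⟩
      exact (hx q _).elim hf hf'⟩
  let e : X ≅ g.domain := X.topIso.symm ≪≫ X.isoOfEq hdom.symm
  have he : e.hom ≫ g.domain.ι = 𝟙 X := by
    simp [e]
  exact ⟨e.hom ≫ g.hom, (g.fromSpecStalk_comp_hom e.hom he).trans ((congrArg _ hgφ).trans hφ)⟩

theorem comp_eq_of_fromSpecFunField (f : X ⟶ Y) (ι : FunField y →ₐ[K] FunField x)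
    (h : fromSpecFunField x ≫ f = Spec.map (CommRingCat.ofHom ι.toRingHom) ≫ fromSpecFunField y) :
    f ≫ y = x := by
  refine ext_of_isDominant (fromSpecFunField x) ?_
  rw [reassoc_of% h, fromSpecFunField_comp, fromSpecFunField_comp, ← Spec.map_comp]
  congr 1
  refine CommRingCat.hom_ext (RingHom.ext fun c => ?_)
  exact ι.commutes c

/-- Proper curves whose local rings are valuation rings are determined by the function field. -/
theorem exists_iso_of_algEquiv [IsProper x] [IsProper y] (ε : FunField y ≃ₐ[K] FunField x)
    (hx : ∀ q f, f ∈ localAlg x q ∨ f⁻¹ ∈ localAlg x q)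
    (hy : ∀ q f, f ∈ localAlg y q ∨ f⁻¹ ∈ localAlg y q) : ∃ e : X ≅ Y, e.hom ≫ y = x := by
  have := isSeparated_of_isSeparated_over x
  have := isSeparated_of_isSeparated_over y
  obtain ⟨f, hf⟩ := exists_hom_of_algHom x y ε.toAlgHom hx
  obtain ⟨g, hg⟩ := exists_hom_of_algHom y x ε.symm.toAlgHom hy
  have h1 : f ≫ g = 𝟙 X := by
    refine ext_of_isDominant (fromSpecFunField x) ?_
    rw [reassoc_of% hf, hg, ← Spec.map_comp_assoc, Category.comp_id]
    refine Eq.trans ?_ (Category.id_comp _)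
    congr 1
    rw [← Spec.map_id]
    congr 1
    exact CommRingCat.hom_ext (RingHom.ext fun c => ε.apply_symm_apply c)
  have h2 : g ≫ f = 𝟙 Y := by
    refine ext_of_isDominant (fromSpecFunField y) ?_
    rw [reassoc_of% hg, hf, ← Spec.map_comp_assoc, Category.comp_id]
    refine Eq.trans ?_ (Category.id_comp _)
    congr 1
    rw [← Spec.map_id]
    congr 1
    exact CommRingCat.hom_ext (RingHom.ext fun c => ε.symm_apply_apply c)
  exact ⟨⟨f, g, h1, h2⟩, comp_eq_of_fromSpecFunField x y f ε.toAlgHom hf⟩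

theorem nonempty_algEquiv_of_adjoin_eq_top {K E F : Type*} [Field K] [Field E] [Field F]
    [Algebra K E] [Algebra K F] {a : E} {b : F} (ha : Transcendental K a) (hb : Transcendental K b)
    (ha' : IntermediateField.adjoin K {a} = ⊤) (hb' : IntermediateField.adjoin K {b} = ⊤) :
    Nonempty (E ≃ₐ[K] F) := by
  exact ⟨((RatFunc.algEquivOfTranscendental a ha).trans
    ((IntermediateField.equivOfEq ha').trans IntermediateField.topEquiv)).symm.trans
    ((RatFunc.algEquivOfTranscendental b hb).trans
    ((IntermediateField.equivOfEq hb').trans IntermediateField.topEquiv))⟩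

end ProperCurves

/-! ### Integrality of `Proj` of a graded domain. -/

section ProjIntegral

/-- A nonzero element of positive degree makes the zero ideal a point of `Proj`; it lies in every
nonempty open set, whence irreducibility. Stalks embed in localizations of the domain, whence
reducedness. -/
theorem AlgebraicGeometry.Proj.isIntegral {A : Type u} [CommRing A] [IsDomain A] {σ : Type*}
    [SetLike σ A] [AddSubgroupClass σ A] (𝒜 : ℕ → σ) [GradedRing 𝒜] {m : ℕ} {f : A}
    (hf : f ∈ 𝒜 m) (hm : 0 < m) (hf0 : f ≠ 0) : IsIntegral (Proj 𝒜) := by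
  let η : ProjectiveSpectrum 𝒜 := ⟨⊥, by
      rw [HomogeneousIdeal.toIdeal_bot]
      exact Ideal.isPrime_bot, fun h => by
      have h1 : f ∈ HomogeneousIdeal.irrelevant 𝒜 := by
        rw [HomogeneousIdeal.mem_irrelevant_iff, GradedRing.proj_apply,
          DirectSum.decompose_of_mem_ne 𝒜 hf hm.ne']
      exact hf0 ((Ideal.mem_bot).mp (h h1))⟩
  have hη (U : Set (Proj 𝒜)) (hU : IsOpen U) (hne : U.Nonempty) : (show Proj 𝒜 from η) ∈ U := by
    obtain ⟨x, hx⟩ := hne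
    obtain ⟨_, ⟨g, rfl⟩, hxg, hgU⟩ :=
      (ProjectiveSpectrum.isTopologicalBasis_basic_opens 𝒜).exists_subset_of_mem_open hx hU
    refine hgU fun hg => ?_
    obtain rfl : g = 0 := (Ideal.mem_bot).mp hg
    exact hxg (Ideal.zero_mem _)
  have : IrreducibleSpace (Proj 𝒜) :=
    { isPreirreducible_univ := fun U V hU hV hU' hV' =>
        ⟨η, trivial, hη U hU (hU'.mono Set.inter_subset_right),
          hη V hV (hV'.mono Set.inter_subset_right)⟩
      toNonempty := ⟨η⟩ }
  have (x : Proj 𝒜) : _root_.IsReduced ((Proj 𝒜).presheaf.stalk x) := by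
    have hx : x.asHomogeneousIdeal.toIdeal.IsPrime := ProjectiveSpectrum.isPrime x
    let ρ := (algebraMap (HomogeneousLocalization.AtPrime 𝒜 x.asHomogeneousIdeal.toIdeal)
      (Localization.AtPrime x.asHomogeneousIdeal.toIdeal)).comp
      (Proj.stalkIso 𝒜 x).commRingCatIsoToRingEquiv.toRingHom
    have hdom : IsDomain (Localization.AtPrime x.asHomogeneousIdeal.toIdeal) :=
      IsLocalization.isDomain_localization x.asHomogeneousIdeal.toIdeal.primeCompl_le_nonZeroDivisors
    refine isReduced_of_injective ρ ?_
    exact (HomogeneousLocalization.val_injective _).comp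
      (Proj.stalkIso 𝒜 x).commRingCatIsoToRingEquiv.injective
  have := isReduced_of_isReduced_stalk (Proj 𝒜)
  exact isIntegral_of_irreducibleSpace_of_isReduced _

end ProjIntegral

/-! ### The projective line: properness, local rings and function field. -/

section ProjectiveLine

open DelPezzo

attribute [local instance] MvPolynomial.gradedAlgebra

variable (K : Type u) [Field K]

instance (n : ℕ) : IsIntegral (projectiveSpace K n) :=
  Proj.isIntegral (f := MvPolynomial.X 0) _
    ((MvPolynomial.mem_homogeneousSubmodule 1 _).mpr (MvPolynomial.isHomogeneous_X K 0)) one_pos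
    (MvPolynomial.X_ne_zero 0)

instance (n : ℕ) : IsProper (projectiveSpaceHom K n) := by
  have : Algebra.FiniteType (MvPolynomial.homogeneousSubmodule (Fin (n + 1)) K 0)
      (MvPolynomial (Fin (n + 1)) K) :=
    have : IsScalarTower K (MvPolynomial.homogeneousSubmodule (Fin (n + 1)) K 0)
        (MvPolynomial (Fin (n + 1)) K) := IsScalarTower.of_algebraMap_eq (R := K)
        (S := MvPolynomial.homogeneousSubmodule (Fin (n + 1)) K 0) fun _ => rfl
    Algebra.FiniteType.of_restrictScalars_finiteType K _ _
  -- Homogeneous polynomials of degree zero are the constants, so the structure morphism factors as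
  -- a proper morphism followed by a closed immersion.
  have h : Function.Surjective
      (algebraMap K (MvPolynomial.homogeneousSubmodule (Fin (n + 1)) K 0)) := by
    rintro ⟨p, hp⟩
    rw [MvPolynomial.homogeneousSubmodule_zero, Submodule.mem_one] at hp
    obtain ⟨c, hc⟩ := hp
    exact ⟨c, Subtype.ext hc⟩
  have : IsClosedImmersion (Spec.map (CommRingCat.ofHom
      (algebraMap K (MvPolynomial.homogeneousSubmodule (Fin (n + 1)) K 0)))) :=
    IsClosedImmersion.spec_of_surjective _ h
  infer_instance

end ProjectiveLine

open MvPolynomial in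
theorem MvPolynomial.aeval_mul_of_isHomogeneous {σ R S : Type*} [Fintype σ] [CommSemiring R]
    [CommSemiring S] [Algebra R S] {p : MvPolynomial σ R} {n : ℕ} (hp : p.IsHomogeneous n)
    (x : σ → S) (c : S) : aeval (fun i => x i * c) p = aeval x p * c ^ n := by
  rw [aeval_def, aeval_def, eval₂_eq', eval₂_eq', Finset.sum_mul]
  refine Finset.sum_congr rfl fun d hd => ?_
  have h : ∑ i, d i = n := by
    rw [← Finsupp.degree_eq_sum, Finsupp.degree_eq_weight_one]
    exact hp (mem_support_iff.mp hd)
  simp_rw [mul_pow]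
  rw [Finset.prod_mul_distrib, Finset.prod_pow_eq_pow_sum, h, mul_assoc]

section ProjectiveLine

open DelPezzo HomogeneousLocalization

attribute [local instance] MvPolynomial.gradedAlgebra

variable (K : Type u) [Field K]

/-- The coordinate ring of the standard chart `xᵢ ≠ 0` of the projective line. -/
abbrev LineChart (i : Fin 2) : Type u :=
  Away (MvPolynomial.homogeneousSubmodule (Fin 2) K) (MvPolynomial.X i)

noncomputable instance (i : Fin 2) : Algebra K (LineChart K i) :=
  ((fromZeroRingHom (MvPolynomial.homogeneousSubmodule (Fin 2) K) _).comp
    (algebraMap K (MvPolynomial.homogeneousSubmodule (Fin 2) K 0))).toAlgebra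

namespace LineChart

variable {K}

theorem X_mem (i : Fin 2) : (MvPolynomial.X i : MvPolynomial (Fin 2) K) ∈
    MvPolynomial.homogeneousSubmodule (Fin 2) K 1 :=
  (MvPolynomial.mem_homogeneousSubmodule 1 _).mpr (MvPolynomial.isHomogeneous_X K i)

variable (K) in
/-- The open immersion of the standard chart. -/
noncomputable def map (i : Fin 2) : Spec (.of (LineChart K i)) ⟶ projectiveSpace K 1 :=
  Proj.awayι (MvPolynomial.homogeneousSubmodule (Fin 2) K) (MvPolynomial.X i) (X_mem i) one_pos

instance (i : Fin 2) : IsOpenImmersion (map K i) :=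
  inferInstanceAs (IsOpenImmersion (Proj.awayι _ _ (X_mem i) one_pos))

variable (K) in
theorem map_comp (i : Fin 2) : map K i ≫ projectiveSpaceHom K 1 =
    Spec.map (CommRingCat.ofHom (algebraMap K (LineChart K i))) := by
  change Proj.awayι (MvPolynomial.homogeneousSubmodule (Fin 2) K) (MvPolynomial.X i)
    (X_mem i) one_pos ≫ Proj.toSpecZero (MvPolynomial.homogeneousSubmodule (Fin 2) K) ≫
      Spec.map (CommRingCat.ofHom (algebraMap K (MvPolynomial.homogeneousSubmodule (Fin 2) K 0))) = _
  rw [Proj.awayι_toSpecZero_assoc, ← Spec.map_comp]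
  rfl

theorem exists_mem_range (q : projectiveSpace K 1) : ∃ i, q ∈ Set.range (map K i) := by
  have h := Proj.iSup_basicOpen_eq_top' (MvPolynomial.homogeneousSubmodule (Fin 2) K)
    (MvPolynomial.X : Fin 2 → _) (fun i => ⟨1, X_mem i⟩) (by
      have h1 := MvPolynomial.adjoin_range_X (R := K) (σ := Fin 2)
      refine top_le_iff.mp fun p _ => ?_
      have hp : p ∈ Algebra.adjoin K (Set.range MvPolynomial.X) := h1 ▸ Algebra.mem_top
      induction hp using Algebra.adjoin_induction with
      | mem p hp => exact Algebra.subset_adjoin hp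
      | algebraMap c =>
        let c' := algebraMap K (MvPolynomial.homogeneousSubmodule (Fin 2) K 0) c
        exact Subalgebra.algebraMap_mem _ c'
      | add p q _ _ hp hq => exact add_mem (hp trivial) (hq trivial)
      | mul p q _ _ hp hq => exact mul_mem (hp trivial) (hq trivial))
  obtain ⟨i, hi⟩ := TopologicalSpace.Opens.mem_iSup.mp (h.ge (show q ∈ (⊤ : Scheme.Opens _) from trivial))
  refine ⟨i, ?_⟩
  rw [← Proj.opensRange_awayι _ _ (X_mem i) one_pos] at hi
  exact hi

/-- The coordinate `xⱼ / xᵢ`. -/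
noncomputable def coord (i j : Fin 2) : LineChart K i :=
  Away.mk _ (X_mem i) 1 (MvPolynomial.X j) (X_mem j)

theorem val_coord_mul (i j : Fin 2) : (coord i j : LineChart K i).val *
    algebraMap (MvPolynomial (Fin 2) K) _ (MvPolynomial.X i) =
      algebraMap (MvPolynomial (Fin 2) K) _ (MvPolynomial.X j) := by
  rw [coord, Away.val_mk, Localization.mk_eq_mk']
  simp_rw [pow_one]
  exact IsLocalization.mk'_spec _ _ _

/-- The embedding of the chart in the localization of the polynomial ring. -/
noncomputable def valHom (i : Fin 2) :
    LineChart K i →ₐ[K] Localization.Away (MvPolynomial.X i : MvPolynomial (Fin 2) K) where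
  __ := algebraMap (LineChart K i) (Localization.Away (MvPolynomial.X i : MvPolynomial (Fin 2) K))
  commutes' _ := rfl

/-- A fraction `a / xᵢⁿ` with `a` homogeneous of degree `n` is the dehomogenization of `a`, obtained
by `xᵢ ↦ 1`, evaluated at `xⱼ / xᵢ`. -/
theorem aeval_coord_surjective {i j : Fin 2} (hij : i ≠ j) :
    Function.Surjective (Polynomial.aeval (R := K) (coord i j : LineChart K i)) := by
  intro b
  obtain ⟨n, a, ha, rfl⟩ := Away.mk_surjective _ (X_mem i) b
  let g : Fin 2 → Polynomial K := fun k => if k = i then 1 else Polynomial.X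
  refine ⟨MvPolynomial.aeval g a, val_injective _ ?_⟩
  have h1 : ((valHom i).comp (Polynomial.aeval (R := K) (coord i j : LineChart K i))).comp
      (MvPolynomial.aeval g) = MvPolynomial.aeval fun k => (coord i k : LineChart K i).val := by
    refine MvPolynomial.algHom_ext fun k => ?_
    rw [MvPolynomial.aeval_X, AlgHom.comp_apply, MvPolynomial.aeval_X, AlgHom.comp_apply]
    by_cases hk : k = i
    · subst hk
      have hu : IsUnit (algebraMap (MvPolynomial (Fin 2) K)
          (Localization.Away (MvPolynomial.X k : MvPolynomial (Fin 2) K)) (MvPolynomial.X k)) :=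
        IsLocalization.Away.algebraMap_isUnit _
      have h := val_coord_mul (K := K) k k
      rw [hu.mul_eq_right] at h
      simp [g, h]
    · obtain rfl : k = j := by omega
      simp only [g, if_neg hk, Polynomial.aeval_X]
      rfl
  have h2 := MvPolynomial.aeval_mul_of_isHomogeneous
    ((MvPolynomial.mem_homogeneousSubmodule _ _).mp ha)
    (fun k => (coord i k : LineChart K i).val) (algebraMap (MvPolynomial (Fin 2) K) _ (MvPolynomial.X i))
  simp_rw [val_coord_mul] at h2
  rw [← h1] at h2
  have h3 : (MvPolynomial.aeval fun k => algebraMap (MvPolynomial (Fin 2) K)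
      (Localization.Away (MvPolynomial.X i : MvPolynomial (Fin 2) K)) (MvPolynomial.X k)) a =
      algebraMap _ _ a := by
    refine DFunLike.congr_fun (g := IsScalarTower.toAlgHom K _ _) ?_ a
    exact MvPolynomial.algHom_ext fun k => MvPolynomial.aeval_X _ k
  rw [h3, smul_eq_mul, mul_one, ← map_pow] at h2
  rw [Away.val_mk, Localization.mk_eq_mk', IsLocalization.eq_mk'_iff_mul_eq]
  exact h2.symm

/-- The dehomogenization `xᵢ ↦ 1` extends to the localization and is a left inverse. -/
theorem aeval_coord_injective {i j : Fin 2} (hij : i ≠ j) :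
    Function.Injective (Polynomial.aeval (R := K) (coord i j : LineChart K i)) := by
  let g : Fin 2 → Polynomial K := fun k => if k = i then 1 else Polynomial.X
  have hu : IsUnit ((MvPolynomial.aeval g).toRingHom (MvPolynomial.X i : MvPolynomial (Fin 2) K)) := by
    simp [g]
  let ρ : Localization.Away (MvPolynomial.X i : MvPolynomial (Fin 2) K) →+* Polynomial K :=
    IsLocalization.Away.lift _ hu
  have hρ (p) : ρ (algebraMap _ _ p) = MvPolynomial.aeval g p := IsLocalization.Away.lift_eq _ hu p
  have h : (ρ.comp (valHom i).toRingHom).comp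
      (Polynomial.aeval (R := K) (coord i j : LineChart K i)).toRingHom = RingHom.id _ := by
    refine Polynomial.ringHom_ext (fun c => ?_) ?_
    · change ρ (valHom i (Polynomial.aeval (coord i j) (algebraMap K (Polynomial K) c))) = _
      rw [AlgHom.commutes, AlgHom.commutes,
        IsScalarTower.algebraMap_apply K (MvPolynomial (Fin 2) K), hρ, AlgHom.commutes]
      rfl
    · have h := congrArg ρ (val_coord_mul (K := K) i j)
      rw [map_mul, hρ, hρ, MvPolynomial.aeval_X, MvPolynomial.aeval_X] at h
      simp only [g, if_true, if_neg hij.symm, mul_one] at h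
      change ρ (valHom i (Polynomial.aeval (coord i j) Polynomial.X)) = _
      rw [Polynomial.aeval_X]
      exact h
  exact Function.LeftInverse.injective (g := ρ.comp (valHom i).toRingHom) fun p => DFunLike.congr_fun h p

/-- The coordinate ring of the chart is a polynomial ring. -/
noncomputable def equivPolynomial {i j : Fin 2} (hij : i ≠ j) : Polynomial K ≃ₐ[K] LineChart K i :=
  AlgEquiv.ofBijective _ ⟨aeval_coord_injective hij, aeval_coord_surjective hij⟩

theorem exists_ne (i : Fin 2) : ∃ j, i ≠ j := ⟨i + 1, by fin_cases i <;> decide⟩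

instance (i : Fin 2) : IsDomain (LineChart K i) :=
  (equivPolynomial (K := K) (exists_ne i).choose_spec).symm.toMulEquiv.isDomain _

instance (i : Fin 2) : IsPrincipalIdealRing (LineChart K i) :=
  .of_surjective (equivPolynomial (K := K) (exists_ne i).choose_spec).toRingHom
    (equivPolynomial (K := K) (exists_ne i).choose_spec).surjective

end LineChart

/-- Over a principal ideal domain `f` can be written in lowest terms; coprime numerator and
denominator do not both vanish at `q`. -/
theorem mem_or_inv_mem_localAlg_of_isPrincipalIdealRing {K : Type u} [Field K] {X : Scheme.{u}}
    [IsIntegral X] (s : X ⟶ Spec (.of K)) {B : Type u} [CommRing B] [IsDomain B] [Algebra K B]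
    [IsPrincipalIdealRing B] (u : Spec (.of B) ⟶ X) [IsOpenImmersion u]
    (hu : u ≫ s = Spec.map (CommRingCat.ofHom (algebraMap K B))) {q : X} (hq : q ∈ Set.range u)
    (f : FunField s) : f ∈ localAlg s q ∨ f⁻¹ ∈ localAlg s q := by
  obtain ⟨Q, hQ, rfl⟩ := exists_chartPoint_eq u hq
  obtain ⟨a, b, hb, hf⟩ := exists_mul_chartMap_eq s u hu f
  obtain ⟨d, hd⟩ := IsPrincipalIdealRing.principal (Ideal.span {a, b})
  rw [Ideal.submodule_span_eq] at hd
  obtain ⟨a', rfl⟩ := Ideal.mem_span_singleton.mp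
    (hd ▸ Ideal.subset_span (Set.mem_insert a {b}) : a ∈ Ideal.span {d})
  obtain ⟨b', rfl⟩ := Ideal.mem_span_singleton.mp
    (hd ▸ Ideal.subset_span (Set.mem_insert_of_mem _ rfl) : b ∈ Ideal.span {d})
  obtain ⟨x, y, hxy⟩ := Ideal.mem_span_pair.mp (hd ▸ Ideal.mem_span_singleton_self d)
  have hd0 : d ≠ 0 := left_ne_zero_of_mul hb
  have h1 : x * a' + y * b' = 1 := mul_left_cancel₀ hd0 (by linear_combination hxy)
  have hfab : f * chartMap s u hu b' = chartMap s u hu a' := by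
    refine mul_left_cancel₀ ((map_ne_zero_iff _ (chartMap_injective s u hu)).mpr hd0) ?_
    rw [← map_mul, ← hf, map_mul]
    ring
  by_cases hb' : b' ∈ Q
  · have ha' : a' ∉ Q := fun ha' => hQ.ne_top ((Ideal.eq_top_iff_one _).mpr
      (h1 ▸ Q.add_mem (Q.mul_mem_left _ ha') (Q.mul_mem_left _ hb')))
    refine Or.inr ((mem_localAlg_chartPoint_iff s u hu Q _).mpr ⟨b', a', ha', ?_⟩)
    have hf0 : f ≠ 0 := by
      rintro rfl
      rw [zero_mul, eq_comm, map_eq_zero_iff _ (chartMap_injective s u hu)] at hfab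
      exact ha' (hfab ▸ Q.zero_mem)
    rw [← hfab, inv_mul_cancel_left₀ hf0]
  · exact Or.inl ((mem_localAlg_chartPoint_iff s u hu Q _).mpr ⟨a', b', hb', hfab⟩)

theorem projectiveLine_mem_or_inv_mem_localAlg (q : projectiveSpace K 1)
    (f : FunField (projectiveSpaceHom K 1)) :
    f ∈ localAlg (projectiveSpaceHom K 1) q ∨ f⁻¹ ∈ localAlg (projectiveSpaceHom K 1) q := by
  obtain ⟨i, hi⟩ := LineChart.exists_mem_range q
  exact mem_or_inv_mem_localAlg_of_isPrincipalIdealRing _ (LineChart.map K i)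
    (LineChart.map_comp K i) hi f

theorem projectiveLine_exists_adjoin_eq_top : ∃ τ : FunField (projectiveSpaceHom K 1),
    Transcendental K τ ∧ IntermediateField.adjoin K {τ} = ⊤ := by
  let θ := chartMap (projectiveSpaceHom K 1) (LineChart.map K 0) (LineChart.map_comp K 0)
  have hθ : Function.Injective θ := chartMap_injective _ _ _
  let T : LineChart K 0 := LineChart.coord 0 1
  have hT (p : Polynomial K) : Polynomial.aeval (θ T) p = θ (Polynomial.aeval T p) :=
    Polynomial.aeval_algHom_apply θ T p
  refine ⟨θ T, ?_, top_le_iff.mp fun f _ => ?_⟩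
  · refine transcendental_iff_injective.mpr fun p p' h => ?_
    rw [hT, hT] at h
    exact LineChart.aeval_coord_injective zero_ne_one (hθ h)
  · obtain ⟨a, b, hb, h⟩ := exists_mul_chartMap_eq _ _ (LineChart.map_comp K 0) f
    obtain ⟨p, rfl⟩ := LineChart.aeval_coord_surjective zero_ne_one a
    obtain ⟨r, rfl⟩ := LineChart.aeval_coord_surjective zero_ne_one b
    refine (IntermediateField.mem_adjoin_simple_iff K f).mpr ⟨p, r, ?_⟩
    rw [hT, hT, eq_div_iff ((map_ne_zero_iff _ hθ).mpr hb)]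
    exact h

end ProjectiveLine

/-! ### Assembly of the theorem. -/

section Main

open DelPezzo

variable {K : Type u} [Field K] {S : Scheme.{u}} [IsIntegral S]
  {s : S ⟶ Spec (.of K)} {Z Z' : Scheme.{u}} {z : Z ⟶ Spec (.of K)}

/-- A cylinder over an open subset of a curve in a del Pezzo surface of Picard number one gives
an embedding of function fields that has exactly one fundamental point; this point is rational,
and so is the curve. -/
theorem DelPezzo.IsSmoothDelPezzoSurface.exists_algHom (hS : IsSmoothDelPezzoSurface s)
    (hρ : picardNumber S = 1) (hz : IsSmoothCurve z) {i : cylinder z ⟶ S} (hi : IsCylinder s z i)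
    {z' : Z' ⟶ Spec (.of K)} [IsIntegral Z'] [SmoothOfRelativeDimension 1 z'] (j : Z ⟶ Z')
    [IsOpenImmersion j] (hj : j ≫ z' = z) :
    ∃ ι : FunField z' →ₐ[K] FunField s,
      Spec.map (CommRingCat.ofHom ι.toRingHom) ≫ fromSpecFunField z' =
        (inducedMap hz hi j).fromFunctionField ∧
      letI := ι.toRingHom.toAlgebra
      (∃ p : Spec (.of K) ⟶ S, p ≫ s = 𝟙 _ ∧ Set.range p = {q | IsFundamental s z' q}) ∧
      Scheme.BirationalOver s (affineSpaceHom K 2) ∧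
      ∃ τ : FunField z', Transcendental K τ ∧ IntermediateField.adjoin K {τ} = ⊤ := by
  have := hS.smooth
  have := hS.proper
  have := hS.geometricallyIntegral
  obtain ⟨H, -, hH⟩ := hS.ample
  obtain ⟨ι, ⟨D⟩, hι⟩ := exists_cylinderChart hz hi j hj
  let := ι.toRingHom.toAlgebra
  have : IsScalarTower K (FunField z') (FunField s) :=
    IsScalarTower.of_algebraMap_eq fun c => (ι.commutes c).symm
  have hK := mem_range_of_isAlgebraic s 2
  obtain ⟨c, hc⟩ := D.exists_isFundamental hρ ⟨_, hH⟩
  obtain ⟨τ, hτ, htop⟩ := D.exists_adjoin_eq_top hc hK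
  exact ⟨ι, hι, D.exists_point_of_isFundamental hc hK, D.birationalOver_affineSpace hτ htop,
    τ, hτ, htop⟩

end Main

theorem mainTheorem5 {K : Type u} [Field K] [CharZero K]
    {S : Scheme.{u}} [IsIntegral S] (s : S ⟶ Spec (.of K))
    (hS : DelPezzo.IsSmoothDelPezzoSurface s)
    (hρ : DelPezzo.picardNumber S = 1)
    {Z : Scheme.{u}} (z : Z ⟶ Spec (.of K)) (hz : DelPezzo.IsSmoothCurve z)
    (i : DelPezzo.cylinder z ⟶ S) (hi : DelPezzo.IsCylinder s z i) :
    -- `S` is `K`-rational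
    Scheme.BirationalOver s (DelPezzo.affineSpaceHom K 2) ∧
    -- for the smooth projective model `Z'` of `Z`:
    ∀ {Z' : Scheme.{u}} (z' : Z' ⟶ Spec (.of K)) (j : Z ⟶ Z'),
      DelPezzo.IsSmoothProjectiveModel z z' j →
      -- the rational map `S ⇢ Z'` has a unique base point, and it is `K`-rational
      (∃ p : Spec (.of K) ⟶ S, p ≫ s = 𝟙 _ ∧
        ((DelPezzo.inducedMap hz hi j).domain : Set S)ᶜ = Set.range p) ∧
      -- `Z'` is isomorphic to the projective line over `K`
      ∃ e : Z' ≅ DelPezzo.projectiveSpace K 1,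
        e.hom ≫ DelPezzo.projectiveSpaceHom K 1 = z' := by
  refine ⟨?_, fun {Z'} z' j hj => ?_⟩
  · have := hz.integral
    have := hz.smooth
    -- Rationality needs no projective model: `Z` itself serves as the curve, since properness of
    -- the curve only enters in the comparison of fundamental points with the domain of the rational
    -- map and in the identification with the projective line.
    obtain ⟨ι, -, -, h, -⟩ := hS.exists_algHom hρ hz hi (z' := z) (𝟙 Z) (Category.id_comp z)
    exact h
  · have := hj.curve.integral
    have := hj.curve.smooth
    have := hj.openImmersion
    have := hj.proper
    obtain ⟨ι, hι, ⟨p, hp, hrange⟩, -, τ, hτ, htop⟩ := hS.exists_algHom hρ hz hi j hj.isOver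
    let := ι.toRingHom.toAlgebra
    have : IsScalarTower K (FunField z') (FunField s) :=
      IsScalarTower.of_algebraMap_eq fun c => (ι.commutes c).symm
    refine ⟨⟨p, hp, (compl_domain_eq s z' _ hι).trans hrange.symm⟩, ?_⟩
    obtain ⟨τ', hτ', htop'⟩ := projectiveLine_exists_adjoin_eq_top K
    obtain ⟨ε⟩ := nonempty_algEquiv_of_adjoin_eq_top hτ' hτ htop' htop
    exact exists_iso_of_algEquiv z' (DelPezzo.projectiveSpaceHom K 1) ε
      (mem_or_inv_mem_localAlg z') (projectiveLine_mem_or_inv_mem_localAlg K)
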